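/- **Setting.** Let $d\ge1$, $n\ge 0$, let $\Omega\subseteq\mathbb R^d$ be open with finite Lebesgue measure, and put $H=L_2(\Omega,\mathbb C^n)$ with $\langle u,v\rangle=\int_\Omega u\cdot\overline v\,dx$. Let $V$ be a closed subspace of $W^{1,2}(\Omega,\mathbb C^n)$ which is dense in $H$, and let $p_*\in(2,\infty)$ be such that there is a continuous embedding $V\subseteq L_{p_*}(\Omega,\mathbb C^n)$ (for $d\ge3$ and $\Omega$ regular one can take $p_*=\frac{2d}{d-2}$). A sesquilinear form $a\colon V\times V\to\mathbb C$ with $|a(u,v)|\le C\|u\|_V\|v\|_V$ and $\operatorname{Re}a(u,u)\ge c\|u\|_V^2$ ($c>0$) defines an operator $A$ in $H$: $u\in D(A)$ and $Au=f\in H$ if and only if $u\in V$ and $\langle f,\varphi\rangle=a(u,\varphi)$ for all $\varphi\in V$. For $0<s<1$ put $A^{-s}=\frac{\sin\pi s}{\pi}\int_0^\infty t^{-s}(t+A)^{-1}\,dt$, and let $A^{-0}=I$, $A^s=(A^{-s})^{-1}$. For $0\le s\le 1$ let $H_s=D(A^s)$ with norm $\|A^su\|_H$, and let $H_{-s}$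 be the completion of $H$ with respect to the norm $\|A^{-s}u\|_H$. Let $A_{-s}$ be the operator in $H_{-s}$ with domain $H_{1-s}$ which is the closure of $A$ in $H_{-s}$. We call $A$ a *Kato operator* if $H_{1/2}=V$ with equivalent norms. Let $r\in[1,\infty]$, $\widetilde B\in L_r(\Omega,\mathbb C^{n\times n})$, and $Bu(x)=\widetilde B(x)u(x)$. For $0\le\gamma<1$ and $B$ mapping $H_{1-\gamma}$ boundedly into $H\subseteq H_{-\gamma}$, a number $\lambda\in\mathbb C$ is a *$\gamma$-weak eigenvalue of $A-B$* if there is $0\ne u\in H_{1-\gamma}$ with $A_{-\gamma}u-Bu=\lambda u$ in $H_{-\gamma}$; it is an *eigenvalue of $A-B$* if there is $0\neq u\in D(A)$ with $Bu\in H$ and $Au-Bu=\lambda u$. **Proposition.** 1. Suppose that - $r=2$ if $d=1$; $r>2$ if $d=2$; $r=\frac{2p_*}{p_*-2}$ if $d\ge3$; - if $d=1$, then $V\subseteq L_\infty(\Omega,\mathbb C^n)$ continuously; if $d=2$, then $V\subseteq L_q(\Omega,\mathbb C^n)$ continuously for every $q\in(2,\infty)$. Then $B|_V\colon V\to H$ is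 bounded. 2. If $A$ is a Kato operator, $\gamma\in[1/2,1)$ and $$\gamma\le\widetilde\gamma_0:=\begin{cases}1-\dfrac{p_*}{(p_*-2)r}&\text{if }r<\infty,\\ 1&\text{if }r=\infty,\end{cases}$$ then $B|_{H_{1-\gamma}}\colon H_{1-\gamma}\to H$ is bounded. 3. If $A$ is a Kato operator, $2<r<\frac{2p_*}{p_*-2}$, and if there is a (finite) $p\ge\frac{2r}{r-2}$ with $D(A)\subseteq L_p(\Omega,\mathbb C^n)$, then $$\widetilde\gamma_p:=\frac12\Bigl(\frac12-\frac1r-\frac1p\Bigr)\Bigl(\frac1{p_*}-\frac1p\Bigr)^{-1}\in[0,1/2),$$ and for all $\gamma\in[0,\widetilde\gamma_p]$ the operator $B|_{H_{1-\gamma}}\colon H_{1-\gamma}\to H$ is bounded. 4. Let $A$ be a Kato operator and $\gamma\in[0,1)$. Suppose that the hypotheses of 1 hold and $\gamma\le1/2$, or that $\widetilde\gamma_0\ge1/2$ and $\gamma\le\widetilde\gamma_0$, or that the hypotheses of 3 hold (with some $p$) and $\gamma\le\widetilde\gamma_p$. Then $B|_{H_{1-\gamma}}\colon H_{1-\gamma}\to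 H$ is bounded, and $\lambda\in\mathbb C$ is a $\gamma$-weak eigenvalue of $A-B$ if and only if $\lambda$ is an eigenvalue of $A-B$. -/

import Mathlib

open MeasureTheory
open scoped ENNReal ContDiff Matrix.Norms.L2Operator

noncomputable section

namespace WeakEv

/-! ### Fractional powers and the extrapolated space of an operator of positive type -/

section Operators

variable {X : Type*} [NormedAddCommGroup X] [NormedSpace ℂ X]

/-- `R` is the bounded two-sided inverse of `A + t`. -/
def IsShiftInverse (A : X →ₗ.[ℂ] X) (t : ℝ) (R : X →L[ℂ] X) : Prop :=
  (∀ x : X, ∃ h : R x ∈ A.domain, A ⟨R x, h⟩ + (t : ℂ) • R x = x) ∧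
    ∀ u : A.domain, R (A u + (t : ℂ) • (u : X)) = u

open Classical in
/-- The bounded operator `(A + t)⁻¹` (zero if `-t` is a spectral value of `A`). -/
def shiftInverse (A : X →ₗ.[ℂ] X) (t : ℝ) : X →L[ℂ] X :=
  if h : ∃ R, IsShiftInverse A t R then h.choose else 0

/-- The bounded operator `A ^ (-s)` for an operator `A` of positive type and `0 ≤ s ≤ 1`,
given for `0 < s < 1` by
`A ^ (-s) = (sin (π s) / π) ∫₀^∞ t ^ (-s) (A + t)⁻¹ dt` (Bochner integral in operator norm). -/
def negPow (A : X →ₗ.[ℂ] X) (s : ℝ) : X →L[ℂ] X :=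
  if s = 0 then ContinuousLinearMap.id ℂ X
  else if s = 1 then shiftInverse A 0
  else (((Real.sin (Real.pi * s) / Real.pi : ℝ)) : ℂ) •
    ∫ t in Set.Ioi (0 : ℝ), ((t ^ (-s) : ℝ) : ℂ) • shiftInverse A t

/-- `A ^ s = (A ^ (-s))⁻¹` for `0 ≤ s ≤ 1`, an unbounded operator whose domain is the range
of `A ^ (-s)`. The space `H_s` is `(fracPow A s).domain` with the norm `‖A ^ s u‖`. -/
def fracPow (A : X →ₗ.[ℂ] X) (s : ℝ) : X →ₗ.[ℂ] X :=
  LinearPMap.inverse ((negPow A s : X →ₗ[ℂ] X).toPMap ⊤)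

/-- The space `X`, to be equipped with the norm `‖A ^ (-γ) u‖`. -/
def ExtrapPre (_A : X →ₗ.[ℂ] X) (_γ : ℝ) : Type _ := X

instance (A : X →ₗ.[ℂ] X) (γ : ℝ) : AddCommGroup (ExtrapPre A γ) :=
  inferInstanceAs (AddCommGroup X)

instance (A : X →ₗ.[ℂ] X) (γ : ℝ) : Module ℂ (ExtrapPre A γ) :=
  inferInstanceAs (Module ℂ X)

/-- `A ^ (-γ)` as a linear map on the copy `ExtrapPre A γ` of `X`. -/
def preMap (A : X →ₗ.[ℂ] X) (γ : ℝ) : ExtrapPre A γ →ₗ[ℂ] X :=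
  (negPow A γ : X →ₗ[ℂ] X)

instance (A : X →ₗ.[ℂ] X) (γ : ℝ) : SeminormedAddCommGroup (ExtrapPre A γ) :=
  SeminormedAddCommGroup.induced (ExtrapPre A γ) X (preMap A γ)

instance (A : X →ₗ.[ℂ] X) (γ : ℝ) : NormedSpace ℂ (ExtrapPre A γ) :=
  NormedSpace.induced ℂ (ExtrapPre A γ) X (preMap A γ)

/-- The extrapolation space `H_{-γ}`, `0 ≤ γ ≤ 1`: the completion of `X` for the norm
`‖A ^ (-γ) u‖`. -/
abbrev Extrap (A : X →ₗ.[ℂ] X) (γ : ℝ) : Type _ :=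
  UniformSpace.Completion (ExtrapPre A γ)

/-- The identity map from `X` to `ExtrapPre A γ`. -/
def toPre (A : X →ₗ.[ℂ] X) (γ : ℝ) : X →ₗ[ℂ] ExtrapPre A γ :=
  (LinearMap.id : X →ₗ[ℂ] X)

/-- The canonical embedding of `X` into `H_{-γ}`. -/
def toExtrap (A : X →ₗ.[ℂ] X) (γ : ℝ) : X →ₗ[ℂ] Extrap A γ :=
  (UniformSpace.Completion.toComplL : ExtrapPre A γ →L[ℂ] Extrap A γ).toLinearMap ∘ₗ toPre A γ

/-- The graph of `A_{-γ}`: the closure in `H_{-γ} × H_{-γ}` of the graph of `A`. -/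
def extrapGraph (A : X →ₗ.[ℂ] X) (γ : ℝ) : Submodule ℂ (Extrap A γ × Extrap A γ) :=
  (A.graph.map ((toExtrap A γ).prodMap (toExtrap A γ))).topologicalClosure

/-- `z` is a `γ`-weak eigenvalue of `A - B`, where `B : H_{1-γ} → H_{-γ}`: there is a nonzero
`u ∈ H_{1-γ}` with `A_{-γ} u - B u = z u` in `H_{-γ}`. -/
def IsWeakEigenvalue (A : X →ₗ.[ℂ] X) (γ : ℝ)
    (B : (fracPow A (1 - γ)).domain →ₗ[ℂ] Extrap A γ) (z : ℂ) : Prop :=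
  ∃ u : (fracPow A (1 - γ)).domain, u ≠ 0 ∧
    (toExtrap A γ u, B u + z • toExtrap A γ u) ∈ extrapGraph A γ

end Operators

/-! ### `L₂(Ω, ℂⁿ)` and `W^{1,2}(Ω, ℂⁿ)` -/

/-- The Hilbert space `L₂(Ω, ℂⁿ)`. -/
abbrev L2 {d : ℕ} (Ω : Set (EuclideanSpace ℝ (Fin d))) (n : ℕ) : Type :=
  Lp (EuclideanSpace ℂ (Fin n)) 2 (volume.restrict Ω)

/-- `g` is the weak partial derivative of `u` in direction `i` on `Ω`. -/
def IsWeakPartial {d n : ℕ} (Ω : Set (EuclideanSpace ℝ (Fin d))) (i : Fin d)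
    (u g : L2 Ω n) : Prop :=
  ∀ φ : EuclideanSpace ℝ (Fin d) → ℝ, ContDiff ℝ ∞ φ → HasCompactSupport φ → tsupport φ ⊆ Ω →
    ∫ x in Ω, (fderiv ℝ φ x (EuclideanSpace.single i (1 : ℝ))) • u x =
      - ∫ x in Ω, φ x • g x

theorem integrable_smul_L2 {d n : ℕ} (Ω : Set (EuclideanSpace ℝ (Fin d)))
    {φ : EuclideanSpace ℝ (Fin d) → ℝ} (hφ : Continuous φ) (hc : HasCompactSupport φ)
    (u : L2 Ω n) : Integrable (fun x => φ x • u x) (volume.restrict Ω) := by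
  have h1 : MemLp φ 2 (volume.restrict Ω) := hφ.memLp_of_hasCompactSupport hc
  have h2 : MemLp (u : EuclideanSpace ℝ (Fin d) → EuclideanSpace ℂ (Fin n)) 2
    (volume.restrict Ω) := Lp.memLp u
  have h3 := h2.smul (r := 1) h1
  exact memLp_one_iff_integrable.1 h3

/-- A test function's partial derivative is continuous with compact support. -/
theorem partial_test {d : ℕ} {φ : EuclideanSpace ℝ (Fin d) → ℝ} (h : ContDiff ℝ ∞ φ)
    (hc : HasCompactSupport φ) (v : EuclideanSpace ℝ (Fin d)) :
    Continuous (fun x => fderiv ℝ φ x v) ∧ HasCompactSupport (fun x => fderiv ℝ φ x v) :=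
  ⟨(h.continuous_fderiv (by simp)).clm_apply continuous_const, hc.fderiv_apply ℝ v⟩

theorem IsWeakPartial.add {d n : ℕ} {Ω : Set (EuclideanSpace ℝ (Fin d))} {i : Fin d}
    {u g u' g' : L2 Ω n} (h : IsWeakPartial Ω i u g) (h' : IsWeakPartial Ω i u' g') :
    IsWeakPartial Ω i (u + u') (g + g') := by
  intro φ hφ hc hs
  obtain ⟨p1, p2⟩ := partial_test hφ hc (EuclideanSpace.single i (1 : ℝ))
  have e1 : ∫ x in Ω, (fderiv ℝ φ x (EuclideanSpace.single i (1 : ℝ))) • (u + u') x =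
      (∫ x in Ω, (fderiv ℝ φ x (EuclideanSpace.single i (1 : ℝ))) • u x) +
      ∫ x in Ω, (fderiv ℝ φ x (EuclideanSpace.single i (1 : ℝ))) • u' x := by
    rw [← integral_add (integrable_smul_L2 Ω p1 p2 u) (integrable_smul_L2 Ω p1 p2 u')]
    refine integral_congr_ae ?_
    filter_upwards [Lp.coeFn_add u u'] with x hx
    rw [hx, Pi.add_apply, smul_add]
  have e2 : ∫ x in Ω, φ x • (g + g') x = (∫ x in Ω, φ x • g x) + ∫ x in Ω, φ x • g' x := by
    rw [← integral_add (integrable_smul_L2 Ω hφ.continuous hc g)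
      (integrable_smul_L2 Ω hφ.continuous hc g')]
    refine integral_congr_ae ?_
    filter_upwards [Lp.coeFn_add g g'] with x hx
    rw [hx, Pi.add_apply, smul_add]
  rw [e1, e2, h φ hφ hc hs, h' φ hφ hc hs, neg_add]

theorem IsWeakPartial.smul {d n : ℕ} {Ω : Set (EuclideanSpace ℝ (Fin d))} {i : Fin d}
    {u g : L2 Ω n} (c : ℂ) (h : IsWeakPartial Ω i u g) :
    IsWeakPartial Ω i (c • u) (c • g) := by
  intro φ hφ hc hs
  have key : ∀ (ψ : EuclideanSpace ℝ (Fin d) → ℝ) (w : L2 Ω n),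
      ∫ x in Ω, ψ x • (c • w) x = c • ∫ x in Ω, ψ x • w x := by
    intro ψ w
    rw [← integral_smul]
    refine integral_congr_ae ?_
    filter_upwards [Lp.coeFn_smul c w] with x hx
    rw [hx, Pi.smul_apply, smul_comm]
  rw [key, key, h φ hφ hc hs, smul_neg]

/-- The Sobolev space `W^{1,2}(Ω, ℂⁿ)`, realized as the space of all pairs `(u, ∇u)` of an
`L₂`-function and its weak gradient in `L₂`. The inherited norm is
`(‖u‖² + ∑ᵢ ‖∂ᵢ u‖²) ^ (1/2)`. -/
def W12 {d : ℕ} (Ω : Set (EuclideanSpace ℝ (Fin d))) (n : ℕ) :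
    Submodule ℂ (WithLp 2 (L2 Ω n × PiLp 2 (fun _ : Fin d => L2 Ω n))) where
  carrier := {w | ∀ i, IsWeakPartial Ω i w.fst (w.snd i)}
  zero_mem' := by
    intro i
    have h : IsWeakPartial Ω i (0 : L2 Ω n) 0 := by
      intro φ _ _ _
      have key : ∀ ψ : EuclideanSpace ℝ (Fin d) → ℝ,
          ∫ x in Ω, ψ x • (0 : L2 Ω n) x = 0 := by
        intro ψ
        refine integral_eq_zero_of_ae ?_
        filter_upwards [Lp.coeFn_zero (EuclideanSpace ℂ (Fin n)) 2 (volume.restrict Ω)]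
          with x hx
        have hx' : (0 : L2 Ω n) x = 0 := hx
        rw [hx', smul_zero, Pi.zero_apply]
      rw [key, key, neg_zero]
    exact h
  add_mem' := fun hw hw' i => (hw i).add (hw' i)
  smul_mem' := fun c _ hw i => (hw i).smul c

/-- The function in `L₂(Ω, ℂⁿ)` underlying an element of a subspace `V` of `W^{1,2}(Ω, ℂⁿ)`. -/
def incl {d n : ℕ} {Ω : Set (EuclideanSpace ℝ (Fin d))} (V : Submodule ℂ (W12 Ω n)) :
    V →L[ℂ] L2 Ω n :=
  (WithLp.fstL 2 ℂ (L2 Ω n) (PiLp 2 (fun _ : Fin d => L2 Ω n))).comp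
    ((W12 Ω n).subtypeL.comp V.subtypeL)

/-- There is a continuous embedding `V ⊆ L_q(Ω, ℂⁿ)`. -/
def EmbedsInLp {d n : ℕ} {Ω : Set (EuclideanSpace ℝ (Fin d))} (V : Submodule ℂ (W12 Ω n))
    (q : ℝ≥0∞) : Prop :=
  ∃ C : ℝ, ∀ v : V, eLpNorm (incl V v) q (volume.restrict Ω) ≤ ENNReal.ofReal (C * ‖v‖)

/-- `w(x) = M(x) u(x)` for almost all `x ∈ Ω`. -/
def IsMulBy {d n : ℕ} {Ω : Set (EuclideanSpace ℝ (Fin d))}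
    (M : EuclideanSpace ℝ (Fin d) → Matrix (Fin n) (Fin n) ℂ) (u w : L2 Ω n) : Prop :=
  ∀ᵐ x ∂(volume.restrict Ω), w x = Matrix.toEuclideanCLM (𝕜 := ℂ) (M x) (u x)

/-! ### Forms, associated operators, Kato operators -/

section Forms

variable {d n : ℕ} {Ω : Set (EuclideanSpace ℝ (Fin d))} {V : Submodule ℂ (W12 Ω n)}

/-- The graph of the operator `A` associated with the sesquilinear form `a` on `V`: all pairs
`(u, f)` with `u ∈ V`, `f ∈ L₂` and `a(u, φ) = ⟨f, φ⟩ = ∫ f · conj φ` for all `φ ∈ V`. -/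
def formGraph (a : V →ₗ[ℂ] V →ₗ⋆[ℂ] ℂ) : Submodule ℂ (L2 Ω n × L2 Ω n) where
  carrier := {q | ∃ v : V, incl V v = q.1 ∧ ∀ φ : V, a v φ = inner ℂ (incl V φ) q.2}
  zero_mem' := ⟨0, by simp, by simp⟩
  add_mem' := by
    rintro q q' ⟨v, h1, h2⟩ ⟨v', h1', h2'⟩
    exact ⟨v + v', by simp [h1, h1'], fun φ => by simp [h2, h2', inner_add_right]⟩
  smul_mem' := by
    rintro c q ⟨v, h1, h2⟩
    exact ⟨c • v, by simp [h1], fun φ => by simp [h2, inner_smul_right]⟩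

/-- The operator `A : D(A) → L₂(Ω, ℂⁿ)` associated with `a`, `⟨A u, φ⟩ = a(u, φ)` for all
`φ ∈ V` (well defined when `V` is dense in `L₂`). -/
def formOp (a : V →ₗ[ℂ] V →ₗ⋆[ℂ] ℂ) : L2 Ω n →ₗ.[ℂ] L2 Ω n :=
  (formGraph a).toLinearPMap

/-- The operator associated with `a` is a Kato operator: `a` is continuous and strongly accretive
on `V`, and `H_{1/2} = D(A^{1/2})` equals `V` with equivalent norms. -/
def IsKato (a : V →ₗ[ℂ] V →ₗ⋆[ℂ] ℂ) : Prop :=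
  (∃ C : ℝ, ∀ u v : V, ‖a u v‖ ≤ C * ‖u‖ * ‖v‖) ∧
  (∃ c : ℝ, 0 < c ∧ ∀ u : V, c * ‖u‖ ^ 2 ≤ (a u u).re) ∧
  LinearMap.range (incl V : V →ₗ[ℂ] L2 Ω n) = (fracPow (formOp a) (1 / 2)).domain ∧
  ∃ c C : ℝ, 0 < c ∧ ∀ (v : V) (u : (fracPow (formOp a) (1 / 2)).domain), incl V v = u →
    c * ‖v‖ ≤ ‖fracPow (formOp a) (1 / 2) u‖ ∧ ‖fracPow (formOp a) (1 / 2) u‖ ≤ C * ‖v‖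

/-- `T` is the operator of multiplication by `M` on `H_s = D(A^s)`, and is bounded from `H_s`
into `L₂`. -/
def IsBoundedMul (M : EuclideanSpace ℝ (Fin d) → Matrix (Fin n) (Fin n) ℂ)
    (A : L2 Ω n →ₗ.[ℂ] L2 Ω n) (s : ℝ) (T : (fracPow A s).domain →ₗ[ℂ] L2 Ω n) : Prop :=
  (∀ u : (fracPow A s).domain, IsMulBy M (u : L2 Ω n) (T u)) ∧
    ∃ C : ℝ, ∀ u : (fracPow A s).domain, ‖T u‖ ≤ C * ‖fracPow A s u‖

/-- `z` is an eigenvalue of `A - B` in `L₂`, `B` being multiplication by `M`: there is a nonzero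
`u ∈ D(A)` with `A u - M u = z u`. -/
def IsMulEigenvalue (M : EuclideanSpace ℝ (Fin d) → Matrix (Fin n) (Fin n) ℂ)
    (A : L2 Ω n →ₗ.[ℂ] L2 Ω n) (z : ℂ) : Prop :=
  ∃ u : A.domain, u ≠ 0 ∧ ∃ w : L2 Ω n, IsMulBy M (u : L2 Ω n) w ∧
    A u - w = z • (u : L2 Ω n)

end Forms

/-! ### The conditions on the exponents -/

/-- `r = 2` if `d = 1`, `r > 2` if `d = 2`, `r = 2 p⋆ / (p⋆ - 2)` if `d ≥ 3`. -/
def GoodExponent (d : ℕ) (pstar : ℝ) (r : ℝ≥0∞) : Prop :=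
  (d = 1 ∧ r = 2) ∨ (d = 2 ∧ 2 < r) ∨
    (3 ≤ d ∧ r = ENNReal.ofReal (2 * pstar / (pstar - 2)))

/-- `1 - p⋆ / ((p⋆ - 2) r)` if `r < ∞`, and `1` if `r = ∞`. -/
def gammaZero (pstar : ℝ) (r : ℝ≥0∞) : ℝ :=
  if r = ⊤ then 1 else 1 - pstar / ((pstar - 2) * r.toReal)

/-- `(1/2) (1/2 - 1/r - 1/p) (1/p⋆ - 1/p)⁻¹`, used for `2 < r < ∞`. -/
def gammaP (pstar : ℝ) (r : ℝ≥0∞) (p : ℝ) : ℝ :=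
  1 / 2 * (1 / 2 - 1 / r.toReal - 1 / p) * (1 / pstar - 1 / p)⁻¹

/-- `V` embeds continuously into `L_∞` if `d = 1`, and into every `L_q`, `2 < q < ∞`,
if `d = 2`. -/
def LowDimEmbedding {d n : ℕ} {Ω : Set (EuclideanSpace ℝ (Fin d))}
    (V : Submodule ℂ (W12 Ω n)) : Prop :=
  (d = 1 → EmbedsInLp V ⊤) ∧ (d = 2 → ∀ q : ℝ≥0∞, 2 < q → q < ⊤ → EmbedsInLp V q)

end WeakEv

end

/-! Write `R t = (A + t)⁻¹` and let `b` be the pointwise operator norm of the matrix function. Since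
`|B u| ≤ b |u|`, each boundedness claim reduces to a scalar inequality `‖b A^(-s) f‖ ≤ K ‖f‖` in
`L₂`, with `s = 1 - γ` (`exists_isMulBy`). On `V` and on `D(A)` such an inequality is Hölder's.
Between the endpoints it is obtained directly, without interpolation theory for domains of
fractional powers.

Integrating Balakrishnan's formula by parts gives `A^(-s) f = const ∫ t^(1-s) A (R t)³ f dt`. By
coercivity of the form, the derivative of `‖t R t f‖²` dominates both `t ‖A (R t)² f‖²` and `c t²
‖(R t)² f‖²`, the latter with the norm of `V`; its integral over `(0, ∞)` is at most `‖f‖²`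
(`exists_square_function`). Hence `A (R t)³ f` is bounded, up to constants, by `t^(-3/2) m`, `t^(-1)
m`, `t^(-1/2) m` in `H`, `V`, `D(A)`, where `∫ m² ≤ ‖f‖²` (`exists_representation`). With `β` a
power of `b`, `lintegral_interpolation` cuts the `(t, x)` space along `β(x) = t` and uses one
endpoint estimate on each side; what remains is a kernel whose square has a `t`-integral bounded
independently of `x`, and Cauchy–Schwarz concludes. The endpoints `H`, `V` serve `γ > 1/2`, and `V`,
`D(A)` serve `0 < γ < 1/2`. At `γ = 1/2` the Kato property is used instead. If `B` is already
bounded on `V`, every `γ ≤ 1/2` is covered, because `D(A^s) ⊆ V` for `s ≥ 1/2`.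

For the eigenvalues, `A^(-γ)` extends continuously to `H_{-γ}`, commutes with `A⁻¹` and is injective
on `H`. So a pair of elements of `H` in the graph of `A_{-γ}` lies in the graph of `A`
(`mem_extrapGraph_iff`). A weak eigenfunction satisfies `B u + z u ∈ H`, hence lies in `D(A)`. The
converse needs `D(A) ⊆ D(A^(1-γ))`, which holds because `A^(-s) A^(s-1)` is a multiple of `A⁻¹`, by
Fubini and a Frullani integral. -/

noncomputable section

namespace WeakEv

open Set Filter Topology

/-! ### Calculus of resolvents -/

section Resolvent

/-- `t ^ (-α) (t + c) ^ (-β)` is integrable on `(0, ∞)` if `α < 1 < α + β`. -/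
theorem integrableOn_rpow_mul_rpow {α β c : ℝ} (hc : 0 < c) (hα : α < 1)
    (h : 1 < α + β) :
    IntegrableOn (fun t : ℝ => t ^ (-α) * (t + c) ^ (-β)) (Ioi 0) := by
  have hm : Measurable fun t : ℝ => t ^ (-α) * (t + c) ^ (-β) := by fun_prop
  rw [← Ioc_union_Ioi_eq_Ioi (zero_le_one' ℝ)]
  refine IntegrableOn.union ?_ ?_
  · have h1 : IntegrableOn (fun t : ℝ => t ^ (-α) * c ^ (-β)) (Ioc 0 1) := by
      have := (intervalIntegral.intervalIntegrable_rpow' (a := 0) (b := 1)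
        (r := -α) (by linarith)).1
      exact this.mul_const _
    refine Integrable.mono' h1 hm.aestronglyMeasurable ?_
    refine (ae_restrict_mem measurableSet_Ioc).mono fun t ht => ?_
    have ht0 : 0 < t := ht.1
    rw [Real.norm_of_nonneg (by positivity)]
    gcongr ?_ * ?_
    exact Real.rpow_le_rpow_of_nonpos hc (by linarith) (by linarith)
  · refine Integrable.mono' (integrableOn_Ioi_rpow_of_lt (a := -(α + β)) (by linarith) one_pos)
      hm.aestronglyMeasurable ?_
    refine (ae_restrict_mem measurableSet_Ioi).mono fun t ht => ?_
    have ht0 : 0 < t := one_pos.trans ht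
    rw [Real.norm_of_nonneg (by positivity), neg_add, Real.rpow_add ht0]
    gcongr ?_ * ?_
    exact Real.rpow_le_rpow_of_nonpos ht0 (by linarith) (by linarith)

variable {𝔸 : Type*} [NormedRing 𝔸] [NormedAlgebra ℝ 𝔸]

/-- `R t`, `t ≥ 0`, behaves like the resolvent `(A + t)⁻¹` of an operator `A` with
`‖(A + t)⁻¹‖ ≤ (t + c)⁻¹`. -/
structure IsPosResolvent (R : ℝ → 𝔸) (c : ℝ) : Prop where
  pos : 0 < c
  sub_eq : ∀ t τ, 0 ≤ t → 0 ≤ τ → R t - R τ = (τ - t) • (R t * R τ)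
  norm_le : ∀ t, 0 ≤ t → ‖R t‖ ≤ (t + c)⁻¹

namespace IsPosResolvent

variable {R : ℝ → 𝔸} {c : ℝ} (hR : IsPosResolvent R c)
include hR

theorem comm {t τ : ℝ} (ht : 0 ≤ t) (hτ : 0 ≤ τ) : R t * R τ = R τ * R t := by
  rcases eq_or_ne t τ with rfl | h
  · rfl
  · have h1 := hR.sub_eq t τ ht hτ
    have h2 := hR.sub_eq τ t hτ ht
    have h3 : (τ - t) • (R t * R τ) = (τ - t) • (R τ * R t) := by
      rw [← h1, ← neg_sub t τ, neg_smul, ← h2, neg_sub]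
    exact smul_right_injective 𝔸 (sub_ne_zero.2 h.symm) h3

theorem norm_mul_le {t τ : ℝ} (ht : 0 ≤ t) (hτ : 0 ≤ τ) :
    ‖R t * R τ‖ ≤ (t + c)⁻¹ * (τ + c)⁻¹ := by
  have := hR.pos
  exact (norm_mul_le_of_le (hR.norm_le t ht) (hR.norm_le τ hτ))

theorem continuousOn : ContinuousOn R (Ici 0) := by
  have hc := hR.pos
  have : LipschitzOnWith (Real.toNNReal (c⁻¹ * c⁻¹)) R (Ici 0) := by
    refine LipschitzOnWith.of_dist_le_mul fun t ht τ hτ => ?_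
    rw [Real.coe_toNNReal _ (by positivity), dist_eq_norm, hR.sub_eq t τ ht hτ, norm_smul,
      dist_comm, Real.dist_eq, Real.norm_eq_abs, mul_comm]
    gcongr
    refine (hR.norm_mul_le ht hτ).trans ?_
    have ht' : 0 ≤ t := ht
    have hτ' : 0 ≤ τ := hτ
    gcongr <;> linarith
  exact this.continuousOn

theorem continuousAt {t : ℝ} (ht : 0 < t) : ContinuousAt R t :=
  (hR.continuousOn).continuousAt (Ici_mem_nhds ht)

theorem hasDerivAt {t : ℝ} (ht : 0 < t) : HasDerivAt R (-(R t * R t)) t := by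
  rw [hasDerivAt_iff_tendsto_slope]
  have h1 : Tendsto (fun τ => -(R τ * R t)) (𝓝[≠] t) (𝓝 (-(R t * R t))) := by
    have := ((hR.continuousAt ht).mul (continuousAt_const (y := R t))).neg
    exact this.tendsto.mono_left nhdsWithin_le_nhds
  refine h1.congr' ?_
  have h2 : ∀ᶠ τ in 𝓝[≠] t, 0 < τ :=
    nhdsWithin_le_nhds (Ioi_mem_nhds ht)
  filter_upwards [h2, self_mem_nhdsWithin] with τ hτ hne
  have hne' : τ - t ≠ 0 := sub_ne_zero.2 hne
  rw [slope_def_module, hR.sub_eq τ t hτ.le ht.le, smul_smul, ← neg_sub τ t, mul_neg,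
    inv_mul_cancel₀ hne', neg_one_smul]

theorem norm_pow_le (k : ℕ) {t : ℝ} (ht : 0 ≤ t) :
    ‖R t ^ (k + 1)‖ ≤ (t + c) ^ (-((k : ℝ) + 1)) := by
  have hc := hR.pos
  refine (norm_pow_le' _ k.succ_pos).trans ?_
  have h1 : (t + c) ^ (-((k : ℝ) + 1)) = ((t + c)⁻¹) ^ (k + 1) := by
    rw [Real.rpow_neg (by positivity), inv_pow, ← Real.rpow_natCast]
    push_cast
    rfl
  rw [h1]
  gcongr
  exact hR.norm_le t ht

theorem integrableOn_rpow_smul_pow (k : ℕ) {α : ℝ} (hα : α < 1) (h : 0 < α + k) :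
    IntegrableOn (fun t : ℝ => t ^ (-α) • R t ^ (k + 1)) (Ioi 0) := by
  have hc := hR.pos
  refine Integrable.mono' (integrableOn_rpow_mul_rpow (α := α) (β := (k : ℝ) + 1) hc hα
    (by linarith)) ?_ ?_
  · refine ContinuousOn.aestronglyMeasurable ?_ measurableSet_Ioi
    refine ContinuousOn.smul (fun t ht => ?_)
      ((hR.continuousOn.mono Ioi_subset_Ici_self).pow _)
    exact (Real.continuousAt_rpow_const _ _ (Or.inl (ne_of_gt ht))).continuousWithinAt
  · refine (ae_restrict_mem measurableSet_Ioi).mono fun t ht => ?_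
    have ht0 : 0 < t := ht
    rw [norm_smul, Real.norm_of_nonneg (by positivity)]
    gcongr
    exact hR.norm_pow_le k ht0.le

theorem integrableOn_rpow_smul {s : ℝ} (hs0 : 0 < s) (hs : s < 1) :
    IntegrableOn (fun t : ℝ => t ^ (-s) • R t) (Ioi 0) := by
  simpa using hR.integrableOn_rpow_smul_pow 0 hs (by simpa using hs0)

/-- Balakrishnan's integral in terms of `A (A + t)⁻³ = (A + t)⁻² - t (A + t)⁻³`. -/
theorem integral_rpow_smul_eq [CompleteSpace 𝔸] {s : ℝ} (hs0 : 0 < s) (hs : s < 1) :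
    IntegrableOn (fun t : ℝ => t ^ (1 - s) • (R t ^ 2 - t • R t ^ 3)) (Ioi 0) ∧
    ∫ t in Ioi (0 : ℝ), t ^ (-s) • R t =
      (2 / (s * (1 - s))) • ∫ t in Ioi (0 : ℝ), t ^ (1 - s) • (R t ^ 2 - t • R t ^ 3) := by
  have hc := hR.pos
  have i1 := hR.integrableOn_rpow_smul hs0 hs
  have i2 := hR.integrableOn_rpow_smul_pow 1 (α := s - 1) (by linarith) (by simpa using hs0)
  have i3 := hR.integrableOn_rpow_smul_pow 2 (α := s - 2) (by linarith) (by simpa using hs0)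
  have i4 : IntegrableOn (fun t : ℝ => t ^ (1 - s) • (R t ^ 2 - t • R t ^ 3)) (Ioi 0) := by
    refine (i2.sub i3).congr ?_
    refine (ae_restrict_mem measurableSet_Ioi).mono fun t ht => ?_
    have ht0 : 0 < t := ht
    have e : t ^ (2 - s) = t ^ (1 - s) * t := by
      rw [← Real.rpow_add_one ht0.ne']; congr 1; ring
    simp only [Pi.sub_apply, smul_sub, smul_smul, neg_sub, e]
  refine ⟨i4, ?_⟩
  -- Two integrations by parts in one primitive: its derivative is twice the new integrand minus `s
  -- (1 - s)` times the old one. It vanishes at `0` because both powers of `t` are positive, and at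
  -- infinity because it is `O(t^(-s))`.
  set f : ℝ → 𝔸 := fun t => t ^ (2 - s) • R t ^ 2 - (s * t ^ (1 - s)) • R t with hf
  set f' : ℝ → 𝔸 := fun t => (2 : ℝ) • (t ^ (1 - s) • (R t ^ 2 - t • R t ^ 3)) -
    (s * (1 - s)) • (t ^ (-s) • R t) with hf'
  have hd : ∀ t ∈ Ioi (0 : ℝ), HasDerivAt f (f' t) t := by
    intro t ht
    have ht0 : 0 < t := ht
    have d1 := Real.hasDerivAt_rpow_const (x := t) (p := 2 - s) (Or.inl ht0.ne')
    have d2 := (Real.hasDerivAt_rpow_const (x := t) (p := 1 - s) (Or.inl ht0.ne')).const_mul s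
    have d3 := hR.hasDerivAt ht0
    have d4 := d3.fun_mul d3
    have d5 : HasDerivAt f _ t := (d1.smul (d4.congr_of_eventuallyEq
      (Eventually.of_forall fun t => pow_two (R t)))).sub (d2.smul d3)
    refine d5.congr_deriv ?_
    have e1 : t ^ (2 - s) = t ^ (1 - s) * t := by
      rw [← Real.rpow_add_one ht0.ne']; congr 1; ring
    have e2 : t ^ (2 - s - 1) = t ^ (1 - s) := by congr 1; ring
    have e3 : t ^ (1 - s - 1) = t ^ (-s) := by congr 1; ring
    rw [hf', e1, e2, e3]
    simp only [pow_succ, pow_zero, one_mul, mul_assoc, neg_mul, mul_neg]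
    module
  have hint : IntegrableOn f' (Ioi 0) := (i4.smul (2 : ℝ)).sub (i1.smul (s * (1 - s)))
  have hbd : ∀ t, 0 < t → ‖f t‖ ≤ t ^ (2 - s) * (t + c) ^ (-(2 : ℝ)) +
      s * t ^ (1 - s) * (t + c)⁻¹ := by
    intro t ht
    refine (norm_sub_le _ _).trans ?_
    rw [norm_smul, norm_smul, Real.norm_of_nonneg (by positivity),
      Real.norm_of_nonneg (by positivity)]
    gcongr
    · have := hR.norm_pow_le 1 ht.le
      norm_num at this ⊢
      exact this
    · exact hR.norm_le t ht.le
  have hinf : Tendsto f atTop (𝓝 0) := by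
    have h1 : Tendsto (fun t : ℝ => t ^ (-s) + s * t ^ (-s)) atTop (𝓝 (0 + s * 0)) :=
      (tendsto_rpow_neg_atTop hs0).add ((tendsto_rpow_neg_atTop hs0).const_mul s)
    rw [mul_zero, add_zero] at h1
    refine squeeze_zero_norm' ?_ h1
    filter_upwards [eventually_gt_atTop 0] with t ht
    refine (hbd t ht).trans ?_
    have e1 : t ^ (-s) = t ^ (2 - s) * t ^ (-(2 : ℝ)) := by
      rw [← Real.rpow_add ht]; congr 1; ring
    have e2 : t ^ (-s) = t ^ (1 - s) * t⁻¹ := by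
      rw [← Real.rpow_neg_one, ← Real.rpow_add ht]; congr 1; ring
    gcongr ?_ + ?_
    · rw [e1]
      gcongr ?_ * ?_
      exact Real.rpow_le_rpow_of_nonpos ht (by linarith) (by norm_num)
    · rw [e2, ← mul_assoc]
      gcongr
      linarith
  have hzero : ContinuousWithinAt f (Ici 0) 0 := by
    have hcR : ContinuousWithinAt R (Ici 0) 0 := hR.continuousOn 0 self_mem_Ici
    refine ContinuousWithinAt.sub (ContinuousWithinAt.smul ?_ (hcR.pow 2))
      (ContinuousWithinAt.smul (ContinuousWithinAt.mul continuousWithinAt_const ?_) hcR)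
    · exact (Real.continuousAt_rpow_const _ _ (Or.inr (by linarith))).continuousWithinAt
    · exact (Real.continuousAt_rpow_const _ _ (Or.inr (by linarith))).continuousWithinAt
  have h0 : f 0 = 0 := by
    rw [hf]
    simp [Real.zero_rpow (show (2 - s) ≠ 0 by linarith),
      Real.zero_rpow (show (1 - s) ≠ 0 by linarith)]
  have key := integral_Ioi_of_hasDerivAt_of_tendsto hzero hd hint hinf
  have hsplit : ∫ t in Ioi (0 : ℝ), f' t =
      (∫ t in Ioi (0 : ℝ), (2 : ℝ) • (t ^ (1 - s) • (R t ^ 2 - t • R t ^ 3))) -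
      ∫ t in Ioi (0 : ℝ), (s * (1 - s)) • (t ^ (-s) • R t) :=
    integral_sub (i4.smul (2 : ℝ)) (i1.smul (s * (1 - s)))
  rw [h0, sub_zero, hsplit, integral_smul, integral_smul, sub_eq_zero] at key
  have hne : s * (1 - s) ≠ 0 := (mul_pos hs0 (by linarith)).ne'
  rw [div_eq_inv_mul, mul_smul, key, smul_smul, inv_mul_cancel₀ hne, one_smul]

/-- Frullani's integral for a resolvent. -/
theorem integral_mul_comp_mul [CompleteSpace 𝔸] {σ : ℝ} (hσ : 0 < σ) (hσ1 : σ ≠ 1) :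
    ∫ t in Ioi (0 : ℝ), R t * R (t * σ) = (Real.log σ / (σ - 1)) • R 0 := by
  have hc := hR.pos
  -- The resolvent identity turns the product into a Frullani difference quotient; `R` runs from `R
  -- 0` to `0` at infinity.
  have e : ∀ t ∈ Ioi (0 : ℝ), t⁻¹ • (R (1 * t) - R (σ * t)) = (σ - 1) • (R t * R (t * σ)) := by
    intro t ht
    have ht0 : 0 < t := ht
    rw [one_mul, mul_comm σ, hR.sub_eq t _ ht0.le (by positivity), smul_smul]
    congr 1
    field_simp
  have hcont : ContinuousOn (fun t => R t * R (t * σ)) (Ioi 0) := by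
    refine (hR.continuousOn.mono Ioi_subset_Ici_self).mul
      (hR.continuousOn.comp (by fun_prop) fun t ht => ?_)
    have ht0 : 0 < t := ht
    exact (mul_pos ht0 hσ).le
  have hint : IntegrableOn (fun t => R t * R (t * σ)) (Ioi 0) := by
    have h1 := (integrableOn_rpow_mul_rpow (α := 0) (β := 2) hc (by norm_num)
      (by norm_num)).const_mul (min 1 σ)⁻¹
    refine Integrable.mono' h1 (hcont.aestronglyMeasurable measurableSet_Ioi) ?_
    refine (ae_restrict_mem measurableSet_Ioi).mono fun t ht => ?_
    have ht0 : 0 < t := ht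
    have hm : 0 < min 1 σ := lt_min one_pos hσ
    refine (hR.norm_mul_le ht0.le (by positivity)).trans ?_
    rw [neg_zero, Real.rpow_zero, one_mul, Real.rpow_neg (by positivity), ← mul_inv, ← mul_inv]
    refine inv_anti₀ (by positivity) ?_
    rw [Real.rpow_two]
    have h2 : min 1 σ * (t + c) ≤ t * σ + c := by
      nlinarith [min_le_left 1 σ, min_le_right 1 σ]
    nlinarith [mul_le_mul_of_nonneg_left h2 (by positivity : 0 ≤ t + c)]
  have hR0 : Tendsto R (𝓝[>] 0) (𝓝 (R 0)) :=
    ((hR.continuousOn 0 self_mem_Ici).mono Ioi_subset_Ici_self)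
  have hRinf : Tendsto R atTop (𝓝 0) := by
    refine squeeze_zero_norm' (a := fun t => (t + c)⁻¹) ?_
      ((tendsto_atTop_add_const_right _ _ tendsto_id).inv_tendsto_atTop)
    filter_upwards [eventually_ge_atTop 0] with t ht using hR.norm_le t ht
  have key := Frullani.integral_Ioi_eq (f := R) (a := 1) (b := σ)
    ((hR.continuousOn.mono Ioi_subset_Ici_self).locallyIntegrableOn measurableSet_Ioi)
    one_pos hσ hR0 hRinf (by
      refine (hint.smul (σ - 1)).congr ?_
      exact (ae_restrict_mem measurableSet_Ioi).mono fun t ht => (e t ht).symm)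
  rw [setIntegral_congr_fun measurableSet_Ioi e, integral_smul, sub_zero, div_one] at key
  have hne : σ - 1 ≠ 0 := sub_ne_zero.2 hσ1
  rw [div_eq_inv_mul, mul_smul, ← key, smul_smul, inv_mul_cancel₀ hne, one_smul]

/-- `A ^ (-s) A ^ (s - 1)` is a multiple of `A⁻¹`. -/
theorem exists_integral_mul_integral [CompleteSpace 𝔸] {s : ℝ} (hs0 : 0 < s) (hs : s < 1) :
    ∃ K : ℝ, (∫ t in Ioi (0 : ℝ), t ^ (-s) • R t) * (∫ t in Ioi (0 : ℝ), t ^ (-(1 - s)) • R t) =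
      K • R 0 := by
  have hc := hR.pos
  -- Substituting `τ = t σ` in the second factor cancels all powers of `t`; after Fubini the
  -- `t`-integral is Frullani's. The value of this constant is never needed: it is seen to be
  -- nonzero later, by injectivity.
  refine ⟨∫ σ in Ioi (0 : ℝ), σ ^ (-(1 - s)) * (Real.log σ / (σ - 1)), ?_⟩
  have i1 := hR.integrableOn_rpow_smul hs0 hs
  have i2 := hR.integrableOn_rpow_smul (s := 1 - s) (by linarith) (by linarith)
  set P := ∫ t in Ioi (0 : ℝ), t ^ (-(1 - s)) • R t with hP
  -- the inner substitution
  have hsub : ∀ t ∈ Ioi (0 : ℝ), (t ^ (-s) • R t) * P =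
      ∫ σ in Ioi (0 : ℝ), σ ^ (-(1 - s)) • (R t * R (t * σ)) := by
    intro t ht
    have ht0 : 0 < t := ht
    have h1 := integral_comp_mul_left_Ioi' (fun τ => τ ^ (-(1 - s)) • (R t * R τ)) 0 ht0
    rw [mul_zero] at h1
    have h2 : (t ^ (-s) • R t) * P =
        t ^ (-s) • ∫ τ in Ioi (0 : ℝ), τ ^ (-(1 - s)) • (R t * R τ) := by
      rw [smul_mul_assoc, hP]
      congr 1
      have := (ContinuousLinearMap.mul ℝ 𝔸 (R t)).integral_comp_comm i2
      simp only [ContinuousLinearMap.mul_apply', mul_smul_comm] at this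
      exact this.symm
    rw [h2, ← h1, smul_smul, ← integral_smul]
    refine setIntegral_congr_fun measurableSet_Ioi fun σ hσ => ?_
    have hσ0 : 0 < σ := hσ
    simp only [smul_smul]
    congr 1
    rw [Real.mul_rpow ht0.le hσ0.le, ← Real.rpow_add_one ht0.ne', ← mul_assoc,
      ← Real.rpow_add ht0]
    simp
  -- the scalar majorant
  set C := ∫ ρ in Ioi (0 : ℝ), ρ ^ (-(1 - s)) * (ρ + c)⁻¹ with hC
  have j0 : IntegrableOn (fun ρ : ℝ => ρ ^ (-(1 - s)) * (ρ + c)⁻¹) (Ioi 0) := by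
    have := integrableOn_rpow_mul_rpow (α := 1 - s) (β := 1) hc (by linarith) (by linarith)
    simpa [Real.rpow_neg_one] using this
  have j1 : IntegrableOn (fun ρ : ℝ => ρ ^ (-s) * (ρ + c)⁻¹) (Ioi 0) := by
    have := integrableOn_rpow_mul_rpow (α := s) (β := 1) hc (by linarith) (by linarith)
    simpa [Real.rpow_neg_one] using this
  set g : ℝ × ℝ → ℝ := fun p => p.2 ^ (-(1 - s)) * ((p.1 + c)⁻¹ * (p.1 * p.2 + c)⁻¹) with hg
  have hgm : Measurable g := by fun_prop
  have eg : ∀ t ∈ Ioi (0 : ℝ), ∀ σ ∈ Ioi (0 : ℝ), g (t, σ) =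
      (t ^ (1 - s) * (t + c)⁻¹) * ((t * σ) ^ (-(1 - s)) * (t * σ + c)⁻¹) := by
    intro t ht σ hσ
    have ht0 : 0 < t := ht
    have hσ0 : 0 < σ := hσ
    have e : t ^ (1 - s) * t ^ (-(1 - s)) = 1 := by rw [← Real.rpow_add ht0]; simp
    rw [hg, Real.mul_rpow ht0.le hσ0.le]
    linear_combination (-(σ ^ (-(1 - s)) * ((t + c)⁻¹ * (t * σ + c)⁻¹))) * e
  have hgint : Integrable g ((volume.restrict (Ioi 0)).prod (volume.restrict (Ioi 0))) := by
    rw [integrable_prod_iff hgm.aestronglyMeasurable]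
    constructor
    · refine (ae_restrict_mem measurableSet_Ioi).mono fun t ht => ?_
      have ht0 : 0 < t := ht
      have h1 := (integrableOn_Ioi_comp_mul_left_iff
        (fun ρ : ℝ => ρ ^ (-(1 - s)) * (ρ + c)⁻¹) 0 ht0).2 (by simpa using j0)
      refine (h1.const_mul (t ^ (1 - s) * (t + c)⁻¹)).congr ?_
      exact (ae_restrict_mem measurableSet_Ioi).mono fun σ hσ => (eg t ht σ hσ).symm
    -- By `ρ = t σ`, the `σ`-integral of the majorant is `C t^(-s) (t + c)⁻¹`.
    · refine (j1.mul_const C).congr ?_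
      refine (ae_restrict_mem measurableSet_Ioi).mono fun t ht => ?_
      have ht0 : 0 < t := ht
      have h1 : ∀ σ ∈ Ioi (0 : ℝ), ‖g (t, σ)‖ =
          (t ^ (1 - s) * (t + c)⁻¹) * ((t * σ) ^ (-(1 - s)) * (t * σ + c)⁻¹) := by
        intro σ hσ
        have hσ0 : 0 < σ := hσ
        rw [eg t ht σ hσ, Real.norm_of_nonneg (by positivity)]
      simp only
      rw [setIntegral_congr_fun measurableSet_Ioi h1, integral_const_mul,
        integral_comp_mul_left_Ioi (fun ρ : ℝ => ρ ^ (-(1 - s)) * (ρ + c)⁻¹) 0 ht0, mul_zero,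
        ← hC, smul_eq_mul]
      have e : t ^ (-s) = t ^ (1 - s) * t⁻¹ := by
        rw [← Real.rpow_neg_one, ← Real.rpow_add ht0]; congr 1; ring
      rw [e]; ring
  have hF : Integrable (Function.uncurry fun t σ : ℝ => σ ^ (-(1 - s)) • (R t * R (t * σ)))
      ((volume.restrict (Ioi 0)).prod (volume.restrict (Ioi 0))) := by
    refine Integrable.mono' hgint ?_ ?_
    · rw [Measure.prod_restrict]
      refine ContinuousOn.aestronglyMeasurable ?_ (measurableSet_Ioi.prod measurableSet_Ioi)
      refine ContinuousOn.smul (fun p hp => ?_) (ContinuousOn.mul ?_ ?_)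
      · exact (continuousAt_snd.rpow_const (Or.inl (ne_of_gt hp.2))).continuousWithinAt
      · exact hR.continuousOn.comp continuousOn_fst fun p hp => (mem_Ioi.1 hp.1).le
      · exact hR.continuousOn.comp (continuousOn_fst.mul continuousOn_snd)
          fun p hp => (mul_pos (mem_Ioi.1 hp.1) (mem_Ioi.1 hp.2)).le
    · rw [Measure.prod_restrict]
      refine (ae_restrict_mem (measurableSet_Ioi.prod measurableSet_Ioi)).mono fun p hp => ?_
      have h1 : 0 < p.1 := hp.1
      have h2 : 0 < p.2 := hp.2
      rw [Function.uncurry, norm_smul, Real.norm_of_nonneg (by positivity), hg]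
      simp only
      gcongr
      exact hR.norm_mul_le h1.le (by positivity)
  have h1 : (∫ t in Ioi (0 : ℝ), t ^ (-s) • R t) * P =
      ∫ t in Ioi (0 : ℝ), (t ^ (-s) • R t) * P :=
    (((ContinuousLinearMap.mul ℝ 𝔸).flip P).integral_comp_comm i1).symm
  rw [h1, setIntegral_congr_fun measurableSet_Ioi hsub, integral_integral_swap hF,
    ← integral_smul_const]
  refine integral_congr_ae ?_
  have hne : ∀ᵐ σ ∂(volume.restrict (Ioi (0 : ℝ))), σ ≠ 1 :=
    ae_restrict_of_ae (by simp [ae_iff])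
  filter_upwards [hne, ae_restrict_mem measurableSet_Ioi] with σ hσ1 hσ
  rw [integral_smul, hR.integral_mul_comp_mul hσ hσ1, smul_smul]

end IsPosResolvent

end Resolvent

/-- The integral `∫₀^∞ t ^ (-s) R t dt`. -/
def resolventIntegral {X : Type*} [NormedAddCommGroup X] [NormedSpace ℂ X] (R : ℝ → X →L[ℂ] X)
    (s : ℝ) : X →L[ℂ] X :=
  ∫ t in Ioi (0 : ℝ), t ^ (-s) • R t

/-! ### Resolvents of coercive sesquilinear forms -/

section FormResolvent

variable {V H : Type*} [NormedAddCommGroup V] [NormedSpace ℂ V]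
  [NormedAddCommGroup H] [InnerProductSpace ℂ H]

/-- `S t f`, `t ≥ 0`, solves `a(S t f, φ) + t ⟨S t f, φ⟩ = ⟨f, φ⟩` for all `φ ∈ V`, where the form
`a` is bounded by `C` and coercive with constant `c`, and `j` is a contraction of `V` onto a dense
subspace of `H`. -/
structure IsFormResolvent (a : V →ₗ[ℂ] V →ₗ⋆[ℂ] ℂ) (j : V →L[ℂ] H) (C c : ℝ)
    (S : ℝ → H →L[ℂ] V) : Prop where
  pos : 0 < c
  nonneg : 0 ≤ C
  norm_le : ∀ v, ‖j v‖ ≤ ‖v‖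
  dense : DenseRange j
  bounded : ∀ u v, ‖a u v‖ ≤ C * ‖u‖ * ‖v‖
  coercive : ∀ u, c * ‖u‖ ^ 2 ≤ (a u u).re
  eq : ∀ t, 0 ≤ t → ∀ f φ, a (S t f) φ + (t : ℂ) * inner ℂ (j φ) (j (S t f)) = inner ℂ (j φ) f

/-- The Lax–Milgram theorem. -/
theorem exists_isFormResolvent_of_innerProductSpace {V : Type*} [NormedAddCommGroup V]
    [InnerProductSpace ℂ V] [CompleteSpace V] [CompleteSpace H]
    {a : V →ₗ[ℂ] V →ₗ⋆[ℂ] ℂ} {j : V →L[ℂ] H} {C c : ℝ} (hc : 0 < c) (hC : 0 ≤ C)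
    (hj : ∀ v, ‖j v‖ ≤ ‖v‖) (hd : DenseRange j)
    (hb : ∀ u v, ‖a u v‖ ≤ C * ‖u‖ * ‖v‖) (hco : ∀ u, c * ‖u‖ ^ 2 ≤ (a u u).re) :
    ∃ S, IsFormResolvent a j C c S := by
  -- The arguments of `a` are exchanged because the Riesz representation wants the conjugate-linear
  -- variable first; the adjoint in `La` undoes the exchange.
  let B : V →L⋆[ℂ] V →L[ℂ] ℂ := LinearMap.mkContinuous₂ a.flip C fun φ v => by
    rw [LinearMap.flip_apply, mul_right_comm]
    exact hb v φ
  let La : V →L[ℂ] V := (InnerProductSpace.continuousLinearMapOfBilin B).adjoint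
  have hLa : ∀ v φ, inner ℂ φ (La v) = a v φ := fun v φ => by
    rw [ContinuousLinearMap.adjoint_inner_right,
      InnerProductSpace.continuousLinearMapOfBilin_apply]
    rfl
  let L : ℝ → V →L[ℂ] V := fun t => La + (t : ℂ) • (j.adjoint ∘L j)
  have hL : ∀ t v φ, inner ℂ φ (L t v) = a v φ + (t : ℂ) * inner ℂ (j φ) (j v) := fun t v φ => by
    simp [L, hLa, ContinuousLinearMap.adjoint_inner_right]
  have hre : ∀ t, 0 ≤ t → ∀ v, c * ‖v‖ ^ 2 ≤ (inner ℂ v (L t v)).re := fun t ht v => by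
    have h1 := hco v
    have h2 : (inner ℂ (j v) (j v)).re = ‖j v‖ ^ 2 := inner_self_eq_norm_sq (𝕜 := ℂ) _
    have h3 : 0 ≤ t * ‖j v‖ ^ 2 := by positivity
    rw [hL, Complex.add_re, Complex.re_ofReal_mul, h2]
    linarith
  have hunit : ∀ t, 0 ≤ t → IsUnit (L t) := fun t ht => by
    refine ContinuousLinearMap.isUnit_of_forall_le_norm_inner_map (L t) (c := ⟨c, hc.le⟩) hc ?_
    intro v
    rw [mul_comm, norm_inner_symm]
    exact (hre t ht v).trans (Complex.re_le_norm _)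
  refine ⟨fun t => Ring.inverse (L t) ∘L j.adjoint, hc, hC, hj, hd, hb, hco, fun t ht f φ => ?_⟩
  rw [← hL, ContinuousLinearMap.comp_apply]
  have := congrArg (fun T : V →L[ℂ] V => T (j.adjoint f)) (Ring.mul_inverse_cancel _ (hunit t ht))
  simp only [mul_apply_eq_comp, one_apply_eq_self] at this
  rw [this, ContinuousLinearMap.adjoint_inner_right]

/-- The Lax–Milgram theorem, where the norm of `V` is only known to satisfy the parallelogram law. -/
theorem exists_isFormResolvent [CompleteSpace V] [CompleteSpace H]
    (hV : ∀ x y : V, ‖x + y‖ * ‖x + y‖ + ‖x - y‖ * ‖x - y‖ = 2 * (‖x‖ * ‖x‖ + ‖y‖ * ‖y‖))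
    {a : V →ₗ[ℂ] V →ₗ⋆[ℂ] ℂ} {j : V →L[ℂ] H} {C c : ℝ} (hc : 0 < c) (hC : 0 ≤ C)
    (hj : ∀ v, ‖j v‖ ≤ ‖v‖) (hd : DenseRange j)
    (hb : ∀ u v, ‖a u v‖ ≤ C * ‖u‖ * ‖v‖) (hco : ∀ u, c * ‖u‖ ^ 2 ≤ (a u u).re) :
    ∃ S, IsFormResolvent a j C c S :=
  letI := InnerProductSpace.ofNorm ℂ hV
  exists_isFormResolvent_of_innerProductSpace hc hC hj hd hb hco

namespace IsFormResolvent

variable {a : V →ₗ[ℂ] V →ₗ⋆[ℂ] ℂ} {j : V →L[ℂ] H} {C c : ℝ} {S : ℝ → H →L[ℂ] V}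
  (hS : IsFormResolvent a j C c S)
include hS

theorem coercive_shift {t : ℝ} (v : V) :
    c * ‖v‖ ^ 2 + t * ‖j v‖ ^ 2 ≤ (a v v + (t : ℂ) * inner ℂ (j v) (j v)).re := by
  have h1 := hS.coercive v
  have h2 : ((t : ℂ) * inner ℂ (j v) (j v)).re = t * ‖j v‖ ^ 2 := by
    rw [Complex.re_ofReal_mul]
    congr 1
    exact inner_self_eq_norm_sq (𝕜 := ℂ) _
  rw [Complex.add_re, h2]
  linarith

theorem eq_of_forall {t : ℝ} (ht : 0 ≤ t) {v w : V}
    (h : ∀ φ, a v φ + (t : ℂ) * inner ℂ (j φ) (j v) =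
      a w φ + (t : ℂ) * inner ℂ (j φ) (j w)) : v = w := by
  have h1 := hS.coercive_shift (t := t) (v - w)
  have h2 : a (v - w) (v - w) + (t : ℂ) * inner ℂ (j (v - w)) (j (v - w)) = 0 := by
    have := h (v - w)
    rw [map_sub a, LinearMap.sub_apply, map_sub j, inner_sub_right, ← map_sub j]
    linear_combination this
  rw [h2, Complex.zero_re] at h1
  have h3 : 0 ≤ t * ‖j (v - w)‖ ^ 2 := by positivity
  have h4 : ‖v - w‖ ^ 2 ≤ 0 := by
    have := hS.pos
    nlinarith
  rw [← sub_eq_zero, ← norm_eq_zero]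
  exact pow_eq_zero_iff two_ne_zero |>.1 (le_antisymm h4 (by positivity))

theorem eq_resolvent {t : ℝ} (ht : 0 ≤ t) {v : V} {f : H}
    (h : ∀ φ, a v φ + (t : ℂ) * inner ℂ (j φ) (j v) = inner ℂ (j φ) f) : v = S t f :=
  hS.eq_of_forall ht fun φ => by rw [h, hS.eq t ht]

theorem energy {t : ℝ} (ht : 0 ≤ t) (f : H) :
    c * ‖S t f‖ ^ 2 + t * ‖j (S t f)‖ ^ 2 ≤ (inner ℂ (j (S t f)) f).re := by
  rw [← hS.eq t ht f]
  exact hS.coercive_shift _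

theorem energy_le {t : ℝ} (ht : 0 ≤ t) (f : H) :
    c * ‖S t f‖ ^ 2 + t * ‖j (S t f)‖ ^ 2 ≤ ‖j (S t f)‖ * ‖f‖ :=
  (hS.energy ht f).trans ((Complex.re_le_norm _).trans (norm_inner_le_norm _ _))

/-- Since `j` is a contraction, the energy inequality yields `(t + c) ‖j (S t f)‖² ≤ ‖j (S t f)‖
‖f‖`. -/
theorem norm_comp_le {t : ℝ} (ht : 0 ≤ t) (f : H) : ‖j (S t f)‖ ≤ (t + c)⁻¹ * ‖f‖ := by
  have hc := hS.pos
  have h1 := hS.energy_le ht f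
  have h2 := hS.norm_le (S t f)
  rw [inv_mul_eq_div, le_div_iff₀ (by positivity)]
  rcases (norm_nonneg (j (S t f))).eq_or_lt with h0 | h0
  · rw [← h0]; simp
  · have h3 : ‖j (S t f)‖ ^ 2 ≤ ‖S t f‖ ^ 2 := by gcongr
    refine le_of_mul_le_mul_left ?_ h0
    nlinarith

theorem sq_norm_le {t : ℝ} (ht : 0 ≤ t) (f : H) :
    c * ‖S t f‖ ^ 2 ≤ (t + c)⁻¹ * ‖f‖ ^ 2 := by
  have hc := hS.pos
  have h1 := hS.energy_le ht f
  have h2 := hS.norm_comp_le ht f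
  have h3 : 0 ≤ t * ‖j (S t f)‖ ^ 2 := by positivity
  nlinarith [mul_le_mul_of_nonneg_right h2 (norm_nonneg f)]

/-- Half a power of decay in the norm of `V`: this is what lets Balakrishnan's integral converge in
`V` for `s > 1/2`. -/
theorem norm_apply_le {t : ℝ} (ht : 0 ≤ t) (f : H) :
    ‖S t f‖ ≤ (√c)⁻¹ * (t + c) ^ (-(1 / 2 : ℝ)) * ‖f‖ := by
  have hc := hS.pos
  have h1 := hS.sq_norm_le ht f
  refine abs_le_of_sq_le_sq' ?_ (by positivity) |>.2
  have e1 : ((√c)⁻¹) ^ 2 = c⁻¹ := by rw [inv_pow, Real.sq_sqrt hc.le]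
  have e2 : ((t + c) ^ (-(1 / 2 : ℝ))) ^ 2 = (t + c)⁻¹ := by
    rw [← Real.rpow_natCast, ← Real.rpow_mul (by positivity)]
    norm_num [Real.rpow_neg_one]
  rw [mul_pow, mul_pow, e1, e2, mul_assoc, inv_mul_eq_div, le_div_iff₀ hc, mul_comm]
  exact h1

theorem sub_eq {t τ : ℝ} (ht : 0 ≤ t) (hτ : 0 ≤ τ) (f : H) :
    S t f - S τ f = ((τ - t : ℝ) : ℂ) • S t (j (S τ f)) := by
  rw [sub_eq_iff_eq_add, eq_comm]
  refine hS.eq_resolvent ht fun φ => ?_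
  have h1 := hS.eq t ht (j (S τ f)) φ
  have h2 := hS.eq τ hτ f φ
  simp only [map_add, map_smul, LinearMap.add_apply, LinearMap.smul_apply, smul_eq_mul,
    inner_add_right, inner_smul_right, Complex.ofReal_sub]
  linear_combination ((τ : ℂ) - t) * h1 + h2

theorem isPosResolvent : IsPosResolvent (fun t => j ∘L S t) c where
  pos := hS.pos
  sub_eq t τ ht hτ := by
    ext f
    change j (S t f) - j (S τ f) = (τ - t) • j (S t (j (S τ f)))
    rw [← map_sub, hS.sub_eq ht hτ, map_smul, Complex.coe_smul]
  norm_le t ht := by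
    have hc := hS.pos
    exact ContinuousLinearMap.opNorm_le_bound _ (by positivity) (hS.norm_comp_le ht)

/-- `v - t (A + t)⁻¹ v` is bounded in `V` uniformly in `t`. -/
theorem norm_sub_smul_le {t : ℝ} (ht : 0 ≤ t) (v : V) :
    ‖v - (t : ℂ) • S t (j v)‖ ≤ C / c * ‖v‖ := by
  have hc := hS.pos
  set w := v - (t : ℂ) • S t (j v) with hw
  have h1 := hS.coercive_shift (t := t) w
  -- Here `w` is formally `A (A + t)⁻¹ v`. Testing the resolvent equation with `w` itself removes
  -- every term carrying a factor `t` from the right-hand side, so the resulting bound is uniform in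
  -- `t`.
  have h2 : a w w + (t : ℂ) * inner ℂ (j w) (j w) = a v w := by
    have := hS.eq t ht (j v) w
    rw [show a w = a v - (t : ℂ) • a (S t (j v)) by rw [hw, map_sub, map_smul],
      show j w = j v - (t : ℂ) • j (S t (j v)) by rw [hw, map_sub, map_smul]] at *
    simp only [LinearMap.sub_apply, LinearMap.smul_apply, smul_eq_mul, inner_sub_right,
      inner_smul_right] at *
    linear_combination -(t : ℂ) * this
  rw [h2] at h1
  have h3 := (Complex.re_le_norm _).trans (hS.bounded v w)
  have h4 : 0 ≤ t * ‖j w‖ ^ 2 := by positivity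
  rw [div_mul_eq_mul_div, le_div_iff₀ hc]
  rcases (norm_nonneg w).eq_or_lt with h0 | h0
  · rw [← h0, zero_mul]
    by_contra hneg
    push Not at hneg
    have hv : ‖v‖ ≠ 0 := by rintro h; rw [h] at hneg; simp at hneg
    have hv' : 0 < ‖v‖ := (norm_nonneg v).lt_of_ne' hv
    have h5 := (norm_nonneg _).trans (hS.bounded v v)
    nlinarith
  · refine le_of_mul_le_mul_right ?_ h0
    nlinarith

/-- The energy inequality forces `S t f = 0`; then the equation says that `f` is orthogonal to the
dense range of `j`. -/
theorem injective_comp {t : ℝ} (ht : 0 ≤ t) {f : H} (h : (inner ℂ f (j (S t f))).re = 0) :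
    f = 0 := by
  have hc := hS.pos
  have h1 := hS.energy ht f
  rw [show (inner ℂ (j (S t f)) f).re = (inner ℂ f (j (S t f))).re from inner_re_symm (𝕜 := ℂ) _ _, h] at h1
  have h2 : 0 ≤ t * ‖j (S t f)‖ ^ 2 := by positivity
  have h3 : ‖S t f‖ ^ 2 = 0 := le_antisymm (by nlinarith) (by positivity)
  have h4 : S t f = 0 := norm_eq_zero.1 (pow_eq_zero_iff two_ne_zero |>.1 h3)
  have h5 : ∀ x : H, inner ℂ x f = 0 := by
    refine fun x => hS.dense.induction_on (p := fun x => inner ℂ x f = 0) x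
      (isClosed_eq (by fun_prop) continuous_const) fun φ => ?_
    rw [← hS.eq t ht f φ, h4]
    simp
  exact inner_self_eq_zero.1 (h5 f)

/-- The square function estimate for `t A (A + t)⁻²`. -/
theorem exists_square_function (f : H) :
    ∃ D : ℝ → ℝ, AEMeasurable D (volume.restrict (Ioi 0)) ∧
      ∫⁻ t in Ioi (0 : ℝ), ENNReal.ofReal (D t) ≤ ENNReal.ofReal (‖f‖ ^ 2) ∧
      ∀ t, 0 < t →
        t * ‖j (S t f) - (t : ℂ) • j (S t (j (S t f)))‖ ^ 2 ≤ D t ∧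
        c * (t * ‖S t (j (S t f))‖) ^ 2 ≤ D t := by
  have hc := hS.pos
  have hR := hS.isPosResolvent
  set R : ℝ → H →L[ℂ] H := fun t => j ∘L S t with hRdef
  -- Here `y' = A (A + t)⁻² f` is the derivative of `y`, and `D` is the derivative of `‖y‖²`.
  set y : ℝ → H := fun t => t • R t f with hy
  set y' : ℝ → H := fun t => R t f - t • R t (R t f) with hy'
  set D : ℝ → ℝ := fun t => 2 * (inner ℂ (y t) (y' t)).re with hD
  have hcR : ∀ g : H, ContinuousOn (fun t => R t g) (Ici 0) := fun g =>
    hR.continuousOn.clm_apply continuousOn_const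
  have hcRR : ContinuousOn (fun t => R t (R t f)) (Ici 0) :=
    hR.continuousOn.clm_apply (hcR f)
  have hcy : ContinuousOn y (Ici 0) := continuousOn_id.smul (hcR f)
  have hcy' : ContinuousOn y' (Ici 0) := (hcR f).sub (continuousOn_id.smul hcRR)
  have hcD : ContinuousOn D (Ici 0) := continuousOn_const.mul
    (Complex.continuous_re.comp_continuousOn (hcy.inner (𝕜 := ℂ) hcy'))
  have hder : ∀ t ∈ Ioi (0 : ℝ), HasDerivAt (fun t => ‖y t‖ ^ 2) (D t) t := by
    intro t ht
    have d1 : HasDerivAt (fun t => R t f) (-(R t (R t f))) t := by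
      exact ((ContinuousLinearMap.apply ℂ H f).restrictScalars ℝ).hasFDerivAt.comp_hasDerivAt t
        (hR.hasDerivAt ht)
    have d2 : HasDerivAt y (y' t) t := by
      refine ((hasDerivAt_id t).smul d1).congr_deriv ?_
      simp only [hy', id, smul_neg, one_smul]
      abel
    have d3 := Complex.reCLM.hasFDerivAt.comp_hasDerivAt t (d2.inner ℂ d2)
    have e : Complex.reCLM ∘ (fun t => inner ℂ (y t) (y t)) = fun t => ‖y t‖ ^ 2 :=
      funext fun t => inner_self_eq_norm_sq (𝕜 := ℂ) _
    rw [e] at d3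
    refine d3.congr_deriv ?_
    have h : (inner ℂ (y' t) (y t)).re = (inner ℂ (y t) (y' t)).re :=
      inner_re_symm (𝕜 := ℂ) _ _
    simp only [map_add, Complex.reCLM_apply, h, hD]
    ring
  -- Insert `y = t (y' + t (R t)² f)`. The cross term `⟨(R t)² f, y'⟩` equals the form at `(R t)²
  -- f`, so coercivity makes both contributions to `D` nonnegative.
  have hlow : ∀ t, 0 ≤ t → t * ‖y' t‖ ^ 2 ≤ D t ∧ c * (t * ‖S t (R t f)‖) ^ 2 ≤ D t ∧ 0 ≤ D t := by
    intro t ht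
    have e1 : R t f = y' t + t • R t (R t f) := by simp [hy']
    have h1 : inner ℂ (j (S t (R t f))) (y' t) = a (S t (R t f)) (S t (R t f)) := by
      have := hS.eq t ht (R t f) (S t (R t f))
      rw [hy', inner_sub_right, ← this, ← Complex.coe_smul, inner_smul_right]
      simp [hRdef]
    have h2 := hS.coercive (S t (R t f))
    rw [← h1] at h2
    have h3 : (inner ℂ (y t) (y' t)).re =
        t * (‖y' t‖ ^ 2 + t * (inner ℂ (j (S t (R t f))) (y' t)).re) := by
      have e2 : y t = (t : ℂ) • (y' t + (t : ℂ) • R t (R t f)) := by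
        rw [Complex.coe_smul, Complex.coe_smul, ← e1]
      have e3 : (inner ℂ (y' t) (y' t)).re = ‖y' t‖ ^ 2 := inner_self_eq_norm_sq (𝕜 := ℂ) _
      rw [e2, inner_smul_left, inner_add_left, inner_smul_left, Complex.conj_ofReal,
        Complex.re_ofReal_mul, Complex.add_re, Complex.re_ofReal_mul, e3]
      rfl
    have h4 : D t = 2 * (t * ‖y' t‖ ^ 2) + 2 * t ^ 2 * (inner ℂ (j (S t (R t f))) (y' t)).re := by
      rw [hD]; simp only; rw [h3]; ring
    have h5 : 0 ≤ t * ‖y' t‖ ^ 2 := by positivity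
    have h6 : 0 ≤ c * ‖S t (R t f)‖ ^ 2 := by positivity
    have h7 : t ^ 2 * (c * ‖S t (R t f)‖ ^ 2) ≤ t ^ 2 * (inner ℂ (j (S t (R t f))) (y' t)).re := by
      gcongr
    have h8 : 0 ≤ t ^ 2 * (c * ‖S t (R t f)‖ ^ 2) := by positivity
    refine ⟨by nlinarith, by nlinarith, by nlinarith⟩
  have hbd : ∀ t, 0 ≤ t → ‖y t‖ ^ 2 ≤ ‖f‖ ^ 2 := by
    intro t ht
    gcongr
    rw [hy, norm_smul, Real.norm_of_nonneg ht]
    refine (mul_le_mul_of_nonneg_left (hS.norm_comp_le ht f) ht).trans ?_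
    rw [← mul_assoc, ← div_eq_mul_inv]
    exact mul_le_of_le_one_left (norm_nonneg _) ((div_le_one (by positivity)).2 (by linarith))
  have hcn : ContinuousOn (fun t => ‖y t‖ ^ 2) (Ici 0) := hcy.norm.pow 2
  have hmono : MonotoneOn (fun t => ‖y t‖ ^ 2) (Ici 0) := by
    refine monotoneOn_of_deriv_nonneg (convex_Ici 0) hcn ?_ ?_
    · rw [interior_Ici]
      exact fun t ht => (hder t ht).differentiableAt.differentiableWithinAt
    · rw [interior_Ici]
      exact fun t ht => by rw [(hder t ht).deriv]; exact (hlow t (mem_Ioi.1 ht).le).2.2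
  -- `‖y‖²` is increasing and at most `‖f‖²`, so it has a limit; since `y 0 = 0`, that limit is the
  -- integral of `D`.
  obtain ⟨l, hl⟩ : ∃ l, Tendsto (fun t => ‖y t‖ ^ 2) atTop (𝓝 l) := by
    have hm : Monotone fun t : ℝ => ‖y (max t 0)‖ ^ 2 := fun s t h =>
      hmono (le_max_right s 0) (le_max_right t 0) (max_le_max_right 0 h)
    refine ⟨_, (tendsto_atTop_ciSup hm ⟨‖f‖ ^ 2, ?_⟩).congr' ?_⟩
    · rintro _ ⟨t, rfl⟩
      exact hbd _ (le_max_right t 0)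
    · filter_upwards [eventually_ge_atTop 0] with t ht
      rw [max_eq_left ht]
  have hlf : l ≤ ‖f‖ ^ 2 := le_of_tendsto hl
    ((eventually_ge_atTop 0).mono fun t ht => hbd t ht)
  have hD0 : ∀ t ∈ Ioi (0 : ℝ), 0 ≤ D t := fun t ht => (hlow t (mem_Ioi.1 ht).le).2.2
  have hint := integrableOn_Ioi_deriv_of_nonneg (hcn 0 self_mem_Ici) hder hD0 hl
  have hval := integral_Ioi_of_hasDerivAt_of_tendsto (hcn 0 self_mem_Ici) hder hint hl
  refine ⟨D, hint.1.aemeasurable, ?_, fun t ht => ?_⟩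
  · rw [← ofReal_integral_eq_lintegral_ofReal hint
      ((ae_restrict_mem measurableSet_Ioi).mono hD0), hval]
    refine ENNReal.ofReal_le_ofReal ?_
    have : y 0 = 0 := by simp [hy]
    rw [this]
    simpa using hlf
  · have := hlow t ht.le
    exact ⟨by simpa [hy', hRdef] using this.1, this.2.1⟩

/-- The functions `A (A + t)⁻³ f` in Balakrishnan's representation of `A ^ (-s) f`, with
quadratic estimates in `H`, `V` and `D(A)`. -/
theorem exists_representation [CompleteSpace H] (f : H) :
    ∃ (m : ℝ → ℝ) (W : ℝ → V) (h : ℝ → H),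
      AEMeasurable m (volume.restrict (Ioi 0)) ∧
      (∫⁻ t in Ioi (0 : ℝ), ENNReal.ofReal (m t) ^ 2 ≤ ENNReal.ofReal (‖f‖ ^ 2)) ∧
      (∀ t, 0 < t → 0 ≤ m t ∧ j (W t) = j (S 0 (h t)) ∧
        ‖j (W t)‖ ≤ t ^ (-(3 / 2) : ℝ) * m t ∧
        ‖W t‖ ≤ C / c * (√c)⁻¹ * (t ^ (-1 : ℝ) * m t) ∧
        ‖h t‖ ≤ 2 * (t ^ (-(1 / 2) : ℝ) * m t)) ∧
      ∀ s : ℝ, 0 < s → s < 1 → ∀ w, inner ℂ w (resolventIntegral (fun t => j ∘L S t) s f) =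
        ((2 / (s * (1 - s)) : ℝ) : ℂ) *
          ∫ t in Ioi (0 : ℝ), ((t ^ (1 - s) : ℝ) : ℂ) * inner ℂ w (j (W t)) := by
  have hc := hS.pos
  have hR := hS.isPosResolvent
  obtain ⟨D, hDm, hDi, hD⟩ := hS.exists_square_function f
  set Z : ℝ → H := fun t => j (S t f) - (t : ℂ) • j (S t (j (S t f))) with hZ
  set v : ℝ → V := fun t => S t (j (S t f)) with hv
  have hD0 : ∀ t, 0 < t → 0 ≤ D t := fun t ht =>
    le_trans (by positivity) (hD t ht).1
  have hZm : ∀ t, 0 < t → ‖Z t‖ ≤ t ^ (-(1 / 2) : ℝ) * √(D t) := by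
    intro t ht
    refine abs_le_of_sq_le_sq' ?_ (by positivity) |>.2
    have e2 : (t ^ (-(1 / 2) : ℝ)) ^ 2 = t⁻¹ := by
      rw [← Real.rpow_natCast, ← Real.rpow_mul ht.le]
      norm_num [Real.rpow_neg_one]
    rw [mul_pow, e2, Real.sq_sqrt (hD0 t ht), inv_mul_eq_div, le_div_iff₀ ht, mul_comm]
    exact (hD t ht).1
  have hvm : ∀ t, 0 < t → ‖v t‖ ≤ (√c)⁻¹ * (t ^ (-1 : ℝ) * √(D t)) := by
    intro t ht
    have h1 : √c * (t * ‖v t‖) ≤ √(D t) := by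
      refine Real.le_sqrt_of_sq_le ?_
      rw [mul_pow, Real.sq_sqrt hc.le]
      exact (hD t ht).2
    have h2 : 0 < √c := Real.sqrt_pos.2 hc
    rw [Real.rpow_neg_one, ← mul_assoc, ← mul_inv, inv_mul_eq_div, le_div_iff₀ (by positivity)]
    linarith
  have hW : ∀ t, 0 < t → j (v t - (t : ℂ) • S t (j (v t))) = j (S t (Z t)) := by
    intro t ht
    simp [hZ, hv]
  have htR : ∀ t, 0 < t → ∀ g : H, ‖j (S t g)‖ ≤ t ^ (-1 : ℝ) * ‖g‖ := by
    intro t ht g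
    refine (hS.norm_comp_le ht.le g).trans ?_
    rw [Real.rpow_neg_one]
    gcongr
    linarith
  -- In terms of `A` these are `Z = A (A+t)⁻² f`, `v = (A+t)⁻² f`, `W = A (A+t)⁻³ f` and `h = A W`.
  -- In `H`, the bound comes from `W = (A+t)⁻¹ Z`; in `V`, from the uniform bound on `v - t (A+t)⁻¹
  -- v`; for `h`, from `‖t (A+t)⁻¹‖ ≤ 1`, whence the factor 2.
  refine ⟨fun t => √(D t), fun t => v t - (t : ℂ) • S t (j (v t)),
    fun t => Z t - (t : ℂ) • j (S t (Z t)), hDm.sqrt, ?_, fun t ht => ⟨by positivity, ?_, ?_, ?_, ?_⟩,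
    fun s hs0 hs => ?_⟩
  · refine le_trans (le_of_eq ?_) hDi
    refine setLIntegral_congr_fun measurableSet_Ioi fun t ht => ?_
    simp only
    rw [← ENNReal.ofReal_pow (by positivity), Real.sq_sqrt (hD0 t ht)]
  · rw [hW t ht]
    have h1 := congrArg j (hS.sub_eq le_rfl ht.le (Z t))
    simp only [map_sub, map_smul, sub_zero] at h1 ⊢
    rw [← h1]
    abel
  · rw [hW t ht]
    refine (htR t ht _).trans ?_
    rw [show (-(3 / 2) : ℝ) = -1 + -(1 / 2) by norm_num, Real.rpow_add ht, mul_assoc]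
    gcongr
    exact hZm t ht
  · have h1 := hS.norm_sub_smul_le ht.le (v t)
    refine h1.trans ?_
    have hC := hS.nonneg
    rw [mul_assoc]
    gcongr
    exact hvm t ht
  · have h1 : ‖(t : ℂ) • j (S t (Z t))‖ ≤ ‖Z t‖ := by
      rw [norm_smul, Complex.norm_real, Real.norm_of_nonneg ht.le]
      have := mul_le_mul_of_nonneg_left (htR t ht (Z t)) ht.le
      rwa [Real.rpow_neg_one, ← mul_assoc, mul_inv_cancel₀ ht.ne', one_mul] at this
    have h2 := norm_sub_le (Z t) ((t : ℂ) • j (S t (Z t)))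
    have h3 := hZm t ht
    simp only
    linarith
  · obtain ⟨h1, h2⟩ := hR.integral_rpow_smul_eq (s := s) hs0 hs
    have e : ∀ t, (t ^ (1 - s) • ((j ∘L S t) ^ 2 - t • (j ∘L S t) ^ 3)) f =
        t ^ (1 - s) • j (v t - (t : ℂ) • S t (j (v t))) := by
      intro t
      simp [hv, pow_succ]
    intro w
    have i := ((ContinuousLinearMap.apply ℂ H f).integrable_comp h1).congr (ae_of_all _ e)
    rw [resolventIntegral, h2, smul_apply, ContinuousLinearMap.integral_apply h1]
    simp_rw [e]
    rw [← Complex.coe_smul, inner_smul_right]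
    congr 1
    rw [← innerSL_apply_apply (𝕜 := ℂ), ← (innerSL ℂ w).integral_comp_comm i]
    simp only [innerSL_apply_apply, ← Complex.coe_smul, inner_smul_right]

/-- `∫ t ^ (-s) (A + t)⁻¹ dt` is injective. -/
theorem eq_zero_of_integral_apply_eq_zero [CompleteSpace H] {s : ℝ} (hs0 : 0 < s) (hs : s < 1)
    {f : H} (h : resolventIntegral (fun t => j ∘L S t) s f = 0) : f = 0 := by
  have hR := hS.isPosResolvent
  have i1 := hR.integrableOn_rpow_smul hs0 hs
  -- The quadratic form at `f` of every resolvent has nonnegative real part; if the integral of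
  -- these real parts vanishes, so does almost every one of them, and a single `t` gives `f = 0`.
  let ℓ : (H →L[ℂ] H) →L[ℝ] ℝ := Complex.reCLM ∘L
    ((innerSL ℂ f ∘L ContinuousLinearMap.apply ℂ H f).restrictScalars ℝ)
  have hℓ : ∀ T : H →L[ℂ] H, ℓ T = (inner ℂ f (T f)).re := fun T => rfl
  have h1 := ℓ.integral_comp_comm i1
  rw [hℓ, ← resolventIntegral, h, inner_zero_right, Complex.zero_re] at h1
  have h2 := ℓ.integrable_comp i1
  have h3 : ∀ t, 0 < t → 0 ≤ ℓ (t ^ (-s) • (j ∘L S t)) := by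
    intro t ht
    have hc := hS.pos
    have h4 := hS.energy ht.le f
    rw [show (inner ℂ (j (S t f)) f).re = (inner ℂ f (j (S t f))).re from
      inner_re_symm (𝕜 := ℂ) _ _] at h4
    have h5 : 0 ≤ (inner ℂ f (j (S t f))).re := le_trans (by positivity) h4
    rw [map_smul, hℓ, smul_eq_mul]
    exact mul_nonneg (by positivity) h5
  have h4 := (setIntegral_eq_zero_iff_of_nonneg_ae
    ((ae_restrict_mem measurableSet_Ioi).mono fun t ht => h3 t ht) h2).1 h1
  have : (ae (volume.restrict (Ioi (0 : ℝ)))).NeBot := by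
    rw [ae_restrict_neBot, Real.volume_Ioi]
    simp
  obtain ⟨t, ht, ht0⟩ := (h4.and (ae_restrict_mem measurableSet_Ioi)).exists
  have ht0' : (0 : ℝ) < t := ht0
  refine hS.injective_comp ht0'.le ?_
  have ht' : ℓ (t ^ (-s) • (j ∘L S t)) = 0 := ht
  rw [map_smul, hℓ, smul_eq_mul] at ht'
  exact (mul_eq_zero.1 ht').resolve_left (Real.rpow_pos_of_pos ht0' _).ne'

theorem continuousOn_apply (f : H) : ContinuousOn (fun t => S t f) (Ici 0) := by
  have hc := hS.pos
  have : LipschitzOnWith (Real.toNNReal ((√c)⁻¹ * c ^ (-(1 / 2 : ℝ)) * (c⁻¹ * ‖f‖)))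
      (fun t => S t f) (Ici 0) := by
    refine LipschitzOnWith.of_dist_le_mul fun t ht τ hτ => ?_
    have ht' : 0 ≤ t := ht
    have hτ' : 0 ≤ τ := hτ
    rw [Real.coe_toNNReal _ (by positivity), dist_eq_norm, hS.sub_eq ht hτ, norm_smul,
      dist_comm, Real.dist_eq, Complex.norm_real, Real.norm_eq_abs, mul_comm]
    gcongr
    refine (hS.norm_apply_le ht _).trans ?_
    have h1 := hS.norm_comp_le hτ f
    gcongr ?_ * ?_ * ?_
    · exact Real.rpow_le_rpow_of_nonpos hc (by linarith) (by norm_num)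
    · refine h1.trans ?_
      gcongr
      linarith
  exact this.continuousOn

/-- `D(A ^ s) ⊆ V` boundedly if `1 / 2 < s < 1`. -/
theorem exists_norm_le_of_half_lt [CompleteSpace V] [CompleteSpace H] {s : ℝ} (hs0 : 1 / 2 < s)
    (hs : s < 1) :
    ∃ K : ℝ, ∀ f, ∃ v, j v = resolventIntegral (fun t => j ∘L S t) s f ∧
      ‖v‖ ≤ K * ‖f‖ := by
  have hc := hS.pos
  have hR := hS.isPosResolvent
  have i1 := hR.integrableOn_rpow_smul (s := s) (by linarith) hs
  -- The majorant in `V` is integrable at infinity because `s + 1/2 > 1`.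
  have i2 := integrableOn_rpow_mul_rpow (α := s) (β := 1 / 2) hc hs (by linarith)
  refine ⟨(√c)⁻¹ * ∫ t in Ioi (0 : ℝ), t ^ (-s) * (t + c) ^ (-(1 / 2 : ℝ)), fun f => ?_⟩
  have hb : ∀ᵐ t ∂(volume.restrict (Ioi (0 : ℝ))), ‖t ^ (-s) • S t f‖ ≤
      (√c)⁻¹ * (t ^ (-s) * (t + c) ^ (-(1 / 2 : ℝ))) * ‖f‖ := by
    refine (ae_restrict_mem measurableSet_Ioi).mono fun t ht => ?_
    have ht0 : 0 < t := ht
    rw [norm_smul, Real.norm_of_nonneg (by positivity)]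
    refine (mul_le_mul_of_nonneg_left (hS.norm_apply_le ht0.le f) (by positivity)).trans
      (le_of_eq (by ring))
  have i3 := (i2.const_mul (√c)⁻¹).mul_const ‖f‖
  have hm : AEStronglyMeasurable (fun t => t ^ (-s) • S t f) (volume.restrict (Ioi (0 : ℝ))) := by
    have h1 : ContinuousOn (fun t : ℝ => t ^ (-s)) (Ioi 0) := fun t ht =>
      (Real.continuousAt_rpow_const _ _ (Or.inl (ne_of_gt ht))).continuousWithinAt
    exact (h1.smul ((hS.continuousOn_apply f).mono Ioi_subset_Ici_self)).aestronglyMeasurable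
      measurableSet_Ioi
  have i4 := Integrable.mono' i3 hm hb
  refine ⟨∫ t in Ioi (0 : ℝ), t ^ (-s) • S t f, ?_, ?_⟩
  · rw [resolventIntegral, ContinuousLinearMap.integral_apply i1, ← j.integral_comp_comm i4]
    refine integral_congr_ae (ae_of_all _ fun t => ?_)
    simp only [← Complex.coe_smul, map_smul]
    rfl
  · refine (norm_integral_le_of_norm_le i3 hb).trans ?_
    rw [integral_mul_const, integral_const_mul]

end IsFormResolvent

end FormResolvent

/-! ### A weighted interpolation inequality -/

section Interpolation

/-- For `β > 0` the kernel is scale invariant: its squared norm in `t` is the same for all such `β`.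
This uniformity removes the dependence on `x` in the interpolation. -/
theorem lintegral_Ioi_indicator_Ici_rpow {β ε : ℝ} (hβ : 0 ≤ β) (hε : 0 < ε) :
    ∫⁻ t in Ioi (0 : ℝ),
      ENNReal.ofReal ((if β ≤ t then t ^ (-(1 / 2) - ε) * β ^ ε else 0)) ^ 2 ≤
      ENNReal.ofReal (1 / (2 * ε)) := by
  rcases hβ.eq_or_lt with rfl | hβ
  · simp [Real.zero_rpow hε.ne']
  have h1 : IntegrableOn (fun t : ℝ => t ^ (-1 - 2 * ε) * β ^ (2 * ε)) (Ioi β) :=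
    (integrableOn_Ioi_rpow_of_lt (by linarith) hβ).mul_const _
  have h2 : ∫ t in Ioi β, t ^ (-1 - 2 * ε) * β ^ (2 * ε) = 1 / (2 * ε) := by
    rw [integral_mul_const, integral_Ioi_rpow_of_lt (by linarith) hβ]
    have e : β ^ (-1 - 2 * ε + 1) * β ^ (2 * ε) = 1 := by
      rw [← Real.rpow_add hβ, show -1 - 2 * ε + 1 + 2 * ε = 0 by ring, Real.rpow_zero]
    have e1 : -1 - 2 * ε + 1 = -(2 * ε) := by ring
    rw [e1] at e ⊢
    rw [neg_div_neg_eq, div_mul_eq_mul_div, e]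
  have h3 : ∀ᵐ t ∂(volume.restrict (Ioi β)), 0 ≤ t ^ (-1 - 2 * ε) * β ^ (2 * ε) := by
    refine (ae_restrict_mem measurableSet_Ioi).mono fun t ht => ?_
    have ht0 : 0 < t := hβ.trans ht
    positivity
  rw [← h2, ofReal_integral_eq_lintegral_ofReal h1 h3, ← lintegral_indicator measurableSet_Ioi,
    ← lintegral_indicator measurableSet_Ioi]
  have hne : ∀ᵐ t : ℝ, t ≠ β := by simp [ae_iff]
  refine lintegral_mono_ae (hne.mono fun t htβ => ?_)
  by_cases ht : t ∈ Ioi (0 : ℝ)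
  · have ht0 : 0 < t := ht
    by_cases hb : β ≤ t
    · have hb' : t ∈ Ioi β := lt_of_le_of_ne hb htβ.symm
      rw [indicator_of_mem ht, indicator_of_mem hb', if_pos hb,
        ← ENNReal.ofReal_pow (by positivity), mul_pow, ← Real.rpow_natCast, ← Real.rpow_natCast,
        ← Real.rpow_mul ht0.le, ← Real.rpow_mul hβ.le]
      refine le_of_eq ?_
      push_cast
      congr 3 <;> ring
    · rw [indicator_of_mem ht, if_neg hb]
      simp
  · rw [indicator_of_notMem ht]
    exact zero_le

theorem lintegral_Ioi_indicator_Iio_rpow {β ε : ℝ} (hε : 0 < ε) :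
    ∫⁻ t in Ioi (0 : ℝ),
      ENNReal.ofReal ((if t < β then t ^ (-(1 / 2) + ε) * β ^ (-ε) else 0)) ^ 2 ≤
      ENNReal.ofReal (1 / (2 * ε)) := by
  rcases le_or_gt β 0 with hβ | hβ
  · refine le_trans (le_of_eq ?_) zero_le
    refine (setLIntegral_congr_fun measurableSet_Ioi fun t ht => ?_).trans (lintegral_zero)
    have ht0 : 0 < t := ht
    rw [if_neg (by linarith)]
    simp
  have h1 : IntegrableOn (fun t : ℝ => t ^ (-1 + 2 * ε) * β ^ (-(2 * ε))) (Ioc 0 β) := by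
    have := (intervalIntegral.intervalIntegrable_rpow' (a := 0) (b := β)
      (r := -1 + 2 * ε) (by linarith)).1
    exact this.mul_const _
  have h2 : ∫ t in Ioc 0 β, t ^ (-1 + 2 * ε) * β ^ (-(2 * ε)) = 1 / (2 * ε) := by
    rw [integral_mul_const, ← intervalIntegral.integral_of_le hβ.le,
      integral_rpow (Or.inl (by linarith))]
    have e : β ^ (2 * ε) * β ^ (-(2 * ε)) = 1 := by
      rw [← Real.rpow_add hβ]; simp
    have e1 : -1 + 2 * ε + 1 = 2 * ε := by ring
    rw [e1, Real.zero_rpow (by positivity), sub_zero, div_mul_eq_mul_div, e]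
  have h3 : ∀ᵐ t ∂(volume.restrict (Ioc 0 β)), 0 ≤ t ^ (-1 + 2 * ε) * β ^ (-(2 * ε)) := by
    refine (ae_restrict_mem measurableSet_Ioc).mono fun t ht => ?_
    have ht0 : 0 < t := ht.1
    positivity
  rw [← h2, ofReal_integral_eq_lintegral_ofReal h1 h3, ← lintegral_indicator measurableSet_Ioi,
    ← lintegral_indicator measurableSet_Ioc]
  refine lintegral_mono fun t => ?_
  by_cases ht : t ∈ Ioi (0 : ℝ)
  · have ht0 : 0 < t := ht
    by_cases hb : t < β
    · have hb' : t ∈ Ioc 0 β := ⟨ht0, hb.le⟩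
      rw [indicator_of_mem ht, indicator_of_mem hb', if_pos hb,
        ← ENNReal.ofReal_pow (by positivity), mul_pow, ← Real.rpow_natCast, ← Real.rpow_natCast,
        ← Real.rpow_mul ht0.le, ← Real.rpow_mul hβ.le]
      refine le_of_eq ?_
      push_cast
      congr 3 <;> ring
    · rw [indicator_of_mem ht, if_neg hb]
      simp
  · rw [indicator_of_notMem ht]
    exact zero_le

variable {X : Type*} [MeasurableSpace X] {μ : Measure X}

/-- The `L₂` norm of a nonnegative function. -/
def l2 (μ : Measure X) (f : X → ℝ≥0∞) : ℝ≥0∞ := (∫⁻ x, f x ^ 2 ∂μ) ^ (1 / 2 : ℝ)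

theorem l2_sq (f : X → ℝ≥0∞) : l2 μ f ^ 2 = ∫⁻ x, f x ^ 2 ∂μ := by
  rw [l2, ← ENNReal.rpow_natCast, ← ENNReal.rpow_mul]
  norm_num

theorem l2_mono {f g : X → ℝ≥0∞} (h : ∀ᵐ x ∂μ, f x ≤ g x) : l2 μ f ≤ l2 μ g := by
  unfold l2
  gcongr ?_ ^ _
  exact lintegral_mono_ae (h.mono fun x hx => by gcongr)

theorem lintegral_mul_le_l2 {f g : X → ℝ≥0∞} (hf : AEMeasurable f μ) (hg : AEMeasurable g μ) :
    ∫⁻ x, f x * g x ∂μ ≤ l2 μ f * l2 μ g := by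
  have := ENNReal.lintegral_mul_le_Lp_mul_Lq μ Real.HolderConjugate.two_two hf hg
  simpa [l2] using this

theorem l2_const_mul {f : X → ℝ≥0∞} (c : ℝ≥0∞) (hc : c ≠ ⊤) :
    l2 μ (fun x => c * f x) = c * l2 μ f := by
  unfold l2
  simp_rw [mul_pow]
  rw [lintegral_const_mul' _ _ (ENNReal.pow_ne_top hc), ENNReal.mul_rpow_of_nonneg _ _ (by norm_num),
    ← ENNReal.rpow_natCast, ← ENNReal.rpow_mul]
  norm_num

theorem measurable_l2_kernel [SFinite μ] {w : ℝ → X → ℝ≥0∞} (hw : Measurable (Function.uncurry w))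
    {h : X → ℝ≥0∞} (hh : Measurable h) : Measurable fun t => l2 μ fun x => w t x * h x := by
  unfold l2
  have : Measurable (Function.uncurry fun t x => (w t x * h x) ^ 2) :=
    ((hw.mul (hh.comp measurable_snd)).pow_const 2)
  exact (this.lintegral_prod_right).pow_const _

/-- Tonelli: after exchanging the integrals, only the squared `t`-norm of the kernel at fixed `x`
matters. -/
theorem l2_l2_kernel_le [SFinite μ] {ν : Measure ℝ} [SFinite ν] {w : ℝ → X → ℝ≥0∞}
    (hw : Measurable (Function.uncurry w)) {h : X → ℝ≥0∞} (hh : Measurable h) {L : ℝ≥0∞}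
    (hL : ∀ x, ∫⁻ t, w t x ^ 2 ∂ν ≤ L) :
    l2 ν (fun t => l2 μ fun x => w t x * h x) ≤ L ^ (1 / 2 : ℝ) * l2 μ h := by
  have hm : Measurable (Function.uncurry fun t x => (w t x * h x) ^ 2) :=
    ((hw.mul (hh.comp measurable_snd)).pow_const 2)
  have h1 : ∫⁻ t, (l2 μ fun x => w t x * h x) ^ 2 ∂ν ≤ L * ∫⁻ x, h x ^ 2 ∂μ := by
    simp_rw [l2_sq]
    rw [lintegral_lintegral_swap hm.aemeasurable, ← lintegral_const_mul _ (hh.pow_const 2)]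
    refine lintegral_mono fun x => ?_
    simp_rw [mul_pow]
    have hwx : Measurable fun t => w t x := hw.comp (measurable_id.prodMk measurable_const)
    rw [lintegral_mul_const _ (hwx.pow_const 2)]
    gcongr
    exact hL x
  unfold l2 at h1 ⊢
  rw [← ENNReal.mul_rpow_of_nonneg _ _ (by norm_num)]
  gcongr

/-- Real interpolation between two weighted estimates, with a multiplier `β ^ κ`. -/
theorem lintegral_interpolation [SFinite μ] {β : X → ℝ} (hβm : Measurable β) (hβ : ∀ x, 0 ≤ β x)
    {s κ ε₀ ε₁ : ℝ} (h₀ : 0 < ε₀) (h₁ : 0 < ε₁) (hκ : 0 < κ)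
    {g : ℝ → X → ℝ≥0∞} (hg : ∀ t, AEMeasurable (g t) μ) {m : ℝ → ℝ≥0∞}
    (hm : AEMeasurable m (volume.restrict (Ioi 0))) {A₀ A₁ : ℝ≥0∞}
    (hA₀ : ∀ t, 0 < t → l2 μ (fun x => ENNReal.ofReal (β x ^ (κ - ε₀)) * g t x) ≤
      A₀ * (ENNReal.ofReal (t ^ (s - 3 / 2 - ε₀)) * m t))
    (hA₁ : ∀ t, 0 < t → l2 μ (fun x => ENNReal.ofReal (β x ^ (κ + ε₁)) * g t x) ≤
      A₁ * (ENNReal.ofReal (t ^ (s - 3 / 2 + ε₁)) * m t))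
    {h : X → ℝ≥0∞} (hh : Measurable h) :
    ∫⁻ t in Ioi (0 : ℝ), ENNReal.ofReal (t ^ (1 - s)) *
        ∫⁻ x, ENNReal.ofReal (β x ^ κ) * g t x * h x ∂μ ≤
      (A₀ * ENNReal.ofReal (1 / (2 * ε₀)) ^ (1 / 2 : ℝ) +
        A₁ * ENNReal.ofReal (1 / (2 * ε₁)) ^ (1 / 2 : ℝ)) *
        (l2 (volume.restrict (Ioi 0)) m * l2 μ h) := by
  -- Where `β ≤ t` the smaller power `κ - ε₀` of the weight is used, where `β > t` the larger power
  -- `κ + ε₁`; `w₀` and `w₁` are the factors left over from `t^(1-s) β^κ`.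
  set w₀ : ℝ → X → ℝ≥0∞ := fun t x =>
    ENNReal.ofReal (if β x ≤ t then t ^ (-(1 / 2) - ε₀) * β x ^ ε₀ else 0) with hw₀
  set w₁ : ℝ → X → ℝ≥0∞ := fun t x =>
    ENNReal.ofReal (if t < β x then t ^ (-(1 / 2) + ε₁) * β x ^ (-ε₁) else 0) with hw₁
  have m₀ : Measurable (Function.uncurry w₀) := by
    refine ENNReal.measurable_ofReal.comp (Measurable.ite
      (measurableSet_le (hβm.comp measurable_snd) measurable_fst) ?_ measurable_const)
    exact (measurable_fst.pow_const _).mul ((hβm.comp measurable_snd).pow_const _)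
  have m₁ : Measurable (Function.uncurry w₁) := by
    refine ENNReal.measurable_ofReal.comp (Measurable.ite
      (measurableSet_lt measurable_fst (hβm.comp measurable_snd)) ?_ measurable_const)
    exact (measurable_fst.pow_const _).mul ((hβm.comp measurable_snd).pow_const _)
  set N₀ : ℝ → ℝ≥0∞ := fun t => l2 μ fun x => w₀ t x * h x with hN₀
  set N₁ : ℝ → ℝ≥0∞ := fun t => l2 μ fun x => w₁ t x * h x with hN₁
  have hmN₀ : Measurable N₀ := measurable_l2_kernel m₀ hh
  have hmN₁ : Measurable N₁ := measurable_l2_kernel m₁ hh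
  have step : ∀ t ∈ Ioi (0 : ℝ), ENNReal.ofReal (t ^ (1 - s)) *
      ∫⁻ x, ENNReal.ofReal (β x ^ κ) * g t x * h x ∂μ ≤
      A₀ * (m t * N₀ t) + A₁ * (m t * N₁ t) := by
    intro t ht
    have ht0 : 0 < t := ht
    set p₀ : X → ℝ≥0∞ := fun x => ENNReal.ofReal (t ^ (3 / 2 - s + ε₀)) *
      (ENNReal.ofReal (β x ^ (κ - ε₀)) * g t x) with hp₀
    set p₁ : X → ℝ≥0∞ := fun x => ENNReal.ofReal (t ^ (3 / 2 - s - ε₁)) *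
      (ENNReal.ofReal (β x ^ (κ + ε₁)) * g t x) with hp₁
    have mp₀ : AEMeasurable p₀ μ :=
      (((hβm.pow_const _).ennreal_ofReal.aemeasurable).mul (hg t)).const_mul _
    have mp₁ : AEMeasurable p₁ μ :=
      (((hβm.pow_const _).ennreal_ofReal.aemeasurable).mul (hg t)).const_mul _
    have mw₀ : Measurable fun x => w₀ t x * h x :=
      (m₀.comp (measurable_const.prodMk measurable_id)).mul hh
    have mw₁ : Measurable fun x => w₁ t x * h x :=
      (m₁.comp (measurable_const.prodMk measurable_id)).mul hh
    have q₀ : l2 μ p₀ ≤ A₀ * m t := by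
      rw [hp₀, l2_const_mul _ ENNReal.ofReal_ne_top]
      refine (mul_le_mul_right (hA₀ t ht0) _).trans (le_of_eq ?_)
      have e : ENNReal.ofReal (t ^ (3 / 2 - s + ε₀)) * ENNReal.ofReal (t ^ (s - 3 / 2 - ε₀)) = 1 := by
        rw [← ENNReal.ofReal_mul (by positivity), ← Real.rpow_add ht0]
        ring_nf
        simp
      calc _ = (ENNReal.ofReal (t ^ (3 / 2 - s + ε₀)) * ENNReal.ofReal (t ^ (s - 3 / 2 - ε₀))) *
          (A₀ * m t) := by ring
        _ = _ := by rw [e, one_mul]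
    have q₁ : l2 μ p₁ ≤ A₁ * m t := by
      rw [hp₁, l2_const_mul _ ENNReal.ofReal_ne_top]
      refine (mul_le_mul_right (hA₁ t ht0) _).trans (le_of_eq ?_)
      have e : ENNReal.ofReal (t ^ (3 / 2 - s - ε₁)) * ENNReal.ofReal (t ^ (s - 3 / 2 + ε₁)) = 1 := by
        rw [← ENNReal.ofReal_mul (by positivity), ← Real.rpow_add ht0]
        ring_nf
        simp
      calc _ = (ENNReal.ofReal (t ^ (3 / 2 - s - ε₁)) * ENNReal.ofReal (t ^ (s - 3 / 2 + ε₁))) *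
          (A₁ * m t) := by ring
        _ = _ := by rw [e, one_mul]
    rw [← lintegral_const_mul' _ _ ENNReal.ofReal_ne_top]
    calc _ ≤ ∫⁻ x, (p₀ x * (w₀ t x * h x) + p₁ x * (w₁ t x * h x)) ∂μ := by
          refine lintegral_mono fun x => ?_
          rcases le_or_gt (β x) t with hx | hx
          · refine le_add_right (le_of_eq ?_)
            simp only [hp₀, hw₀, if_pos hx]
            have e : t ^ (1 - s) * β x ^ κ =
                t ^ (3 / 2 - s + ε₀) * β x ^ (κ - ε₀) * (t ^ (-(1 / 2) - ε₀) * β x ^ ε₀) := by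
              have e1 : t ^ (1 - s) = t ^ (3 / 2 - s + ε₀) * t ^ (-(1 / 2) - ε₀) := by
                rw [← Real.rpow_add ht0]; congr 1; ring
              have e2 : β x ^ κ = β x ^ (κ - ε₀) * β x ^ ε₀ := by
                -- At `β x = 0` exponents do not add, since `κ - ε₀` may be `0`; both sides vanish
                -- because `κ` and `ε₀` are positive.
                rcases (hβ x).eq_or_lt with h0 | h0
                · rw [← h0, Real.zero_rpow hκ.ne', Real.zero_rpow h₀.ne', mul_zero]
                · rw [← Real.rpow_add h0, sub_add_cancel]
              rw [e1, e2]; ring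
            have e' := congrArg ENNReal.ofReal e
            have p1 := Real.rpow_nonneg (hβ x) κ
            have p2 := Real.rpow_nonneg (hβ x) (κ - ε₀)
            rw [ENNReal.ofReal_mul (by positivity), ENNReal.ofReal_mul (by positivity),
              ENNReal.ofReal_mul (by positivity)] at e'
            rw [← mul_assoc, ← mul_assoc, e']
            ring
          · refine le_add_left (le_of_eq ?_)
            simp only [hp₁, hw₁, if_pos hx]
            have e : t ^ (1 - s) * β x ^ κ =
                t ^ (3 / 2 - s - ε₁) * β x ^ (κ + ε₁) * (t ^ (-(1 / 2) + ε₁) * β x ^ (-ε₁)) := by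
              have e1 : t ^ (1 - s) = t ^ (3 / 2 - s - ε₁) * t ^ (-(1 / 2) + ε₁) := by
                rw [← Real.rpow_add ht0]; congr 1; ring
              have e2 : β x ^ κ = β x ^ (κ + ε₁) * β x ^ (-ε₁) := by
                rw [← Real.rpow_add (ht0.trans hx), add_neg_cancel_right]
              rw [e1, e2]; ring
            have e' := congrArg ENNReal.ofReal e
            have p1 := Real.rpow_nonneg (hβ x) κ
            have p2 := Real.rpow_nonneg (hβ x) (κ + ε₁)
            rw [ENNReal.ofReal_mul (by positivity), ENNReal.ofReal_mul (by positivity),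
              ENNReal.ofReal_mul (by positivity)] at e'
            rw [← mul_assoc, ← mul_assoc, e']
            ring
      _ = ∫⁻ x, p₀ x * (w₀ t x * h x) ∂μ + ∫⁻ x, p₁ x * (w₁ t x * h x) ∂μ :=
          lintegral_add_left' (mp₀.mul mw₀.aemeasurable) _
      _ ≤ l2 μ p₀ * N₀ t + l2 μ p₁ * N₁ t :=
          add_le_add (lintegral_mul_le_l2 mp₀ mw₀.aemeasurable)
            (lintegral_mul_le_l2 mp₁ mw₁.aemeasurable)
      _ ≤ _ := by
          rw [← mul_assoc, ← mul_assoc]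
          gcongr
  calc _ ≤ ∫⁻ t in Ioi (0 : ℝ), (A₀ * (m t * N₀ t) + A₁ * (m t * N₁ t)) :=
        setLIntegral_mono' measurableSet_Ioi step
    _ = A₀ * (∫⁻ t in Ioi (0 : ℝ), m t * N₀ t) + A₁ * ∫⁻ t in Ioi (0 : ℝ), m t * N₁ t := by
        have k₀ : AEMeasurable (fun t => m t * N₀ t) (volume.restrict (Ioi 0)) :=
          hm.mul hmN₀.aemeasurable
        have k₁ : AEMeasurable (fun t => m t * N₁ t) (volume.restrict (Ioi 0)) :=
          hm.mul hmN₁.aemeasurable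
        have k₂ : AEMeasurable (fun t => A₀ * (m t * N₀ t)) (volume.restrict (Ioi 0)) :=
          k₀.const_mul _
        rw [lintegral_add_left' k₂, lintegral_const_mul'' _ k₀, lintegral_const_mul'' _ k₁]
    _ ≤ A₀ * (l2 (volume.restrict (Ioi 0)) m *
          (ENNReal.ofReal (1 / (2 * ε₀)) ^ (1 / 2 : ℝ) * l2 μ h)) +
        A₁ * (l2 (volume.restrict (Ioi 0)) m *
          (ENNReal.ofReal (1 / (2 * ε₁)) ^ (1 / 2 : ℝ) * l2 μ h)) := by
        gcongr
        · refine (lintegral_mul_le_l2 hm hmN₀.aemeasurable).trans ?_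
          gcongr
          exact l2_l2_kernel_le m₀ hh fun x => lintegral_Ioi_indicator_Ici_rpow (hβ x) h₀
        · refine (lintegral_mul_le_l2 hm hmN₁.aemeasurable).trans ?_
          gcongr
          exact l2_l2_kernel_le m₁ hh fun x => lintegral_Ioi_indicator_Iio_rpow h₁
    _ = _ := by ring

theorem l2_enorm_eq {E : Type*} [NormedAddCommGroup E] (f : X → E) :
    l2 μ (fun x => ‖f x‖ₑ) = eLpNorm f 2 μ := by
  rw [l2, eLpNorm_eq_lintegral_rpow_enorm_toReal two_ne_zero ENNReal.ofNat_ne_top]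
  simp

/-- A weak integral `u = ∫ t ^ (1 - s) G t dt` in `L₂` inherits the interpolated estimate. -/
theorem l2_multiplier_le [SFinite μ] {E : Type*} [NormedAddCommGroup E] [InnerProductSpace ℂ E]
    {β : X → ℝ} (hβm : Measurable β) (hβ : ∀ x, 0 ≤ β x)
    {s κ ε₀ ε₁ : ℝ} (h₀ : 0 < ε₀) (h₁ : 0 < ε₁) (hκ : 0 < κ)
    {G : ℝ → Lp E 2 μ} {m : ℝ → ℝ≥0∞} {u : Lp E 2 μ}
    (hu : ∀ w, inner ℂ w u = ∫ t in Ioi (0 : ℝ), ((t ^ (1 - s) : ℝ) : ℂ) * inner ℂ w (G t))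
    (hm : AEMeasurable m (volume.restrict (Ioi 0))) {A₀ A₁ : ℝ≥0∞}
    (hA₀ : ∀ t, 0 < t → l2 μ (fun x => ENNReal.ofReal (β x ^ (κ - ε₀)) * ‖G t x‖ₑ) ≤
      A₀ * (ENNReal.ofReal (t ^ (s - 3 / 2 - ε₀)) * m t))
    (hA₁ : ∀ t, 0 < t → l2 μ (fun x => ENNReal.ofReal (β x ^ (κ + ε₁)) * ‖G t x‖ₑ) ≤
      A₁ * (ENNReal.ofReal (t ^ (s - 3 / 2 + ε₁)) * m t)) :
    l2 μ (fun x => ENNReal.ofReal (β x ^ κ) * ‖u x‖ₑ) ≤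
      (A₀ * ENNReal.ofReal (1 / (2 * ε₀)) ^ (1 / 2 : ℝ) +
        A₁ * ENNReal.ofReal (1 / (2 * ε₁)) ^ (1 / 2 : ℝ)) *
        l2 (volume.restrict (Ioi 0)) m := by
  set K := (A₀ * ENNReal.ofReal (1 / (2 * ε₀)) ^ (1 / 2 : ℝ) +
        A₁ * ENNReal.ofReal (1 / (2 * ε₁)) ^ (1 / 2 : ℝ)) *
        l2 (volume.restrict (Ioi 0)) m with hK
  have hum : StronglyMeasurable u := Lp.stronglyMeasurable u
  -- Truncating the weight makes `P` finite. Testing with `w = b² u` gives `P²` on the left and at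
  -- most `K P` on the right, so `P` can be cancelled; monotone convergence then removes the
  -- truncation.
  have key : ∀ N : ℕ, l2 μ (fun x => ENNReal.ofReal (min (β x ^ κ) N) * ‖u x‖ₑ) ≤ K := by
    intro N
    set b : X → ℝ := fun x => min (β x ^ κ) N with hb
    have hbm : Measurable b := (hβm.pow_const _).min measurable_const
    have hb0 : ∀ x, 0 ≤ b x := fun x => le_min (Real.rpow_nonneg (hβ x) _) N.cast_nonneg
    have hbN : ∀ x, b x ≤ N := fun x => min_le_right _ _
    set P := l2 μ (fun x => ENNReal.ofReal (b x) * ‖u x‖ₑ) with hP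
    have hPtop : P ≠ ⊤ := by
      refine ne_top_of_le_ne_top ?_ (l2_mono (g := fun x => ENNReal.ofReal N * ‖u x‖ₑ)
        (ae_of_all _ fun x => by gcongr; exact hbN x))
      rw [l2_const_mul _ ENNReal.ofReal_ne_top, l2_enorm_eq]
      exact ENNReal.mul_ne_top ENNReal.ofReal_ne_top (Lp.eLpNorm_ne_top u)
    have hwL : MemLp (fun x => (b x ^ 2) • u x) 2 μ := by
      refine MemLp.of_le_mul (c := (N : ℝ) ^ 2) (Lp.memLp u)
        ((hbm.pow_const 2).stronglyMeasurable.smul hum).aestronglyMeasurable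
        (ae_of_all _ fun x => ?_)
      rw [norm_smul, Real.norm_of_nonneg (by positivity)]
      gcongr
      · exact hb0 x
      · exact hbN x
    set w : Lp E 2 μ := hwL.toLp with hw
    have hwx : ∀ᵐ x ∂μ, w x = (b x ^ 2) • u x := hwL.coeFn_toLp
    have e1 : ‖inner ℂ w u‖ₑ = P ^ 2 := by
      have h2 : inner ℂ w u = (((∫ x, (b x * ‖u x‖) ^ 2 ∂μ : ℝ)) : ℂ) := by
        rw [L2.inner_def, ← integral_complex_ofReal]
        refine integral_congr_ae (hwx.mono fun x hx => ?_)
        simp only [hx]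
        rw [← Complex.coe_smul, inner_smul_left, inner_self_eq_norm_sq_to_K]
        simp [mul_pow]
      rw [h2, hP, l2_sq]
      rw [← ofReal_norm, Complex.norm_real, Real.norm_of_nonneg (integral_nonneg fun x =>
        by positivity), ofReal_integral_eq_lintegral_ofReal]
      · refine lintegral_congr fun x => ?_
        rw [ENNReal.ofReal_pow (mul_nonneg (hb0 x) (norm_nonneg _)), ENNReal.ofReal_mul (hb0 x),
          ofReal_norm]
      · have : MemLp (fun x => b x * ‖u x‖) 2 μ := by
          refine MemLp.of_le_mul (c := (N : ℝ)) (Lp.memLp u)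
            (hbm.stronglyMeasurable.mul hum.norm).aestronglyMeasurable (ae_of_all _ fun x => ?_)
          rw [norm_mul, norm_norm, Real.norm_of_nonneg (hb0 x)]
          gcongr
          exact hbN x
        exact this.integrable_sq
      · exact ae_of_all _ fun x => by positivity
    have e2 : ‖inner ℂ w u‖ₑ ≤ K * P := by
      rw [hu w]
      refine (enorm_integral_le_lintegral_enorm _).trans ?_
      have h3 := lintegral_interpolation (μ := μ) (g := fun t x => ‖G t x‖ₑ) hβm hβ h₀ h₁ hκ
        (fun t => (Lp.stronglyMeasurable (G t)).enorm.aemeasurable) hm hA₀ hA₁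
        (h := fun x => ENNReal.ofReal (b x) * ‖u x‖ₑ)
        (hbm.ennreal_ofReal.mul hum.enorm)
      rw [hK, mul_assoc]
      refine le_trans ?_ h3
      refine setLIntegral_mono' measurableSet_Ioi fun t ht => ?_
      have ht0 : 0 < t := ht
      rw [enorm_mul, ← ofReal_norm (_ : ℂ),
        Complex.norm_real, Real.norm_of_nonneg (by positivity), L2.inner_def]
      gcongr
      refine (enorm_integral_le_lintegral_enorm _).trans ?_
      refine lintegral_mono_ae (hwx.mono fun x hx => ?_)
      rw [hx]
      have h4 : ‖inner ℂ ((b x ^ 2) • u x) (G t x)‖ₑ ≤ ‖(b x ^ 2) • u x‖ₑ * ‖G t x‖ₑ := by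
        rw [← ofReal_norm, ← ofReal_norm, ← ofReal_norm, ← ENNReal.ofReal_mul (norm_nonneg _)]
        exact ENNReal.ofReal_le_ofReal (norm_inner_le_norm _ _)
      refine h4.trans ?_
      rw [enorm_smul, Real.enorm_of_nonneg (by positivity), ENNReal.ofReal_pow (hb0 x)]
      calc _ = ENNReal.ofReal (b x) * ‖G t x‖ₑ * (ENNReal.ofReal (b x) * ‖u x‖ₑ) := by ring
        _ ≤ _ := by
          gcongr
          exact min_le_left _ _
    rw [e1, pow_two] at e2
    rcases eq_or_ne P 0 with h0 | h0
    · rw [h0]; exact zero_le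
    · exact (ENNReal.mul_le_mul_iff_left h0 hPtop).1 e2
  have hlim : Tendsto (fun N : ℕ => ∫⁻ x, (ENNReal.ofReal (min (β x ^ κ) N) * ‖u x‖ₑ) ^ 2 ∂μ) atTop
      (𝓝 (∫⁻ x, (ENNReal.ofReal (β x ^ κ) * ‖u x‖ₑ) ^ 2 ∂μ)) := by
    refine lintegral_tendsto_of_tendsto_of_monotone (fun N => ?_) (ae_of_all _ fun x => ?_)
      (ae_of_all _ fun x => ?_)
    · exact ((((hβm.pow_const _).min measurable_const).ennreal_ofReal.mul
        hum.enorm).pow_const 2).aemeasurable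
    · intro N M hNM
      have : (N : ℝ) ≤ M := by exact_mod_cast hNM
      simp only
      gcongr
    · refine tendsto_const_nhds.congr' ?_
      obtain ⟨N₀, hN₀⟩ := exists_nat_ge (β x ^ κ)
      filter_upwards [eventually_ge_atTop N₀] with N hN
      rw [min_eq_left (hN₀.trans (by exact_mod_cast hN))]
  have h2 : ∫⁻ x, (ENNReal.ofReal (β x ^ κ) * ‖u x‖ₑ) ^ 2 ∂μ ≤ K ^ 2 := by
    refine le_of_tendsto' hlim fun N => ?_
    rw [← l2_sq]
    gcongr
    exact key N
  unfold l2
  calc _ ≤ (K ^ 2) ^ (1 / 2 : ℝ) := by gcongr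
    _ = K := by
      rw [← ENNReal.rpow_natCast, ← ENNReal.rpow_mul]
      norm_num

end Interpolation

/-! ### Fractional powers of an operator with a positive resolvent -/

section FractionalPowers

variable {X : Type*} [NormedAddCommGroup X] [NormedSpace ℂ X]

/-- `A` is an operator with resolvents `R t = (A + t)⁻¹`, `‖R t‖ ≤ (t + c)⁻¹`, and with injective
fractional powers. -/
structure IsPositiveOp (A : X →ₗ.[ℂ] X) (R : ℝ → X →L[ℂ] X) (c : ℝ) : Prop where
  isPosResolvent : IsPosResolvent R c
  isShiftInverse : ∀ t, 0 ≤ t → IsShiftInverse A t (R t)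
  injective : ∀ s : ℝ, 0 < s → s < 1 → ∀ f,
    resolventIntegral R s f = 0 → f = 0

namespace IsPositiveOp

variable {A : X →ₗ.[ℂ] X} {R : ℝ → X →L[ℂ] X} {c : ℝ} (hA : IsPositiveOp A R c)
include hA

theorem shiftInverse_eq {t : ℝ} (ht : 0 ≤ t) : shiftInverse A t = R t := by
  have h : ∃ R, IsShiftInverse A t R := ⟨_, hA.isShiftInverse t ht⟩
  rw [shiftInverse, dif_pos h]
  ext x
  obtain ⟨hx, hx'⟩ := h.choose_spec.1 x
  have := (hA.isShiftInverse t ht).2 ⟨h.choose x, hx⟩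
  rw [hx'] at this
  exact this.symm

theorem negPow_eq {s : ℝ} (hs0 : 0 < s) (hs : s < 1) :
    negPow A s = ((Real.sin (Real.pi * s) / Real.pi : ℝ) : ℂ) • resolventIntegral R s := by
  rw [negPow, if_neg hs0.ne', if_neg hs.ne]
  congr 1
  refine setIntegral_congr_fun measurableSet_Ioi fun t ht => ?_
  rw [hA.shiftInverse_eq (le_of_lt ht), Complex.coe_smul]

theorem negPow_one : negPow A 1 = R 0 := by
  rw [negPow, if_neg one_ne_zero, if_pos rfl, hA.shiftInverse_eq le_rfl]

omit hA in
theorem negPow_zero : negPow A 0 = ContinuousLinearMap.id ℂ X := by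
  rw [negPow, if_pos rfl]

omit hA in
theorem sin_div_pi_pos {s : ℝ} (hs0 : 0 < s) (hs : s < 1) :
    0 < Real.sin (Real.pi * s) / Real.pi := by
  have := Real.pi_pos
  refine div_pos (Real.sin_pos_of_pos_of_lt_pi (by positivity) ?_) this
  nlinarith

omit hA in
theorem sin_div_pi_ne {s : ℝ} (hs0 : 0 < s) (hs : s < 1) :
    ((Real.sin (Real.pi * s) / Real.pi : ℝ) : ℂ) ≠ 0 := by
  exact_mod_cast (sin_div_pi_pos hs0 hs).ne'

theorem mem_graph_iff {u f : X} : (u, f) ∈ A.graph ↔ R 0 f = u := by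
  obtain ⟨h1, h2⟩ := hA.isShiftInverse 0 le_rfl
  rw [LinearPMap.mem_graph_iff]
  constructor
  · rintro ⟨y, rfl, rfl⟩
    simpa using h2 y
  · rintro rfl
    obtain ⟨h, h'⟩ := h1 f
    exact ⟨⟨_, h⟩, rfl, by simpa using h'⟩

theorem mem_domain_iff {u : X} : u ∈ A.domain ↔ ∃ f, R 0 f = u := by
  rw [LinearPMap.mem_domain_iff]
  simp_rw [hA.mem_graph_iff]

theorem inv_injective {f : X} (h : R 0 f = 0) : f = 0 := by
  rw [← hA.mem_graph_iff] at h
  exact A.graph_fst_eq_zero_snd h rfl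

theorem negPow_injective {s : ℝ} (hs0 : 0 ≤ s) (hs : s ≤ 1) {f : X} (h : negPow A s f = 0) :
    f = 0 := by
  rcases hs0.eq_or_lt with rfl | hs0
  · simpa [negPow_zero] using h
  rcases hs.eq_or_lt with rfl | hs
  · rw [hA.negPow_one] at h
    exact hA.inv_injective h
  · rw [hA.negPow_eq hs0 hs, smul_apply] at h
    exact hA.injective s hs0 hs f ((smul_eq_zero.1 h).resolve_left (sin_div_pi_ne hs0 hs))

omit hA in
theorem mem_fracPow_domain {s : ℝ} {u : X} :
    u ∈ (fracPow A s).domain ↔ ∃ f, negPow A s f = u := by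
  rw [fracPow, LinearPMap.inverse_domain]
  constructor
  · rintro ⟨f, rfl⟩
    exact ⟨f, rfl⟩
  · rintro ⟨f, rfl⟩
    exact ⟨⟨f, trivial⟩, rfl⟩

theorem fracPow_apply {s : ℝ} (hs0 : 0 ≤ s) (hs : s ≤ 1) {f : X} (u : (fracPow A s).domain)
    (h : negPow A s f = u) : fracPow A s u = f := by
  have hk : LinearMap.ker ((negPow A s : X →ₗ[ℂ] X).toPMap ⊤).toFun = ⊥ := by
    rw [LinearMap.ker_eq_bot']
    rintro ⟨x, hx⟩ h
    exact Subtype.ext (hA.negPow_injective hs0 hs h)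
  exact LinearPMap.inverse_apply_eq hk (x := ⟨f, trivial⟩) h

theorem comm_integral [CompleteSpace X] {s : ℝ} (hs0 : 0 < s) (hs : s < 1) :
    R 0 * resolventIntegral R s = resolventIntegral R s * R 0 := by
  have hi := hA.isPosResolvent.integrableOn_rpow_smul hs0 hs
  have h1 := (ContinuousLinearMap.mul ℝ (X →L[ℂ] X) (R 0)).integral_comp_comm hi
  have h2 := ((ContinuousLinearMap.mul ℝ (X →L[ℂ] X)).flip (R 0)).integral_comp_comm hi
  simp only [ContinuousLinearMap.mul_apply', ContinuousLinearMap.flip_apply] at h1 h2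
  rw [resolventIntegral, ← h1, ← h2]
  refine setIntegral_congr_fun measurableSet_Ioi fun t ht => ?_
  rw [mul_smul_comm, smul_mul_assoc, hA.isPosResolvent.comm le_rfl (le_of_lt ht)]

theorem comm_negPow [CompleteSpace X] {s : ℝ} (hs0 : 0 ≤ s) (hs : s ≤ 1) (f : X) :
    negPow A s (R 0 f) = R 0 (negPow A s f) := by
  rcases hs0.eq_or_lt with rfl | hs0
  · simp [negPow_zero]
  rcases hs.eq_or_lt with rfl | hs
  · rw [hA.negPow_one]
  · rw [hA.negPow_eq hs0 hs]
    have := congrArg (fun T : X →L[ℂ] X => T f) (hA.comm_integral hs0 hs)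
    simp only [mul_apply_eq_comp] at this
    simp only [smul_apply, map_smul, this]

/-- With unnormalized integrals `P`, `Q` for `A^(-s)`, `A^(s-1)`, the identity `P Q = K A⁻¹` puts
`A⁻¹ f` in the range of `P` once `K ≠ 0`. If `K = 0`, injectivity of `P` and `Q` would give `f = 0`.
-/
theorem domain_le_fracPow_domain [CompleteSpace X] {s : ℝ} (hs0 : 0 ≤ s) (hs : s ≤ 1) :
    A.domain ≤ (fracPow A s).domain := by
  intro u hu
  obtain ⟨f, rfl⟩ := hA.mem_domain_iff.1 hu
  rw [mem_fracPow_domain]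
  rcases hs0.eq_or_lt with rfl | hs0
  · exact ⟨_, by rw [negPow_zero]; rfl⟩
  rcases hs.eq_or_lt with rfl | hs
  · exact ⟨f, by rw [hA.negPow_one]⟩
  obtain ⟨K, hK⟩ := hA.isPosResolvent.exists_integral_mul_integral hs0 hs
  by_cases hf : f = 0
  · exact ⟨0, by simp [hf]⟩
  set P := resolventIntegral R s with hP
  set Q := resolventIntegral R (1 - s) with hQ
  have hPQ : P (Q f) = (K : ℂ) • R 0 f := by
    have := congrArg (fun T : X →L[ℂ] X => T f) hK
    change P (Q f) = (K • R 0) f at this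
    rw [this, Complex.coe_smul]
    rfl
  have hK0 : (K : ℂ) ≠ 0 := by
    intro h0
    rw [h0, zero_smul] at hPQ
    exact hf (hA.injective (1 - s) (by linarith) (by linarith) f
      (hA.injective s hs0 hs _ hPQ))
  set k : ℂ := ((Real.sin (Real.pi * s) / Real.pi : ℝ) : ℂ) with hk
  have hk0 : k ≠ 0 := sin_div_pi_ne hs0 hs
  refine ⟨(k⁻¹ * (K : ℂ)⁻¹) • Q f, ?_⟩
  rw [hA.negPow_eq hs0 hs, smul_apply, map_smul, hPQ, smul_smul, smul_smul, ← hk]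
  rw [show k * (k⁻¹ * (K : ℂ)⁻¹) * K = 1 by field_simp, one_smul]

/-- Let `J` be the continuous extension of `A^(-γ)` to the completion. The relation `J u = A⁻¹ J f`
is closed and holds on the graph of `A`, hence on its closure. For `u`, `f` in `X` it reads `A^(-γ)
u = A^(-γ) A⁻¹ f`, and `A^(-γ)` is injective on `X`. -/
theorem mem_extrapGraph_iff [CompleteSpace X] {γ : ℝ} (h0 : 0 ≤ γ) (h1 : γ ≤ 1) {u f : X} :
    (toExtrap A γ u, toExtrap A γ f) ∈ extrapGraph A γ ↔ (u, f) ∈ A.graph := by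
  constructor
  · intro h
    have huc : UniformContinuous (preMap A γ) :=
      AddMonoidHomClass.uniformContinuous_of_bound (preMap A γ) 1 fun x => by
        rw [one_mul]; exact le_rfl
    let J : Extrap A γ → X := UniformSpace.Completion.extension (preMap A γ)
    have hJc : Continuous J := UniformSpace.Completion.continuous_extension
    have hJ : ∀ x, J (toExtrap A γ x) = negPow A γ x := fun x =>
      UniformSpace.Completion.extension_coe huc (toPre A γ x)
    have hcl : IsClosed {q : Extrap A γ × Extrap A γ | J q.1 = R 0 (J q.2)} :=
      isClosed_eq (hJc.comp continuous_fst) ((R 0).continuous.comp (hJc.comp continuous_snd))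
    have hsub : (extrapGraph A γ : Set (Extrap A γ × Extrap A γ)) ⊆
        {q | J q.1 = R 0 (J q.2)} := by
      rw [extrapGraph, Submodule.topologicalClosure_coe]
      refine closure_minimal ?_ hcl
      rintro _ ⟨⟨v, g⟩, hvg, rfl⟩
      have hvg' := hA.mem_graph_iff.1 hvg
      change J (toExtrap A γ v) = R 0 (J (toExtrap A γ g))
      rw [hJ, hJ, ← hvg', hA.comm_negPow h0 h1]
    have h2 : J (toExtrap A γ u) = R 0 (J (toExtrap A γ f)) := hsub h
    rw [hJ, hJ, ← hA.comm_negPow h0 h1] at h2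
    rw [hA.mem_graph_iff, eq_comm, ← sub_eq_zero]
    exact hA.negPow_injective h0 h1 (by rw [map_sub, h2, sub_self])
  · intro h
    exact Submodule.le_topologicalClosure _ ⟨_, h, rfl⟩

/-- A weak eigenfunction belongs to the domain of the operator in the original space. -/
theorem isWeakEigenvalue_iff [CompleteSpace X] {γ : ℝ} (h0 : 0 ≤ γ) (h1 : γ ≤ 1)
    (T : (fracPow A (1 - γ)).domain →ₗ[ℂ] X) (z : ℂ) :
    IsWeakEigenvalue A γ (toExtrap A γ ∘ₗ T) z ↔
      ∃ u : (fracPow A (1 - γ)).domain, u ≠ 0 ∧ ((u : X), T u + z • (u : X)) ∈ A.graph := by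
  refine exists_congr fun u => and_congr_right fun _ => ?_
  rw [LinearMap.comp_apply, ← map_smul, ← map_add]
  exact hA.mem_extrapGraph_iff h0 h1

end IsPositiveOp

end FractionalPowers

/-! ### Multipliers on the domains of fractional powers of form operators -/

section FormMultiplier

variable {X : Type*} [MeasurableSpace X] {μ : Measure X} [SFinite μ]
  {E : Type*} [NormedAddCommGroup E] [InnerProductSpace ℂ E] [CompleteSpace E]
  {V : Type*} [NormedAddCommGroup V] [NormedSpace ℂ V]
  {a : V →ₗ[ℂ] V →ₗ⋆[ℂ] ℂ} {j : V →L[ℂ] Lp E 2 μ} {C c : ℝ} {S : ℝ → Lp E 2 μ →L[ℂ] V}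

/-- Multiplication by `b` is bounded with respect to the "norm" `N` on the image of `ι`. -/
def IsMultiplier {D : Type*} (b : X → ℝ) (ι : D → Lp E 2 μ) (N : D → ℝ) : Prop :=
  ∃ K : ℝ, 0 ≤ K ∧ ∀ v, l2 μ (fun x => ENNReal.ofReal (b x) * ‖ι v x‖ₑ) ≤ ENNReal.ofReal (K * N v)

omit [SFinite μ] [CompleteSpace E] in
theorem l2_mul_smul (b : X → ℝ) (k : ℂ) (u : Lp E 2 μ) :
    l2 μ (fun x => ENNReal.ofReal (b x) * ‖(k • u : Lp E 2 μ) x‖ₑ) =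
      ‖k‖ₑ * l2 μ (fun x => ENNReal.ofReal (b x) * ‖u x‖ₑ) := by
  rw [← l2_const_mul _ enorm_ne_top]
  have h : ∀ᵐ x ∂μ, ENNReal.ofReal (b x) * ‖(k • u : Lp E 2 μ) x‖ₑ =
      ‖k‖ₑ * (ENNReal.ofReal (b x) * ‖u x‖ₑ) := by
    filter_upwards [Lp.coeFn_smul k u] with x hx
    rw [hx, Pi.smul_apply, enorm_smul]
    ring
  exact le_antisymm (l2_mono (h.mono fun x hx => hx.le)) (l2_mono (h.mono fun x hx => hx.ge))

/-- Common source of both interpolations: the two endpoint hypotheses are phrased through the bounds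
on `A (A+t)⁻³ f` in `H`, `V` and `D(A)`, so that either neighbouring pair of spaces can be supplied.
-/
theorem IsFormResolvent.isMultiplier_of_interpolation (hS : IsFormResolvent a j C c S)
    {β : X → ℝ} (hβm : Measurable β) (hβ : ∀ x, 0 ≤ β x) {s κ ε₀ ε₁ : ℝ} (hs0 : 0 < s) (hs : s < 1)
    (h₀ : 0 < ε₀) (h₁ : 0 < ε₁) (hκ : 0 < κ) {A₀ A₁ : ℝ} (hA₀ : 0 ≤ A₀) (hA₁ : 0 ≤ A₁)
    (hW₀ : ∀ (w : V) (h : Lp E 2 μ) (t m : ℝ), 0 < t → 0 ≤ m → j w = j (S 0 h) →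
        ‖j w‖ ≤ t ^ (-(3 / 2) : ℝ) * m →
        ‖w‖ ≤ C / c * (√c)⁻¹ * (t ^ (-1 : ℝ) * m) →
      l2 μ (fun x => ENNReal.ofReal (β x ^ (κ - ε₀)) * ‖j w x‖ₑ) ≤
        ENNReal.ofReal (A₀ * (t ^ (s - 3 / 2 - ε₀) * m)))
    (hW₁ : ∀ (w : V) (h : Lp E 2 μ) (t m : ℝ), 0 < t → 0 ≤ m → j w = j (S 0 h) →
        ‖w‖ ≤ C / c * (√c)⁻¹ * (t ^ (-1 : ℝ) * m) →
        ‖h‖ ≤ 2 * (t ^ (-(1 / 2) : ℝ) * m) →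
      l2 μ (fun x => ENNReal.ofReal (β x ^ (κ + ε₁)) * ‖j w x‖ₑ) ≤
        ENNReal.ofReal (A₁ * (t ^ (s - 3 / 2 + ε₁) * m))) :
    IsMultiplier (fun x => β x ^ κ)
      (fun f : Lp E 2 μ => resolventIntegral (fun t => j ∘L S t) s f) (fun f => ‖f‖) := by
  set k : ℝ := 2 / (s * (1 - s)) with hk
  have hk0 : 0 < k := div_pos two_pos (mul_pos hs0 (by linarith))
  refine ⟨k * (A₀ * (1 / (2 * ε₀)) ^ (1 / 2 : ℝ) + A₁ * (1 / (2 * ε₁)) ^ (1 / 2 : ℝ)),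
    by positivity, fun f => ?_⟩
  obtain ⟨m, W, h, hm, hm2, hWt, hrep⟩ := hS.exists_representation f
  set F : Lp E 2 μ := resolventIntegral (fun t => j ∘L S t) s f with hF
  have hkC : (k : ℂ) ≠ 0 := by exact_mod_cast hk0.ne'
  have hu : ∀ w, inner ℂ w ((k : ℂ)⁻¹ • F) =
      ∫ t in Ioi (0 : ℝ), ((t ^ (1 - s) : ℝ) : ℂ) * inner ℂ w (j (W t)) := by
    intro w
    rw [inner_smul_right, hrep s hs0 hs w, ← mul_assoc, inv_mul_cancel₀ hkC, one_mul]
  have key := l2_multiplier_le hβm hβ h₀ h₁ hκ hu hm.ennreal_ofReal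
    (A₀ := ENNReal.ofReal A₀) (A₁ := ENNReal.ofReal A₁)
    (fun t ht => by
      obtain ⟨p0, p1, p2, p3, p4⟩ := hWt t ht
      rw [← ENNReal.ofReal_mul (by positivity), ← ENNReal.ofReal_mul hA₀]
      exact hW₀ _ _ t (m t) ht p0 p1 p2 p3)
    (fun t ht => by
      obtain ⟨p0, p1, p2, p3, p4⟩ := hWt t ht
      rw [← ENNReal.ofReal_mul (by positivity), ← ENNReal.ofReal_mul hA₁]
      exact hW₁ _ _ t (m t) ht p0 p1 p3 p4)
  have hml : l2 (volume.restrict (Ioi (0 : ℝ))) (fun t => ENNReal.ofReal (m t)) ≤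
      ENNReal.ofReal ‖f‖ := by
    unfold l2
    calc _ ≤ (ENNReal.ofReal (‖f‖ ^ 2)) ^ (1 / 2 : ℝ) := by gcongr
      _ = _ := by
        rw [ENNReal.ofReal_pow (norm_nonneg _), ← ENNReal.rpow_natCast, ← ENNReal.rpow_mul]
        norm_num
  have hFu : F = (k : ℂ) • ((k : ℂ)⁻¹ • F) := by
    rw [smul_smul, mul_inv_cancel₀ hkC, one_smul]
  change l2 μ (fun x => ENNReal.ofReal (β x ^ κ) * ‖F x‖ₑ) ≤ _
  rw [hFu, l2_mul_smul]
  have hke : ‖(k : ℂ)‖ₑ = ENNReal.ofReal k := by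
    rw [← ofReal_norm, Complex.norm_real, Real.norm_of_nonneg hk0.le]
  have hc₀ : ENNReal.ofReal (1 / (2 * ε₀)) ^ (1 / 2 : ℝ) =
      ENNReal.ofReal ((1 / (2 * ε₀)) ^ (1 / 2 : ℝ)) :=
    ENNReal.ofReal_rpow_of_pos (by positivity)
  have hc₁ : ENNReal.ofReal (1 / (2 * ε₁)) ^ (1 / 2 : ℝ) =
      ENNReal.ofReal ((1 / (2 * ε₁)) ^ (1 / 2 : ℝ)) :=
    ENNReal.ofReal_rpow_of_pos (by positivity)
  rw [hke, ENNReal.ofReal_mul (by positivity), ENNReal.ofReal_mul hk0.le, mul_assoc]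
  gcongr
  refine key.trans ?_
  rw [hc₀, hc₁, ← ENNReal.ofReal_mul hA₀, ← ENNReal.ofReal_mul hA₁,
    ← ENNReal.ofReal_add (by positivity) (by positivity)]
  gcongr

/-- Interpolation between `H` and `V`. -/
theorem IsFormResolvent.isMultiplier_of_lt_half (hS : IsFormResolvent a j C c S)
    {b : X → ℝ} (hbm : Measurable b) (hb : ∀ x, 0 ≤ b x) {s : ℝ} (hs0 : 0 < s) (hs : s < 1 / 2)
    (hV : IsMultiplier (fun x => b x ^ (1 / (2 * s))) j (fun v => ‖v‖)) :
    IsMultiplier b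
      (fun f : Lp E 2 μ => resolventIntegral (fun t => j ∘L S t) s f) (fun f => ‖f‖) := by
  have hc := hS.pos
  have hC := hS.nonneg
  obtain ⟨K, hK0, hK⟩ := hV
  -- With `κ = ε₀ = s` the lower weight is `β^0 = 1`, so the endpoint `H` needs no information on
  -- `b`; with `β = b^(1/s)` the upper weight is `b^(1/(2s))`.
  have := hS.isMultiplier_of_interpolation (β := fun x => b x ^ (1 / s)) (hbm.pow_const _)
    (fun x => Real.rpow_nonneg (hb x) _) (κ := s) (ε₀ := s) (ε₁ := 1 / 2 - s) hs0 (by linarith) hs0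
    (by linarith) hs0 (A₀ := 1) (A₁ := K * (C / c * (√c)⁻¹)) zero_le_one (by positivity)
    (fun w h t m ht hm0 _ h2 _ => by
      have e : s - 3 / 2 - s = -(3 / 2) := by ring
      simp only [sub_self, Real.rpow_zero, ENNReal.ofReal_one, one_mul]
      rw [l2_enorm_eq, e, ← Lp.enorm_def, ← ofReal_norm]
      exact ENNReal.ofReal_le_ofReal h2)
    (fun w h t m ht hm0 _ h2 _ => by
      have e1 : s - 3 / 2 + (1 / 2 - s) = -1 := by ring
      have e2 : ∀ x, (b x ^ (1 / s)) ^ (s + (1 / 2 - s)) = b x ^ (1 / (2 * s)) := fun x => by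
        rw [← Real.rpow_mul (hb x)]
        congr 1
        field_simp
        ring
      simp_rw [e1, e2]
      refine (hK w).trans (ENNReal.ofReal_le_ofReal ?_)
      rw [mul_assoc]
      gcongr)
  simpa only [← Real.rpow_mul (hb _), one_div_mul_cancel hs0.ne', Real.rpow_one] using this

/-- Interpolation between `V` and `D(A)`. -/
theorem IsFormResolvent.isMultiplier_of_half_lt (hS : IsFormResolvent a j C c S)
    {β : X → ℝ} (hβm : Measurable β) (hβ : ∀ x, 0 ≤ β x) {s κ : ℝ} (hs0 : 1 / 2 < s) (hs : s < 1)
    (hκ : 0 < κ)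
    (hV : IsMultiplier (fun x => β x ^ (κ - (s - 1 / 2))) j (fun v => ‖v‖))
    (hD : IsMultiplier (fun x => β x ^ (κ + (1 - s))) (fun f => j (S 0 f)) (fun f => ‖f‖)) :
    IsMultiplier (fun x => β x ^ κ)
      (fun f : Lp E 2 μ => resolventIntegral (fun t => j ∘L S t) s f) (fun f => ‖f‖) := by
  have hc := hS.pos
  have hC := hS.nonneg
  obtain ⟨K₀, hK₀, hV⟩ := hV
  obtain ⟨K₁, hK₁, hD⟩ := hD
  -- These `ε₀`, `ε₁` are forced: they make the powers of `t` equal to `-1` and `-1/2`, the rates in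
  -- `V` and `D(A)`.
  refine hS.isMultiplier_of_interpolation hβm hβ (κ := κ) (ε₀ := s - 1 / 2) (ε₁ := 1 - s)
    (by linarith) hs (by linarith) (by linarith) hκ (A₀ := K₀ * (C / c * (√c)⁻¹)) (A₁ := K₁ * 2)
    (by positivity) (by positivity)
    (fun w h t m ht hm0 _ _ h2 => ?_) (fun w h t m ht hm0 h1 _ h2 => ?_)
  · have e1 : s - 3 / 2 - (s - 1 / 2) = -1 := by ring
    rw [e1]
    refine (hV w).trans (ENNReal.ofReal_le_ofReal ?_)
    rw [mul_assoc]
    gcongr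
  · have e1 : s - 3 / 2 + (1 - s) = -(1 / 2) := by ring
    rw [e1, h1]
    refine (hD h).trans (ENNReal.ofReal_le_ofReal ?_)
    rw [mul_assoc]
    gcongr

end FormMultiplier

/-- The case `t = 0` determines all others: the resolvent identity gives `R t x = R 0 (x - t R t
x)`, that is, `A R t x = x - t R t x`. -/
theorem isShiftInverse_of_mem_graph_iff {X : Type*} [NormedAddCommGroup X] [NormedSpace ℂ X]
    {A : X →ₗ.[ℂ] X} {R : ℝ → X →L[ℂ] X} {c : ℝ} (hR : IsPosResolvent R c)
    (hA : ∀ u f, (u, f) ∈ A.graph ↔ R 0 f = u) {t : ℝ} (ht : 0 ≤ t) :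
    IsShiftInverse A t (R t) := by
  have h1 : ∀ x, R 0 x - R t x = (t : ℂ) • R 0 (R t x) := fun x => by
    have := congrArg (fun T : X →L[ℂ] X => T x) (hR.sub_eq 0 t le_rfl ht)
    rw [Complex.coe_smul]
    simpa using this
  have h2 : ∀ x, R 0 (R t x) = R t (R 0 x) := fun x =>
    congrArg (fun T : X →L[ℂ] X => T x) (hR.comm le_rfl ht)
  have h0 : ∀ x, (R t x, x - (t : ℂ) • R t x) ∈ A.graph := fun x => by
    rw [hA, map_sub, map_smul, ← h1]
    abel
  refine ⟨fun x => ?_, fun u => ?_⟩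
  · obtain ⟨y, hy, hy'⟩ := A.mem_graph_iff.1 (h0 x)
    have hy : (y : X) = R t x := hy
    have hm : R t x ∈ A.domain := hy ▸ y.2
    refine ⟨hm, ?_⟩
    rw [show y = ⟨R t x, hm⟩ from Subtype.ext hy] at hy'
    rw [hy']
    simp
  · have h3 : R 0 (A u) = u := (hA _ _).1 (A.mem_graph u)
    have h4 := h1 (A u)
    rw [h2, h3] at h4
    rw [map_add, map_smul, ← h4]
    abel

/-! ### The Sobolev space and the operator associated with a form -/

section Sobolev

variable {d n : ℕ} {Ω : Set (EuclideanSpace ℝ (Fin d))}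

theorem continuous_integral_smul {ψ : EuclideanSpace ℝ (Fin d) → ℝ} (hψ : Continuous ψ)
    (hc : HasCompactSupport ψ) : Continuous fun u : L2 Ω n => ∫ x in Ω, ψ x • u x := by
  have hm : MemLp ψ 2 (volume.restrict Ω) := hψ.memLp_of_hasCompactSupport hc
  let B : ℝ →L[ℝ] EuclideanSpace ℂ (Fin n) →L[ℝ] EuclideanSpace ℂ (Fin n) :=
    ContinuousLinearMap.lsmul ℝ ℝ
  have h := (B.lpPairing (volume.restrict Ω) 2 2 hm.toLp).continuous
  refine h.congr fun u => ?_
  rw [ContinuousLinearMap.lpPairing_eq_integral]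
  refine integral_congr_ae ?_
  filter_upwards [hm.coeFn_toLp] with x hx
  rw [hx]
  rfl

/-- Pairing with a test function is continuous on `L₂`, so each weak-derivative identity is a closed
condition. The resulting completeness of `V` is needed for Lax–Milgram and for integrals in `V`. -/
theorem isClosed_W12 :
    IsClosed (W12 Ω n : Set (WithLp 2 (L2 Ω n × PiLp 2 (fun _ : Fin d => L2 Ω n)))) := by
  have h : (W12 Ω n : Set (WithLp 2 (L2 Ω n × PiLp 2 (fun _ : Fin d => L2 Ω n)))) =
      {w | ∀ i, ∀ φ : EuclideanSpace ℝ (Fin d) → ℝ, ContDiff ℝ ∞ φ → HasCompactSupport φ →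
        tsupport φ ⊆ Ω →
        ∫ x in Ω, (fderiv ℝ φ x (EuclideanSpace.single i (1 : ℝ))) • w.fst x =
          - ∫ x in Ω, φ x • w.snd i x} := rfl
  rw [h]
  simp only [ofPred_forall]
  refine isClosed_iInter fun i => isClosed_iInter fun φ => isClosed_iInter fun hφ =>
    isClosed_iInter fun hc => isClosed_iInter fun _ => ?_
  obtain ⟨p1, p2⟩ := partial_test hφ hc (EuclideanSpace.single i (1 : ℝ))
  have c1 : Continuous fun w : WithLp 2 (L2 Ω n × PiLp 2 (fun _ : Fin d => L2 Ω n)) => w.fst :=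
    (WithLp.fstL 2 ℂ (L2 Ω n) (PiLp 2 (fun _ : Fin d => L2 Ω n))).continuous
  have c2 : Continuous fun w : WithLp 2 (L2 Ω n × PiLp 2 (fun _ : Fin d => L2 Ω n)) => w.snd i :=
    (PiLp.continuous_apply 2 _ i).comp
      (WithLp.sndL 2 ℂ (L2 Ω n) (PiLp 2 (fun _ : Fin d => L2 Ω n))).continuous
  exact isClosed_eq ((continuous_integral_smul p1 p2).comp c1)
    ((continuous_integral_smul hφ.continuous hc).comp c2).neg

variable {V : Submodule ℂ (W12 Ω n)}

theorem completeSpace_of_isClosed (hV : IsClosed (V : Set (W12 Ω n))) : CompleteSpace V := by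
  have : CompleteSpace (W12 Ω n) := isClosed_W12.completeSpace_coe
  exact hV.completeSpace_coe

theorem norm_incl_le (v : V) : ‖incl V v‖ ≤ ‖v‖ := by
  have h := WithLp.norm_fst_le _ (v : W12 Ω n).1
  exact h

/-- `IsFormResolvent` for a form on a space of Sobolev functions. -/
abbrev IsResolvent (a : V →ₗ[ℂ] V →ₗ⋆[ℂ] ℂ) (C c : ℝ) (S : ℝ → L2 Ω n →L[ℂ] V) : Prop :=
  @IsFormResolvent V (L2 Ω n) (Submodule.normedAddCommGroup V) (Submodule.normedSpace V) _ _
    a (incl V) C c S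

/-- Uniqueness in Lax–Milgram identifies the form graph with the inverse of `S 0`. It is
single-valued, so that `toLinearPMap` keeps it, because `S 0` is injective; density of `V` enters
here. -/
theorem mem_graph_formOp {a : V →ₗ[ℂ] V →ₗ⋆[ℂ] ℂ} {C c : ℝ} {S : ℝ → L2 Ω n →L[ℂ] V}
    (hS : IsResolvent a C c S) {u f : L2 Ω n} :
    (u, f) ∈ (formOp a).graph ↔ incl V (S 0 f) = u := by
  have hg : ∀ q : L2 Ω n × L2 Ω n, q ∈ formGraph a ↔ incl V (S 0 q.2) = q.1 := by
    intro q
    constructor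
    · rintro ⟨v, h1, h2⟩
      rw [← hS.eq_resolvent le_rfl (v := v) (f := q.2) fun φ => by simp [h2 φ], h1]
    · intro h
      exact ⟨S 0 q.2, h, fun φ => by simpa using hS.eq 0 le_rfl q.2 φ⟩
  rw [formOp, Submodule.toLinearPMap_graph_eq, hg]
  intro q hq h0
  rw [hg, h0] at hq
  exact hS.injective_comp le_rfl (by rw [hq]; simp)

theorem IsResolvent.isPositiveOp {a : V →ₗ[ℂ] V →ₗ⋆[ℂ] ℂ} {C c : ℝ} {S : ℝ → L2 Ω n →L[ℂ] V}
    (hS : IsResolvent a C c S) :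
    IsPositiveOp (formOp a) (fun t => incl V ∘L S t) c where
  isPosResolvent := hS.isPosResolvent
  injective _ hs0 hs _ h := hS.eq_zero_of_integral_apply_eq_zero hs0 hs h
  isShiftInverse _ ht :=
    isShiftInverse_of_mem_graph_iff hS.isPosResolvent (fun _ _ => mem_graph_formOp hS) ht

theorem IsKato.exists_isFormResolvent (hVclosed : IsClosed (V : Set (W12 Ω n)))
    (hVdense : DenseRange (incl V)) {a : V →ₗ[ℂ] V →ₗ⋆[ℂ] ℂ} (ha : IsKato a) :
    ∃ C c S, IsResolvent a C c S := by
  obtain ⟨⟨C, hC⟩, ⟨c, hc, hco⟩, -⟩ := ha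
  have := completeSpace_of_isClosed hVclosed
  have hpar : ∀ x y : V,
      ‖x + y‖ * ‖x + y‖ + ‖x - y‖ * ‖x - y‖ = 2 * (‖x‖ * ‖x‖ + ‖y‖ * ‖y‖) := fun x y => by
    have h := parallelogram_law_with_norm ℂ (x : W12 Ω n).1 (y : W12 Ω n).1
    simp only [pow_two] at h
    exact h
  obtain ⟨S, hS⟩ := @WeakEv.exists_isFormResolvent V (L2 Ω n) (Submodule.normedAddCommGroup V)
    (Submodule.normedSpace V) _ _ _ _ hpar a (incl V) (max C 0) c hc
    (le_max_right _ _) norm_incl_le hVdense (fun u v => (hC u v).trans (by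
      refine mul_le_mul_of_nonneg_right (mul_le_mul_of_nonneg_right (le_max_left _ _) ?_) ?_
      · exact norm_nonneg u
      · exact norm_nonneg v)) hco
  exact ⟨_, _, S, hS⟩

end Sobolev

/-! ### Multiplication operators -/

section Multiplication

variable {X : Type*} [MeasurableSpace X] {μ : Measure X} {E : Type*} [NormedAddCommGroup E]

theorem l2_mul_le_eLpNorm_mul {b : X → ℝ} (hbm : Measurable b) (hb : ∀ x, 0 ≤ b x) {p q : ℝ≥0∞}
    [p.HolderTriple q 2] {u : X → E} (hu : AEStronglyMeasurable u μ) :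
    l2 μ (fun x => ENNReal.ofReal (b x) * ‖u x‖ₑ) ≤ eLpNorm b p μ * eLpNorm u q μ := by
  have h := eLpNorm_smul_le_mul_eLpNorm (p := p) (q := q) (r := 2) (𝕜 := ℝ) (f := fun x => ‖u x‖)
    hu.norm hbm.aestronglyMeasurable
  rw [eLpNorm_norm] at h
  rw [← l2_enorm_eq] at h
  convert h using 3 with x
  rw [Pi.smul_apply', smul_eq_mul, enorm_mul, Real.enorm_of_nonneg (hb x), enorm_norm]

variable [InnerProductSpace ℂ E]

omit [InnerProductSpace ℂ E] in
theorem isMultiplier_of_eLpNorm_le {D : Type*} {b : X → ℝ} (hbm : Measurable b)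
    (hb : ∀ x, 0 ≤ b x) {p q : ℝ≥0∞} (hpq : p⁻¹ + q⁻¹ = 2⁻¹) (hbp : MemLp b p μ)
    {ι : D → Lp E 2 μ} {N : D → ℝ} (hN : ∀ v, 0 ≤ N v) {K : ℝ}
    (hι : ∀ v, eLpNorm (ι v) q μ ≤ ENNReal.ofReal (K * N v)) :
    IsMultiplier b ι N := by
  have : p.HolderTriple q 2 := ⟨hpq⟩
  refine ⟨(eLpNorm b p μ).toReal * |K|, by positivity, fun v => ?_⟩
  refine (l2_mul_le_eLpNorm_mul (p := p) (q := q) hbm hb (Lp.aestronglyMeasurable _)).trans ?_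
  rw [mul_assoc, ENNReal.ofReal_mul ENNReal.toReal_nonneg, ENNReal.ofReal_toReal hbp.2.ne]
  gcongr
  refine (hι v).trans (ENNReal.ofReal_le_ofReal ?_)
  exact mul_le_mul_of_nonneg_right (le_abs_self K) (hN v)

theorem memLp_rpow {b : X → ℝ} (hb : ∀ x, 0 ≤ b x) {ρ θ : ℝ} (hθ : 0 < θ)
    (h : MemLp b (ENNReal.ofReal (ρ * θ)) μ) :
    MemLp (fun x => b x ^ θ) (ENNReal.ofReal ρ) μ := by
  have := h.norm_rpow_div (ENNReal.ofReal θ)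
  rw [← ENNReal.ofReal_div_of_pos hθ, mul_div_cancel_right₀ _ hθ.ne',
    ENNReal.toReal_ofReal hθ.le] at this
  simpa only [Real.norm_of_nonneg (hb _)] using this

theorem inv_ofReal_add_inv_ofReal {p q : ℝ} (hp : 0 < p) (hq : 0 < q) (h : 1 / p + 1 / q = 1 / 2) :
    (ENNReal.ofReal p)⁻¹ + (ENNReal.ofReal q)⁻¹ = 2⁻¹ := by
  rw [← ENNReal.ofReal_inv_of_pos hp, ← ENNReal.ofReal_inv_of_pos hq,
    ← ENNReal.ofReal_add (by positivity) (by positivity), ← one_div, ← one_div, h, one_div,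
    ENNReal.ofReal_inv_of_pos two_pos]
  simp

/-- A bounded operator in `L₂` with range in `L_p` is bounded into `L_p`. -/
theorem exists_eLpNorm_le_of_memLp [CompleteSpace E] {p : ℝ≥0∞} (hp : 1 ≤ p)
    (R : Lp E 2 μ →L[ℂ] Lp E 2 μ) (h : ∀ f, MemLp (R f) p μ) :
    ∃ K : ℝ, ∀ f, eLpNorm (R f) p μ ≤ ENNReal.ofReal (K * ‖f‖) := by
  have : Fact (1 ≤ p) := ⟨hp⟩
  let g : Lp E 2 μ →ₗ[ℂ] Lp E p μ :=
    { toFun := fun f => (h f).toLp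
      map_add' := fun f f' => by
        rw [← MemLp.toLp_add]
        refine MemLp.toLp_congr _ _ ?_
        rw [map_add]
        exact Lp.coeFn_add _ _
      map_smul' := fun c f => by
        rw [RingHom.id_apply, ← MemLp.toLp_const_smul]
        refine MemLp.toLp_congr _ _ ?_
        rw [map_smul]
        exact Lp.coeFn_smul _ _ }
  have hg : Continuous g := by
    -- Closed graph theorem: limits in `L_p` and in `L₂` agree, since a common subsequence converges
    -- almost everywhere to both.
    refine g.continuous_of_seq_closed_graph fun u x y hu hy => ?_
    obtain ⟨ns, hns, h1⟩ := (tendstoInMeasure_of_tendsto_Lp hy).exists_seq_tendsto_ae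
    have h2 : Tendsto (fun k => R (u (ns k))) atTop (𝓝 (R x)) :=
      (R.continuous.tendsto x).comp (hu.comp hns.tendsto_atTop)
    obtain ⟨ms, hms, h3⟩ := (tendstoInMeasure_of_tendsto_Lp h2).exists_seq_tendsto_ae
    refine Lp.ext ?_
    have h4 : ∀ᵐ x ∂μ, ∀ k, g (u k) x = R (u k) x :=
      ae_all_iff.2 fun k => (h (u k)).coeFn_toLp
    have h5 : ∀ᵐ z ∂μ, g x z = R x z := (h x).coeFn_toLp
    filter_upwards [h1, h3, h4, h5] with z z1 z3 z4 z5
    refine tendsto_nhds_unique (z1.comp hms.tendsto_atTop) ?_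
    rw [z5]
    exact z3.congr fun k => (z4 _).symm
  refine ⟨‖(⟨g, hg⟩ : Lp E 2 μ →L[ℂ] Lp E p μ)‖, fun f => ?_⟩
  have h1 := (⟨g, hg⟩ : Lp E 2 μ →L[ℂ] Lp E p μ).le_opNorm f
  have h2 : eLpNorm (R f) p μ = ENNReal.ofReal ‖g f‖ := by
    rw [ofReal_norm, Lp.enorm_def]
    exact eLpNorm_congr_ae (h f).coeFn_toLp.symm
  rw [h2]
  exact ENNReal.ofReal_le_ofReal h1

end Multiplication

/-! ### Transfer and interpolation of multipliers -/

section Transfer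

variable {X : Type*} [MeasurableSpace X] {μ : Measure X} {E : Type*} [NormedAddCommGroup E]
  [InnerProductSpace ℂ E]

omit [InnerProductSpace ℂ E] in
-- Multipliers pass to any map that factors boundedly through `ι`, for instance from `V` to `A^(-s)`
-- with `s ≥ 1/2`.
theorem IsMultiplier.of_range {D D' : Type*} {b : X → ℝ} {ι : D → Lp E 2 μ} {N : D → ℝ}
    (h : IsMultiplier b ι N) {ι' : D' → Lp E 2 μ} {N' : D' → ℝ} (hN' : ∀ f, 0 ≤ N' f)
    (hr : ∃ K : ℝ, ∀ f, ∃ v, ι v = ι' f ∧ N v ≤ K * N' f) : IsMultiplier b ι' N' := by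
  obtain ⟨K₁, hK₁, h⟩ := h
  obtain ⟨K₂, hr⟩ := hr
  refine ⟨K₁ * |K₂|, by positivity, fun f => ?_⟩
  obtain ⟨v, hv, hv'⟩ := hr f
  rw [← hv, mul_assoc]
  refine (h v).trans (ENNReal.ofReal_le_ofReal (mul_le_mul_of_nonneg_left ?_ hK₁))
  exact hv'.trans (mul_le_mul_of_nonneg_right (le_abs_self _) (hN' f))

theorem IsMultiplier.const_smul {D : Type*} {b : X → ℝ} {ι : D → Lp E 2 μ} {N : D → ℝ}
    (h : IsMultiplier b ι N) (k : ℂ) : IsMultiplier b (fun f => k • ι f) N := by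
  obtain ⟨K, hK, h⟩ := h
  refine ⟨‖k‖ * K, by positivity, fun f => ?_⟩
  rw [l2_mul_smul, mul_assoc, ENNReal.ofReal_mul (norm_nonneg k), ofReal_norm]
  gcongr
  exact h f

omit [InnerProductSpace ℂ E] in
/-- Hölder's inequality. -/
theorem isMultiplier_of_embedding {D : Type*} {b : X → ℝ} (hbm : Measurable b)
    (hb : ∀ x, 0 ≤ b x) {q : ℝ} (hq : 2 < q) (hbq : MemLp b (ENNReal.ofReal (1 / (1 / 2 - 1 / q))) μ)
    {ι : D → Lp E 2 μ} {N : D → ℝ} (hN : ∀ v, 0 ≤ N v)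
    (hι : ∃ K : ℝ, ∀ v, eLpNorm (ι v) (ENNReal.ofReal q) μ ≤ ENNReal.ofReal (K * N v)) :
    IsMultiplier b ι N := by
  obtain ⟨K, hι⟩ := hι
  have h1 : 1 / q < 1 / 2 := one_div_lt_one_div_of_lt two_pos hq
  refine isMultiplier_of_eLpNorm_le hbm hb (inv_ofReal_add_inv_ofReal ?_ (by linarith) ?_)
    hbq hN hι
  · exact one_div_pos.2 (by linarith)
  · rw [one_div_one_div]
    ring

theorem IsFormResolvent.exists_norm_le_smul_of_half_lt {H V : Type*} [NormedAddCommGroup H]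
    [InnerProductSpace ℂ H] [CompleteSpace H] [NormedAddCommGroup V] [NormedSpace ℂ V]
    [CompleteSpace V] {a : V →ₗ[ℂ] V →ₗ⋆[ℂ] ℂ} {j : V →L[ℂ] H} {C c : ℝ} {S : ℝ → H →L[ℂ] V}
    (hS : IsFormResolvent a j C c S) {s : ℝ} (hs0 : 1 / 2 < s) (hs : s < 1) (k : ℂ) :
    ∃ K : ℝ, ∀ f, ∃ v, j v = (k • resolventIntegral (fun t => j ∘L S t) s) f ∧
      ‖v‖ ≤ K * ‖f‖ := by
  obtain ⟨K, hK⟩ := hS.exists_norm_le_of_half_lt hs0 hs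
  refine ⟨‖k‖ * K, fun f => ?_⟩
  obtain ⟨v, hv, hv'⟩ := hK f
  refine ⟨k • v, by rw [map_smul, hv, smul_apply], ?_⟩
  rw [norm_smul, mul_assoc]
  gcongr

variable [SFinite μ] [CompleteSpace E] {V : Type*} [NormedAddCommGroup V] [NormedSpace ℂ V]
  {a : V →ₗ[ℂ] V →ₗ⋆[ℂ] ℂ} {j : V →L[ℂ] Lp E 2 μ} {C c : ℝ} {S : ℝ → Lp E 2 μ →L[ℂ] V}

/-- Hölder from `L_q` to `L₂` needs a weight in `L_{1/y}` with `y = 1/2 - 1/q`. As `y` is the convex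
combination of the endpoint values `y₀`, `y₁` with weights `2γ`, `1 - 2γ`, and `b ∈ L_{1/y}`, the
powers `b^(y₀/y)` and `b^(y₁/y)` have exactly the integrability required in `V` and `D(A)`. -/
theorem IsFormResolvent.isMultiplier_of_embedding_of_half_lt (hS : IsFormResolvent a j C c S)
    {b : X → ℝ} (hbm : Measurable b) (hb : ∀ x, 0 ≤ b x) {p q γ : ℝ} (hp : 2 < p) (hpq : p < q)
    (hγ0 : 0 < γ) (hγ : γ < 1 / 2)
    (hbp : MemLp b (ENNReal.ofReal
      (1 / (2 * γ * (1 / 2 - 1 / p) + (1 - 2 * γ) * (1 / 2 - 1 / q)))) μ)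
    (hV : ∃ K : ℝ, ∀ v, eLpNorm (j v) (ENNReal.ofReal p) μ ≤ ENNReal.ofReal (K * ‖v‖))
    (hD : ∃ K : ℝ, ∀ f, eLpNorm (j (S 0 f)) (ENNReal.ofReal q) μ ≤ ENNReal.ofReal (K * ‖f‖)) :
    IsMultiplier b
      (fun f : Lp E 2 μ => resolventIntegral (fun t => j ∘L S t) (1 - γ) f) (fun f => ‖f‖) := by
  have hp1 : 1 / p < 1 / 2 := one_div_lt_one_div_of_lt two_pos hp
  have hq1 : 1 / q < 1 / p := one_div_lt_one_div_of_lt (by linarith) hpq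
  set y₀ : ℝ := 1 / 2 - 1 / p with hy₀
  set y₁ : ℝ := 1 / 2 - 1 / q with hy₁
  set y : ℝ := 2 * γ * y₀ + (1 - 2 * γ) * y₁ with hy
  have h₀ : 0 < y₀ := by linarith
  have h₁ : 0 < y₁ := by linarith
  have h₀₁ : 0 < y₁ - y₀ := by linarith
  have hy0 : 0 < y := by
    have := mul_pos hγ0 h₀
    have := mul_pos (show 0 < 1 - 2 * γ by linarith) h₁
    linarith
  -- The exponents of `β` at the endpoints differ by `ε₀ + ε₁ = 1/2`; `ρ` rescales `y₁ - y₀` to this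
  -- length.
  set ρ : ℝ := 1 / (2 * (y₁ - y₀)) with hρ
  have hρ0 : 0 < ρ := by positivity
  have hρy : ρ * (y₁ - y₀) = 1 / 2 := by
    rw [hρ]
    field_simp
  have e₀ : ρ * y - (1 - γ - 1 / 2) = ρ * y₀ := by
    linear_combination (1 - 2 * γ) * hρy + ρ * hy
  have e₁ : ρ * y + (1 - (1 - γ)) = ρ * y₁ := by
    linear_combination (-2 * γ) * hρy + ρ * hy
  have hbpow : ∀ θ, (fun x => (b x ^ (1 / (ρ * y))) ^ (ρ * θ)) = fun x => b x ^ (θ / y) := by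
    intro θ
    ext x
    rw [← Real.rpow_mul (hb x)]
    congr 1
    field_simp
  have hm : ∀ θ, 0 < θ → MemLp (fun x => b x ^ (θ / y)) (ENNReal.ofReal (1 / θ)) μ := by
    intro θ hθ
    refine memLp_rpow hb (by positivity) ?_
    rwa [one_div_mul_eq_div, div_div_cancel_left' hθ.ne', ← one_div]
  have := hS.isMultiplier_of_half_lt (β := fun x => b x ^ (1 / (ρ * y))) (hbm.pow_const _)
    (fun x => Real.rpow_nonneg (hb x) _) (s := 1 - γ) (κ := ρ * y) (by linarith) (by linarith)
    (by positivity)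
    (by
      rw [e₀, hbpow]
      exact isMultiplier_of_embedding (hbm.pow_const _) (fun x => Real.rpow_nonneg (hb x) _) hp
        (hm _ h₀) (fun _ => norm_nonneg _) hV)
    (by
      rw [e₁, hbpow]
      exact isMultiplier_of_embedding (hbm.pow_const _) (fun x => Real.rpow_nonneg (hb x) _)
        (hp.trans hpq) (hm _ h₁) (fun _ => norm_nonneg _) hD)
  rw [hbpow] at this
  simpa only [div_self hy0.ne', Real.rpow_one] using this

theorem IsFormResolvent.isMultiplier_of_embedding_of_lt_half (hS : IsFormResolvent a j C c S)
    {b : X → ℝ} (hbm : Measurable b) (hb : ∀ x, 0 ≤ b x) {p s : ℝ} (hp : 2 < p)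
    (hs0 : 0 < s) (hs : s < 1 / 2)
    (hbp : MemLp b (ENNReal.ofReal (1 / (1 / 2 - 1 / p) * (1 / (2 * s)))) μ)
    (hV : ∃ K : ℝ, ∀ v, eLpNorm (j v) (ENNReal.ofReal p) μ ≤ ENNReal.ofReal (K * ‖v‖)) :
    IsMultiplier b
      (fun f : Lp E 2 μ => resolventIntegral (fun t => j ∘L S t) s f) (fun f => ‖f‖) :=
  hS.isMultiplier_of_lt_half hbm hb hs0 hs
    (isMultiplier_of_embedding (hbm.pow_const _) (fun x => Real.rpow_nonneg (hb x) _) hp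
      (memLp_rpow hb (by positivity) hbp) (fun _ => norm_nonneg _) hV)

end Transfer

/-! ### Multiplication by a matrix-valued function -/

section Matrix

variable {d n : ℕ} {Ω : Set (EuclideanSpace ℝ (Fin d))}
  {M : EuclideanSpace ℝ (Fin d) → Matrix (Fin n) (Fin n) ℂ}

theorem continuous_toEuclideanCLM :
    Continuous (Matrix.toEuclideanCLM (n := Fin n) (𝕜 := ℂ)) :=
  (AddMonoidHomClass.isometry_of_norm (Matrix.toEuclideanCLM (n := Fin n) (𝕜 := ℂ))
    Matrix.l2_opNorm_toEuclideanCLM).continuous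

/-- The interpolation uses real powers and level sets of the weight, hence an everywhere measurable
and nonnegative representative. -/
theorem exists_measurable_norm {r : ℝ≥0∞} (hM : MemLp M r (volume.restrict Ω)) :
    ∃ b : EuclideanSpace ℝ (Fin d) → ℝ, Measurable b ∧ (∀ x, 0 ≤ b x) ∧
      (∀ᵐ x ∂(volume.restrict Ω), b x = ‖M x‖) ∧ MemLp b r (volume.restrict Ω) := by
  have h : ∀ᵐ x ∂(volume.restrict Ω), ‖hM.1.mk M x‖ = ‖M x‖ := by
    filter_upwards [hM.1.ae_eq_mk] with x hx
    rw [← hx]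
  exact ⟨fun x => ‖hM.1.mk M x‖, hM.1.stronglyMeasurable_mk.norm.measurable,
    fun _ => norm_nonneg _, h, hM.norm.ae_eq (h.mono fun _ hx => hx.symm)⟩

/-- The pointwise bound `|M u| ≤ ‖M‖ |u|` carries the scalar multiplier estimate over to the matrix,
and makes the products square integrable so that the operator exists. -/
theorem exists_isMulBy {D : Type*} [AddCommGroup D] [Module ℂ D] (ι : D →ₗ[ℂ] L2 Ω n)
    (hM : AEStronglyMeasurable M (volume.restrict Ω)) {b : EuclideanSpace ℝ (Fin d) → ℝ}
    (hb : ∀ᵐ x ∂(volume.restrict Ω), b x = ‖M x‖) {N : D → ℝ} (hN : ∀ v, 0 ≤ N v)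
    (h : IsMultiplier b ι N) :
    ∃ T : D →ₗ[ℂ] L2 Ω n, (∀ v, IsMulBy M (ι v) (T v)) ∧ ∃ K : ℝ, ∀ v, ‖T v‖ ≤ K * N v := by
  obtain ⟨K, hK, h⟩ := h
  let m : D → EuclideanSpace ℝ (Fin d) → EuclideanSpace ℂ (Fin n) :=
    fun v x => Matrix.toEuclideanCLM (𝕜 := ℂ) (M x) (ι v x)
  have hmm : ∀ v, AEStronglyMeasurable (m v) (volume.restrict Ω) := fun v =>
    isBoundedBilinearMap_apply.continuous.comp_aestronglyMeasurable
      ((continuous_toEuclideanCLM.comp_aestronglyMeasurable hM).prodMk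
        (Lp.aestronglyMeasurable (ι v)))
  have hle : ∀ v, eLpNorm (m v) 2 (volume.restrict Ω) ≤ ENNReal.ofReal (K * N v) := by
    intro v
    refine le_trans ?_ (h v)
    rw [← l2_enorm_eq]
    refine l2_mono (hb.mono fun x hx => ?_)
    rw [hx, ← Matrix.l2_opNorm_toEuclideanCLM, ofReal_norm]
    exact (Matrix.toEuclideanCLM (𝕜 := ℂ) (M x)).le_opENorm _
  have hmem : ∀ v, MemLp (m v) 2 (volume.restrict Ω) := fun v =>
    ⟨hmm v, (hle v).trans_lt ENNReal.ofReal_lt_top⟩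
  let T : D →ₗ[ℂ] L2 Ω n :=
    { toFun := fun v => (hmem v).toLp
      map_add' := fun v w => by
        rw [← MemLp.toLp_add]
        refine MemLp.toLp_congr _ _ ?_
        filter_upwards [Lp.coeFn_add (ι v) (ι w)] with x hx
        simp only [m, Pi.add_apply, map_add, hx]
      map_smul' := fun k v => by
        rw [RingHom.id_apply, ← MemLp.toLp_const_smul]
        refine MemLp.toLp_congr _ _ ?_
        filter_upwards [Lp.coeFn_smul k (ι v)] with x hx
        simp only [m, Pi.smul_apply, map_smul, hx] }
  refine ⟨T, fun v => (hmem v).coeFn_toLp, K, fun v => ?_⟩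
  change ‖(hmem v).toLp‖ ≤ _
  rw [Lp.norm_toLp]
  exact ENNReal.toReal_le_of_le_ofReal (mul_nonneg hK (hN v)) (hle v)

variable {V : Submodule ℂ (W12 Ω n)} {a : V →ₗ[ℂ] V →ₗ⋆[ℂ] ℂ} {C c : ℝ}
  {S : ℝ → L2 Ω n →L[ℂ] V} {b : EuclideanSpace ℝ (Fin d) → ℝ}

theorem IsResolvent.exists_isBoundedMul (hS : IsResolvent a C c S)
    (hM : AEStronglyMeasurable M (volume.restrict Ω))
    (hb : ∀ᵐ x ∂(volume.restrict Ω), b x = ‖M x‖) {s : ℝ} (hs0 : 0 ≤ s) (hs : s ≤ 1)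
    (h : IsMultiplier b (fun f => negPow (formOp a) s f) (fun f => ‖f‖)) :
    ∃ T, IsBoundedMul M (formOp a) s T :=
  exists_isMulBy (fracPow (formOp a) s).domain.subtype hM hb (fun _ => norm_nonneg _)
    (h.of_range (fun _ => norm_nonneg _) ⟨1, fun u => by
      obtain ⟨f, hf⟩ := IsPositiveOp.mem_fracPow_domain.1 u.2
      refine ⟨f, hf, ?_⟩
      rw [hS.isPositiveOp.fracPow_apply hs0 hs u hf, one_mul]⟩)

theorem IsResolvent.isMultiplier_negPow (hS : IsResolvent a C c S) {s : ℝ} (hs0 : 0 < s)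
    (hs : s < 1)
    (h : IsMultiplier b (fun f => resolventIntegral (fun t => incl V ∘L S t) s f)
      (fun f => ‖f‖)) :
    IsMultiplier b (fun f => negPow (formOp a) s f) (fun f => ‖f‖) := by
  rw [hS.isPositiveOp.negPow_eq hs0 hs]
  exact h.const_smul _

/-- For a Kato operator the domain of a power of order at least `1 / 2` is contained in `V`. -/
theorem IsKato.exists_incl_eq_negPow (hVclosed : IsClosed (V : Set (W12 Ω n))) (ha : IsKato a)
    (hS : IsResolvent a C c S) {s : ℝ} (hs0 : 1 / 2 ≤ s) (hs : s ≤ 1) :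
    ∃ K : ℝ, ∀ f, ∃ v : V, incl V v = negPow (formOp a) s f ∧ ‖v‖ ≤ K * ‖f‖ := by
  have hA := hS.isPositiveOp
  -- Only `s = 1/2` uses `H_{1/2} = V`; for larger `s` the bounds of the form suffice.
  rcases hs0.eq_or_lt with rfl | hs0
  · obtain ⟨-, -, hr, k, _, hk, hk'⟩ := ha
    refine ⟨k⁻¹, fun f => ?_⟩
    have hm : negPow (formOp a) (1 / 2) f ∈ (fracPow (formOp a) (1 / 2)).domain :=
      IsPositiveOp.mem_fracPow_domain.2 ⟨f, rfl⟩
    obtain ⟨v, hv⟩ := hr.ge hm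
    refine ⟨v, hv, ?_⟩
    have h1 := (hk' v ⟨_, hm⟩ hv).1
    rw [hA.fracPow_apply (by norm_num) (by norm_num) ⟨_, hm⟩ rfl] at h1
    rwa [inv_mul_eq_div, le_div_iff₀' hk]
  rcases hs.eq_or_lt with rfl | hs
  · refine ⟨(√c)⁻¹ * (0 + c) ^ (-(1 / 2 : ℝ)), fun f => ⟨S 0 f, ?_, hS.norm_apply_le le_rfl f⟩⟩
    rw [hA.negPow_one]
    rfl
  · have := completeSpace_of_isClosed hVclosed
    rw [hA.negPow_eq (by linarith) hs]
    exact hS.exists_norm_le_smul_of_half_lt hs0 hs _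

end Matrix

/-! ### The conditions on the exponents -/

section Exponents

variable {d n : ℕ} {Ω : Set (EuclideanSpace ℝ (Fin d))} {V : Submodule ℂ (W12 Ω n)}
  {b : EuclideanSpace ℝ (Fin d) → ℝ} {pstar : ℝ} {r : ℝ≥0∞}

theorem two_mul_div_sub_two {p : ℝ} (hp : 2 < p) : 2 * p / (p - 2) = 1 / (1 / 2 - 1 / p) := by
  have h1 : p ≠ 0 := by linarith
  have h2 : p - 2 ≠ 0 := by linarith
  have h3 : 1 / 2 - 1 / p = (p - 2) / (2 * p) := by field_simp
  rw [h3, one_div_div]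

theorem EmbedsInLp.isMultiplier_incl (hbm : Measurable b) (hb : ∀ x, 0 ≤ b x) (hp : 2 < pstar)
    (hSob : EmbedsInLp V (ENNReal.ofReal pstar))
    (hbp : MemLp b (ENNReal.ofReal (2 * pstar / (pstar - 2))) (volume.restrict Ω)) :
    IsMultiplier b (incl V) (fun v => ‖v‖) := by
  rw [two_mul_div_sub_two hp] at hbp
  exact isMultiplier_of_embedding hbm hb hp hbp (fun v => norm_nonneg v) hSob

theorem embedsInLp_two : EmbedsInLp V 2 := by
  refine ⟨1, fun v => ?_⟩
  rw [one_mul, ← Lp.enorm_def, ← ofReal_norm]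
  exact ENNReal.ofReal_le_ofReal (norm_incl_le v)

/-- Hölder with the partner exponent `∞` for `d = 1`, the `q` with `1/r + 1/q = 1/2` for `d = 2` (`q
= 2` if `r = ∞`), and `p⋆` for `d ≥ 3`. -/
theorem GoodExponent.isMultiplier_incl (hr : GoodExponent d pstar r) (hV : LowDimEmbedding V)
    (hbm : Measurable b) (hb : ∀ x, 0 ≤ b x) (hp : 2 < pstar)
    (hSob : EmbedsInLp V (ENNReal.ofReal pstar)) (hbr : MemLp b r (volume.restrict Ω)) :
    IsMultiplier b (incl V) (fun v => ‖v‖) := by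
  rcases hr with ⟨hd, rfl⟩ | ⟨hd, hr⟩ | ⟨hd, rfl⟩
  · obtain ⟨K, hK⟩ := hV.1 hd
    exact isMultiplier_of_eLpNorm_le hbm hb (by simp) hbr (fun v => norm_nonneg v) hK
  · rcases eq_or_ne r ⊤ with rfl | hrt
    · obtain ⟨K, hK⟩ := embedsInLp_two (V := V)
      exact isMultiplier_of_eLpNorm_le hbm hb (by simp) hbr (fun v => norm_nonneg v) hK
    · lift r to NNReal using hrt
      have hr2 : (2 : ℝ) < r := by exact_mod_cast hr
      have h1 : 1 / (r : ℝ) < 1 / 2 := one_div_lt_one_div_of_lt two_pos hr2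
      have h2 : (2 : ℝ) < 1 / (1 / 2 - 1 / r) := by
        rw [lt_one_div two_pos (by linarith)]
        have : 0 < 1 / (r : ℝ) := one_div_pos.2 (by linarith)
        linarith
      obtain ⟨K, hK⟩ := hV.2 hd (ENNReal.ofReal (1 / (1 / 2 - 1 / r)))
        (by rw [← ENNReal.ofReal_ofNat]; exact (ENNReal.ofReal_lt_ofReal_iff (by linarith)).2 h2)
        ENNReal.ofReal_lt_top
      refine isMultiplier_of_eLpNorm_le hbm hb ?_ hbr (fun v => norm_nonneg v) hK
      rw [← ENNReal.ofReal_coe_nnreal]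
      refine inv_ofReal_add_inv_ofReal (by linarith) (by linarith) ?_
      rw [one_div_one_div]
      ring
  · exact hSob.isMultiplier_incl hbm hb hp hbr

theorem ofReal_le_of_le_gammaZero (hp : 2 < pstar) (hr : 1 ≤ r) {γ : ℝ} (hγ1 : γ < 1)
    (hγ : γ ≤ gammaZero pstar r) :
    ENNReal.ofReal (pstar / ((pstar - 2) * (1 - γ))) ≤ r := by
  rcases eq_or_ne r ⊤ with rfl | hrt
  · exact le_top
  · have hr0 : 0 < r.toReal :=
      ENNReal.toReal_pos (zero_lt_one.trans_le hr).ne' hrt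
    rw [gammaZero, if_neg hrt] at hγ
    rw [ENNReal.ofReal_le_iff_le_toReal hrt, div_le_iff₀ (mul_pos (by linarith) (by linarith))]
    have h1 : pstar / ((pstar - 2) * r.toReal) ≤ 1 - γ := by linarith
    rw [div_le_iff₀ (mul_pos (by linarith) hr0)] at h1
    linarith

/-- In the reciprocal exponents `y = 1/2 - 1/q` the threshold solves `2γ y₀ + (1 - 2γ) y₁ = 1/r`,
with `y₀`, `y₁` belonging to `p⋆`, `p`. -/
theorem gammaP_eq (r : ℝ≥0∞) (pstar p : ℝ) :
    gammaP pstar r p = ((1 / 2 - 1 / p) - 1 / r.toReal) /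
      (2 * ((1 / 2 - 1 / p) - (1 / 2 - 1 / pstar))) := by
  have h : 2 * ((1 / 2 - 1 / p) - (1 / 2 - 1 / pstar)) = 2 * (1 / pstar - 1 / p) := by ring
  rw [h, gammaP, div_eq_mul_inv _ (2 * _), mul_inv]
  ring

/-- The hypotheses on `r` and `p` say that `1/r` lies in `(y₀, y₁]`; this is what places the
threshold in `[0, 1/2)`. -/
theorem lt_of_two_mul_div_le (hp : 2 < pstar) (hr2 : 2 < r)
    (hr : r < ENNReal.ofReal (2 * pstar / (pstar - 2))) {p : ℝ}
    (hpr : 2 * r.toReal / (r.toReal - 2) ≤ p) :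
    2 < r.toReal ∧ pstar < p ∧ 1 / r.toReal ≤ 1 / 2 - 1 / p ∧ 1 / 2 - 1 / pstar < 1 / r.toReal := by
  have hrt : r ≠ ⊤ := hr.ne_top
  have h2 : 2 < r.toReal := by
    have := (ENNReal.toReal_lt_toReal ENNReal.ofNat_ne_top hrt).2 hr2
    simpa using this
  have h3 : r.toReal < 1 / (1 / 2 - 1 / pstar) := by
    rw [← two_mul_div_sub_two hp]
    exact (ENNReal.lt_ofReal_iff_toReal_lt hrt).1 hr
  rw [two_mul_div_sub_two h2] at hpr
  have h4 : 1 / r.toReal < 1 / 2 := one_div_lt_one_div_of_lt two_pos h2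
  have h5 : 1 / pstar < 1 / 2 := one_div_lt_one_div_of_lt two_pos hp
  have h6 : 1 / 2 - 1 / pstar < 1 / r.toReal := by
    rwa [lt_one_div (by linarith) (by linarith)]
  have hp0 : 0 < p := lt_of_lt_of_le (one_div_pos.2 (by linarith)) hpr
  have h7 : 1 / p ≤ 1 / 2 - 1 / r.toReal := by
    rwa [one_div_le hp0 (by linarith)]
  refine ⟨h2, ?_, by linarith, h6⟩
  exact lt_of_one_div_lt_one_div hp0 (by linarith)

theorem gammaP_mem_Ico (hp : 2 < pstar) (hr2 : 2 < r)
    (hr : r < ENNReal.ofReal (2 * pstar / (pstar - 2))) {p : ℝ}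
    (hpr : 2 * r.toReal / (r.toReal - 2) ≤ p) : gammaP pstar r p ∈ Set.Ico (0 : ℝ) (1 / 2) := by
  obtain ⟨_, _, h1, h2⟩ := lt_of_two_mul_div_le hp hr2 hr hpr
  rw [gammaP_eq]
  constructor
  · exact div_nonneg (by linarith) (by linarith)
  · rw [div_lt_iff₀ (by linarith)]
    linarith

theorem ofReal_le_of_le_gammaP (hp : 2 < pstar) (hr2 : 2 < r)
    (hr : r < ENNReal.ofReal (2 * pstar / (pstar - 2))) {p : ℝ}
    (hpr : 2 * r.toReal / (r.toReal - 2) ≤ p) {γ : ℝ} (hγ : γ ≤ gammaP pstar r p) :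
    ENNReal.ofReal
      (1 / (2 * γ * (1 / 2 - 1 / pstar) + (1 - 2 * γ) * (1 / 2 - 1 / p))) ≤ r := by
  obtain ⟨h0, _, h1, h2⟩ := lt_of_two_mul_div_le hp hr2 hr hpr
  rw [gammaP_eq, le_div_iff₀ (by linarith)] at hγ
  have h3 : 1 / r.toReal ≤ 2 * γ * (1 / 2 - 1 / pstar) + (1 - 2 * γ) * (1 / 2 - 1 / p) := by
    linarith
  have h4 : 0 < 1 / r.toReal := one_div_pos.2 (by linarith)
  rw [ENNReal.ofReal_le_iff_le_toReal hr.ne_top, one_div_le (by linarith) (by linarith)]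
  exact h3

end Exponents

/-! ### Boundedness and eigenvalues -/

section Main

variable {d n : ℕ} {Ω : Set (EuclideanSpace ℝ (Fin d))} {V : Submodule ℂ (W12 Ω n)}
  {a : V →ₗ[ℂ] V →ₗ⋆[ℂ] ℂ} {C c : ℝ} {S : ℝ → L2 Ω n →L[ℂ] V}
  {b : EuclideanSpace ℝ (Fin d) → ℝ} {pstar : ℝ} {r : ℝ≥0∞}

theorem IsKato.isMultiplier_negPow_of_incl (hVclosed : IsClosed (V : Set (W12 Ω n)))
    (ha : IsKato a) (hS : IsResolvent a C c S) (h : IsMultiplier b (incl V) (fun v => ‖v‖)) {γ : ℝ}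
    (hγ0 : 0 ≤ γ) (hγ : γ ≤ 1 / 2) :
    IsMultiplier b (fun f => negPow (formOp a) (1 - γ) f) (fun f => ‖f‖) :=
  h.of_range (fun _ => norm_nonneg _)
    (ha.exists_incl_eq_negPow hVclosed hS (by linarith) (by linarith))

theorem IsKato.isMultiplier_negPow_of_le_gammaZero [IsFiniteMeasure (volume.restrict Ω)]
    (hVclosed : IsClosed (V : Set (W12 Ω n))) (ha : IsKato a) (hS : IsResolvent a C c S)
    (hbm : Measurable b) (hb : ∀ x, 0 ≤ b x) (hp : 2 < pstar)
    (hSob : EmbedsInLp V (ENNReal.ofReal pstar)) (hr : 1 ≤ r)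
    (hbr : MemLp b r (volume.restrict Ω)) {γ : ℝ}
    (hγ0 : 1 / 2 ≤ γ) (hγ1 : γ < 1) (hγ : γ ≤ gammaZero pstar r) :
    IsMultiplier b (fun f => negPow (formOp a) (1 - γ) f) (fun f => ‖f‖) := by
  have hb1 := hbr.mono_exponent (ofReal_le_of_le_gammaZero hp hr hγ1 hγ)
  have hp0 : pstar - 2 ≠ 0 := by linarith
  -- At `γ = 1/2` the interpolation between `H` and `V` degenerates (`ε₁ = 0`), and the Kato
  -- property replaces it.
  rcases hγ0.eq_or_lt with rfl | hγ0
  · refine ha.isMultiplier_negPow_of_incl hVclosed hS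
      (hSob.isMultiplier_incl hbm hb hp ?_) (by norm_num) le_rfl
    convert hb1 using 2
    field_simp
    norm_num
  · refine hS.isMultiplier_negPow (by linarith) (by linarith) ?_
    refine hS.isMultiplier_of_embedding_of_lt_half hbm hb hp (by linarith) (by linarith) ?_ hSob
    have h1 : 1 - γ ≠ 0 := by linarith
    convert hb1 using 2
    rw [← two_mul_div_sub_two hp]
    field_simp

/-- The closed graph theorem upgrades the mere inclusion `D(A) ⊆ L_p` to a norm bound. -/
theorem IsResolvent.exists_eLpNorm_le (hS : IsResolvent a C c S) {p : ℝ} (hp : 1 ≤ p)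
    (hD : ∀ u : (formOp a).domain, MemLp (u : L2 Ω n) (ENNReal.ofReal p) (volume.restrict Ω)) :
    ∃ K : ℝ, ∀ f, eLpNorm (incl V (S 0 f)) (ENNReal.ofReal p) (volume.restrict Ω) ≤
      ENNReal.ofReal (K * ‖f‖) :=
  exists_eLpNorm_le_of_memLp (by simpa using hp) (incl V ∘L S 0) fun f =>
    hD ⟨incl V (S 0 f), hS.isPositiveOp.mem_domain_iff.2 ⟨f, rfl⟩⟩

theorem IsResolvent.isMultiplier_negPow_of_le_gammaP [IsFiniteMeasure (volume.restrict Ω)]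
    (hS : IsResolvent a C c S) (hbm : Measurable b) (hb : ∀ x, 0 ≤ b x) (hp : 2 < pstar)
    (hSob : EmbedsInLp V (ENNReal.ofReal pstar)) (hr2 : 2 < r)
    (hr : r < ENNReal.ofReal (2 * pstar / (pstar - 2)))
    (hbr : MemLp b r (volume.restrict Ω)) {p : ℝ}
    (hpr : 2 * r.toReal / (r.toReal - 2) ≤ p)
    (hD : ∀ u : (formOp a).domain, MemLp (u : L2 Ω n) (ENNReal.ofReal p) (volume.restrict Ω))
    {γ : ℝ} (hγ0 : 0 ≤ γ) (hγ : γ ≤ gammaP pstar r p) :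
    IsMultiplier b (fun f => negPow (formOp a) (1 - γ) f) (fun f => ‖f‖) := by
  obtain ⟨-, hpp, -⟩ := lt_of_two_mul_div_le hp hr2 hr hpr
  have hb1 := hbr.mono_exponent (ofReal_le_of_le_gammaP hp hr2 hr hpr hγ)
  have hγ1 := hγ.trans_lt (gammaP_mem_Ico hp hr2 hr hpr).2
  have hDp := hS.exists_eLpNorm_le (by linarith) hD
  -- For `γ = 0` the space is `D(A)` itself and Hölder in `L_p` is enough.
  rcases hγ0.eq_or_lt with rfl | hγ0
  · rw [sub_zero, hS.isPositiveOp.negPow_one]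
    simp only [mul_zero, zero_mul, zero_add, sub_zero, one_mul] at hb1
    exact isMultiplier_of_embedding hbm hb (hp.trans hpp) hb1 (fun f => norm_nonneg f) hDp
  · exact hS.isMultiplier_negPow (by linarith) (by linarith)
      (hS.isMultiplier_of_embedding_of_half_lt hbm hb hp hpp hγ0 hγ1 hb1 hSob hDp)

theorem IsMulBy.unique {M : EuclideanSpace ℝ (Fin d) → Matrix (Fin n) (Fin n) ℂ} {u w w' : L2 Ω n}
    (h : IsMulBy M u w) (h' : IsMulBy M u w') : w = w' := by
  refine Lp.ext ?_
  filter_upwards [h, h'] with x hx hx'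
  rw [hx, hx']

/-- One direction is the regularity of weak eigenfunctions; the other needs `D(A) ⊆ D(A^(1-γ))` and
the uniqueness of the product `M u`. -/
theorem IsResolvent.isWeakEigenvalue_iff_isMulEigenvalue (hS : IsResolvent a C c S)
    {M : EuclideanSpace ℝ (Fin d) → Matrix (Fin n) (Fin n) ℂ} {γ : ℝ} (h0 : 0 ≤ γ) (h1 : γ ≤ 1)
    {T : (fracPow (formOp a) (1 - γ)).domain →ₗ[ℂ] L2 Ω n}
    (hT : ∀ u : (fracPow (formOp a) (1 - γ)).domain, IsMulBy M (u : L2 Ω n) (T u)) (z : ℂ) :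
    IsWeakEigenvalue (formOp a) γ (toExtrap (formOp a) γ ∘ₗ T) z ↔
      IsMulEigenvalue M (formOp a) z := by
  rw [hS.isPositiveOp.isWeakEigenvalue_iff h0 h1]
  constructor
  · rintro ⟨u, hu, hg⟩
    obtain ⟨y, hy, hy'⟩ := (formOp a).mem_graph_iff.1 hg
    have hy : (y : L2 Ω n) = u := hy
    refine ⟨y, fun h => hu (Subtype.ext ?_), T u, hy ▸ hT u, ?_⟩
    · rw [← hy, h]
      rfl
    · rw [hy', hy, add_sub_cancel_left]
  · rintro ⟨u, hu, w, hw, he⟩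
    have hm : (u : L2 Ω n) ∈ (fracPow (formOp a) (1 - γ)).domain :=
      hS.isPositiveOp.domain_le_fracPow_domain (by linarith) (by linarith) u.2
    refine ⟨⟨u, hm⟩, fun h => hu ?_, ?_⟩
    · have h' : (u : L2 Ω n) = 0 := congrArg Subtype.val h
      exact Subtype.ext h'
    rw [(hT ⟨u, hm⟩).unique hw, ← he, add_sub_cancel]
    exact (formOp a).mem_graph u

end Main

end WeakEv

end

/-! ### The proposition -/

theorem proposition5p8 {d n : ℕ} (hd : 1 ≤ d)
    (Ω : Set (EuclideanSpace ℝ (Fin d))) (hΩ : IsOpen Ω) (hfin : volume Ω < ⊤)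
    (V : Submodule ℂ (WeakEv.W12 Ω n)) (hVclosed : IsClosed (V : Set (WeakEv.W12 Ω n)))
    (hVdense : DenseRange (WeakEv.incl V))
    (pstar : ℝ) (hpstar : 2 < pstar) (hSob : WeakEv.EmbedsInLp V (ENNReal.ofReal pstar))
    (r : ℝ≥0∞) (hr : 1 ≤ r)
    (Bt : EuclideanSpace ℝ (Fin d) → Matrix (Fin n) (Fin n) ℂ)
    (hBt : MemLp Bt r (volume.restrict Ω)) :
    -- boundedness `V → H`
    (WeakEv.GoodExponent d pstar r → WeakEv.LowDimEmbedding V →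
      ∃ T : V →L[ℂ] WeakEv.L2 Ω n, ∀ v : V, WeakEv.IsMulBy Bt (WeakEv.incl V v) (T v)) ∧
    ∀ a : V →ₗ[ℂ] V →ₗ⋆[ℂ] ℂ, WeakEv.IsKato a →
      -- boundedness `H_{1-γ} → H` for `γ ≥ 1/2`
      (∀ γ : ℝ, 1 / 2 ≤ γ → γ < 1 → γ ≤ WeakEv.gammaZero pstar r →
        ∃ T, WeakEv.IsBoundedMul Bt (WeakEv.formOp a) (1 - γ) T) ∧
      -- boundedness `H_{1-γ} → H` for `γ < 1/2`
      (2 < r → r < ENNReal.ofReal (2 * pstar / (pstar - 2)) →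
        ∀ p : ℝ, 2 * r.toReal / (r.toReal - 2) ≤ p →
        (∀ u : (WeakEv.formOp a).domain,
          MemLp (u : WeakEv.L2 Ω n) (ENNReal.ofReal p) (volume.restrict Ω)) →
        WeakEv.gammaP pstar r p ∈ Set.Ico (0 : ℝ) (1 / 2) ∧
        ∀ γ : ℝ, 0 ≤ γ → γ ≤ WeakEv.gammaP pstar r p →
          ∃ T, WeakEv.IsBoundedMul Bt (WeakEv.formOp a) (1 - γ) T) ∧
      -- weak eigenvalues are eigenvalues
      (∀ γ : ℝ, 0 ≤ γ → γ < 1 →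
        ((WeakEv.GoodExponent d pstar r ∧ WeakEv.LowDimEmbedding V ∧ γ ≤ 1 / 2) ∨
         (1 / 2 ≤ WeakEv.gammaZero pstar r ∧ γ ≤ WeakEv.gammaZero pstar r) ∨
         (2 < r ∧ r < ENNReal.ofReal (2 * pstar / (pstar - 2)) ∧
          ∃ p : ℝ, 2 * r.toReal / (r.toReal - 2) ≤ p ∧
            (∀ u : (WeakEv.formOp a).domain,
              MemLp (u : WeakEv.L2 Ω n) (ENNReal.ofReal p) (volume.restrict Ω)) ∧
            γ ≤ WeakEv.gammaP pstar r p)) →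
        ∃ T, WeakEv.IsBoundedMul Bt (WeakEv.formOp a) (1 - γ) T ∧
          ∀ z : ℂ,
            WeakEv.IsWeakEigenvalue (WeakEv.formOp a) γ
                (WeakEv.toExtrap (WeakEv.formOp a) γ ∘ₗ T) z ↔
              WeakEv.IsMulEigenvalue Bt (WeakEv.formOp a) z) := by
  have : IsFiniteMeasure (volume.restrict Ω) := ⟨by simpa using hfin⟩
  obtain ⟨b, hbm, hb, hbB, hbr⟩ := WeakEv.exists_measurable_norm hBt
  refine ⟨fun hg hlow => ?_, fun a ha => ?_⟩
  · obtain ⟨T, hT, K, hK⟩ := WeakEv.exists_isMulBy (WeakEv.incl V : V →ₗ[ℂ] WeakEv.L2 Ω n) hBt.1 hbB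
      (fun v => norm_nonneg v) (hg.isMultiplier_incl hlow hbm hb hpstar hSob hbr)
    exact ⟨T.mkContinuous K hK, hT⟩
  obtain ⟨C, c, S, hS⟩ := ha.exists_isFormResolvent hVclosed hVdense
  have h2 : ∀ γ : ℝ, 1 / 2 ≤ γ → γ < 1 → γ ≤ WeakEv.gammaZero pstar r →
      ∃ T, WeakEv.IsBoundedMul Bt (WeakEv.formOp a) (1 - γ) T := fun γ h0 h1 hγ =>
    hS.exists_isBoundedMul hBt.1 hbB (by linarith) (by linarith)
      (ha.isMultiplier_negPow_of_le_gammaZero hVclosed hS hbm hb hpstar hSob hr hbr h0 h1 hγ)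
  have hV : ∀ γ : ℝ, 0 ≤ γ → γ ≤ 1 / 2 →
      WeakEv.IsMultiplier b (WeakEv.incl V) (fun v => ‖v‖) →
      ∃ T, WeakEv.IsBoundedMul Bt (WeakEv.formOp a) (1 - γ) T := fun γ h0 h1 h =>
    hS.exists_isBoundedMul hBt.1 hbB (by linarith) (by linarith)
      (ha.isMultiplier_negPow_of_incl hVclosed hS h h0 h1)
  have h3 : 2 < r → r < ENNReal.ofReal (2 * pstar / (pstar - 2)) →
      ∀ p : ℝ, 2 * r.toReal / (r.toReal - 2) ≤ p →
      (∀ u : (WeakEv.formOp a).domain,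
        MemLp (u : WeakEv.L2 Ω n) (ENNReal.ofReal p) (volume.restrict Ω)) →
      ∀ γ : ℝ, 0 ≤ γ → γ ≤ WeakEv.gammaP pstar r p →
        ∃ T, WeakEv.IsBoundedMul Bt (WeakEv.formOp a) (1 - γ) T := by
    intro hr2 hr' p hp hD γ h0 hγ
    have h1 := (WeakEv.gammaP_mem_Ico hpstar hr2 hr' hp).2
    exact hS.exists_isBoundedMul hBt.1 hbB (by linarith) (by linarith)
      (hS.isMultiplier_negPow_of_le_gammaP hbm hb hpstar hSob hr2 hr' hbr hp hD h0 hγ)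
  refine ⟨h2, fun hr2 hr' p hp hD => ⟨WeakEv.gammaP_mem_Ico hpstar hr2 hr' hp,
    h3 hr2 hr' p hp hD⟩, fun γ h0 h1 h => ?_⟩
  obtain ⟨T, hT⟩ : ∃ T, WeakEv.IsBoundedMul Bt (WeakEv.formOp a) (1 - γ) T := by
    rcases h with ⟨hg, hlow, hγ⟩ | ⟨hg, hγ⟩ | ⟨hr2, hr', p, hp, hD, hγ⟩
    · exact hV γ h0 hγ (hg.isMultiplier_incl hlow hbm hb hpstar hSob hbr)
    · rcases le_total (1 / 2) γ with h | h
      · exact h2 γ h h1 hγ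
      -- For `γ ≤ 1/2` the condition `1/2 ≤ gammaZero` already gives `r ≥ 2 p⋆ / (p⋆ - 2)`, so
      -- multiplication is bounded on `V`, which contains `H_{1-γ}`.
      · refine hV γ h0 h (hSob.isMultiplier_incl hbm hb hpstar (hbr.mono_exponent ?_))
        refine le_trans (le_of_eq ?_) (WeakEv.ofReal_le_of_le_gammaZero hpstar hr
          (by norm_num : (1 / 2 : ℝ) < 1) hg)
        have hp0 : pstar - 2 ≠ 0 := by linarith
        congr 1
        field_simp
        norm_num
    · exact h3 hr2 hr' p hp hD γ h0 hγ
  exact ⟨T, hT, hS.isWeakEigenvalue_iff_isMulEigenvalue h0 h1.le hT.1⟩
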